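/- **Bray's Conjecture.** Fix $n$ and let $Y_n$ be the set of tuples $(w_{ij},w_{ijk},w_{ijkl},y_{ijk},y_{ijkl})$ of real numbers (all indices running over $n$ values) with $\det(w_{ij})\neq 0$. Let $L:Y_n\to\mathbb R$ be a smooth function that is, for fixed $(w_{ij})$, of degree at most two in the remaining variables, in the sense that $D_uD_vD_wL=0$ for all directions $u,v,w$ with vanishing $(w_{ij})$-part. For a Lorentz metric $g$ (signature $(-,+,\dots,+)$) and an arbitrary smooth affine connection $\nabla$ on the tangent bundle of a smooth $n$-manifold $M$ (Hausdorff, second countable), write in a coordinate system $\Gamma_{ijk}=g(\nabla_{\partial_i}\partial_j,\partial_k)$, and let commas denote partial derivatives. Suppose that for every such triple $(M,g,\nabla)$ there is $f_{g,\nabla}\in C^\infty(M)$ such that $$L(g_{ij},g_{ij,k},g_{ij,kl},\Gamma_{ijk},\Gamma_{ijk,l})=f_{g,\nabla}$$ in all coordinate systems on $M$. Then there are constants $a,b,c\in\mathbb R$ and families of coefficients $\mu^{ijkabc}(w)$ and $\beta^{ijkl}(w)$, smooth on the set of matrices $w$ with $\det w\ne0$, such that for all triples $(M,g,\nabla)$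 $$f_{g,\nabla}=a+bR_g+c\,|d\gamma|_g^2+Q_g(D)+Bd_g(D),$$ where - $R_g$ is the scalar curvature of $g$; - $D_{ijk}=\Gamma_{ijk}-\tfrac12(g_{jk,i}+g_{ik,j}-g_{ij,k})$ is the difference tensor between $\nabla$ and the Levi-Civita connection of $g$, and $\gamma$ is the 3-form given by its fully antisymmetric part, with exterior derivative $d\gamma$ and $|d\gamma|_g^2=g^{ia}g^{jb}g^{kc}g^{ld}(d\gamma)_{ijkl}(d\gamma)_{abcd}$; - $Q_g(D)=\mu^{ijkabc}(g)\,D_{ijk}D_{abc}$ is a quadratic invariant: its value does not depend on the choice of coordinates; - $Bd_g(D)=|\det g|^{-1/2}\,\partial_l\big(|\det g|^{1/2}X^l\big)$ is a divergence term, namely the divergence of the vector field $X^l=\beta^{ijkl}(g)\,D_{ijk}$, and this vector field does not depend on the choice of coordinates. In particular there is no trace term linear in $D$. -/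

import Mathlib

open scoped Manifold ContDiff

noncomputable section

namespace BrayLagrangian

/-! ### Arrays of components and the domain of the Lagrangian -/

/-- The model space of an `n`-manifold. -/
abbrev Coord (n : ℕ) : Type := EuclideanSpace ℝ (Fin n)

/-- Arrays `w_{ij}`. -/
abbrev Arr2 (n : ℕ) : Type := Fin n → Fin n → ℝ

/-- Arrays `w_{ijk}`. -/
abbrev Arr3 (n : ℕ) : Type := Fin n → Fin n → Fin n → ℝ

/-- Arrays `w_{ijkl}`. -/
abbrev Arr4 (n : ℕ) : Type := Fin n → Fin n → Fin n → Fin n → ℝ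

/-- The vector space of all tuples `(w_{ij}, w_{ijk}, w_{ijkl}, y_{ijk}, y_{ijkl})`. -/
abbrev JetSpace (n : ℕ) : Type := Arr2 n × Arr3 n × Arr4 n × Arr3 n × Arr4 n

/-- The arrays `w_{ij}` with nonzero determinant. -/
def nondegenerate (n : ℕ) : Set (Arr2 n) := {w | (Matrix.of w).det ≠ 0}

/-- The domain of the Lagrangians: the tuples with `det (w_{ij}) ≠ 0`. -/
def jetDomain (n : ℕ) : Set (JetSpace n) := {x | x.1 ∈ nondegenerate n}

/-- `L` is, for each fixed `(w_{ij})`, a polynomial of degree at most two in the remaining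
variables: `D_u D_v D_w L = 0` on the domain for all directions `u, v, w` whose `(w_{ij})`-part
vanishes. -/
def IsQuadratic {n : ℕ} (L : JetSpace n → ℝ) : Prop :=
  ∀ x ∈ jetDomain n, ∀ u v w : JetSpace n, u.1 = 0 → v.1 = 0 → w.1 = 0 →
    lineDeriv ℝ (fun x₁ => lineDeriv ℝ (fun x₂ => lineDeriv ℝ L x₂ w) x₁ v) x u = 0

/-- The matrix `diag (-1, 1, …, 1)`. -/
def minkowski (n : ℕ) : Matrix (Fin n) (Fin n) ℝ :=
  Matrix.diagonal fun i => if (i : ℕ) = 0 then -1 else 1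

/-! ### Lorentz metrics and affine connections on manifolds -/

section Manifold

variable {n : ℕ} {M : Type*} [TopologicalSpace M] [ChartedSpace (Coord n) M]

variable (n M) in
/-- A smooth Lorentz metric: a smooth symmetric `(0,2)`-tensor field which, at each point, has the
matrix `diag (-1, 1, …, 1)` in a suitable basis of the tangent space. -/
structure LorentzMetric [IsManifold (𝓡 n) ∞ M] where
  /-- The bilinear form on each tangent space. -/
  val (p : M) : TangentSpace (𝓡 n) p →L[ℝ] TangentSpace (𝓡 n) p →L[ℝ] ℝ
  symm (p : M) (v w : TangentSpace (𝓡 n) p) : val p v w = val p w v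
  lorentz (p : M) : ∃ b : Module.Basis (Fin n) ℝ (TangentSpace (𝓡 n) p),
    ∀ i j, val p (b i) (b j) = minkowski n i j
  contMDiff : ContMDiff (𝓡 n) ((𝓡 n).prod 𝓘(ℝ, Coord n →L[ℝ] Coord n →L[ℝ] ℝ)) ∞
    (fun p => Bundle.TotalSpace.mk' (Coord n →L[ℝ] Coord n →L[ℝ] ℝ)
      (E := fun q : M => TangentSpace (𝓡 n) q →L[ℝ] TangentSpace (𝓡 n) q →L[ℝ] ℝ) p (val p))

variable (n M) in
/-- Affine connections on the tangent bundle. In Mathlib's convention `cov Y p (X p)` is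
`(∇_X Y) p`. Smoothness is the separate class `ContMDiffCovariantDerivative`. -/
abbrev AffineConnection [IsManifold (𝓡 n) ∞ M] : Type _ :=
  CovariantDerivative (𝓡 n) (Coord n) (fun p : M => TangentSpace (𝓡 n) p)

/-- The coordinate vector field `∂_i` of the chart `e` (meaningful on `e.source` only). -/
def coordField (e : OpenPartialHomeomorph M (Coord n)) (i : Fin n) (p : M) :
    TangentSpace (𝓡 n) p :=
  VectorField.mpullback (𝓡 n) (𝓡 n) e
    (fun _ => (EuclideanSpace.single i 1 : Coord n)) p

variable [IsManifold (𝓡 n) ∞ M]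

/-- The components `g_{ij} = g(∂_i, ∂_j)` as functions of the coordinates of the chart `e`. -/
def metricComp (g : LorentzMetric n M) (e : OpenPartialHomeomorph M (Coord n))
    (x : Coord n) : Arr2 n := fun i j =>
  g.val (e.symm x) (coordField e i (e.symm x)) (coordField e j (e.symm x))

/-- The Christoffel symbols `Γ_{ijk} = g(∇_{∂_i} ∂_j, ∂_k)` of the connection, as functions of the
coordinates of the chart `e`. -/
def connectionComp (g : LorentzMetric n M) (cov : AffineConnection n M)
    (e : OpenPartialHomeomorph M (Coord n)) (x : Coord n) : Arr3 n := fun i j k =>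
  g.val (e.symm x) (cov (coordField e j) (e.symm x) (coordField e i (e.symm x)))
    (coordField e k (e.symm x))

end Manifold

/-! ### Coordinate expressions

In this part `G` stands for the components of a metric and `D` for the components of a
`(0,3)`-tensor field, as functions of the coordinates. -/

section Coordinates

variable {n : ℕ}

/-- The partial derivative `∂_k f`. -/
def pd (k : Fin n) (f : Coord n → ℝ) (x : Coord n) : ℝ :=
  fderiv ℝ f x (EuclideanSpace.single k 1)

/-- The tuple `(g_{ij}, g_{ij,k}, g_{ij,kl}, Γ_{ijk}, Γ_{ijk,l})` at `x`. -/
def jet (G : Coord n → Arr2 n) (C : Coord n → Arr3 n) (x : Coord n) : JetSpace n :=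
  (G x,
    fun i j k => pd k (fun y => G y i j) x,
    fun i j k l => pd l (pd k (fun y => G y i j)) x,
    C x,
    fun i j k l => pd l (fun y => C y i j k) x)

/-- The inverse metric `g^{ij}`. -/
def inv (w : Arr2 n) : Arr2 n := fun i j => (Matrix.of w)⁻¹ i j

/-- The Levi-Civita symbols of the first kind, `½ (g_{jk,i} + g_{ik,j} - g_{ij,k})`. -/
def leviCivitaLower (G : Coord n → Arr2 n) (x : Coord n) : Arr3 n := fun i j k =>
  (pd i (fun y => G y j k) x + pd j (fun y => G y i k) x - pd k (fun y => G y i j) x) / 2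

/-- The Levi-Civita Christoffel symbols `Γ^k_{ij}`, with the upper index first. -/
def leviCivita (G : Coord n → Arr2 n) (x : Coord n) : Arr3 n := fun k i j =>
  ∑ r, inv (G x) k r * leviCivitaLower G x i j r

/-- The Ricci curvature `Ric_{ij} = dx^k(∇_k ∇_j ∂_i - ∇_j ∇_k ∂_i)`. -/
def ricci (G : Coord n → Arr2 n) (x : Coord n) : Arr2 n := fun i j =>
  ∑ k, (pd k (fun y => leviCivita G y k j i) x - pd j (fun y => leviCivita G y k k i) x
    + ∑ r, (leviCivita G x r j i * leviCivita G x k k r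
      - leviCivita G x r k i * leviCivita G x k j r))

/-- The scalar curvature `R_g = g^{ij} Ric_{ij}`. -/
def scalarCurvature (G : Coord n → Arr2 n) (x : Coord n) : ℝ :=
  ∑ i, ∑ j, inv (G x) i j * ricci G x i j

/-- The difference tensor `D_{ijk} = Γ_{ijk} - ½ (g_{jk,i} + g_{ik,j} - g_{ij,k})`. -/
def difference (G : Coord n → Arr2 n) (C : Coord n → Arr3 n) (x : Coord n) : Arr3 n :=
  fun i j k => C x i j k - leviCivitaLower G x i j k

/-- The fully antisymmetric part of an array `D_{ijk}`. -/
def antisymmPart (D : Arr3 n) : Arr3 n := fun i j k =>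
  (D i j k + D j k i + D k i j - D j i k - D i k j - D k j i) / 6

/-- The exterior derivative of a 3-form with components `γ_{ijk}`. -/
def extDeriv3 (γ : Coord n → Arr3 n) (x : Coord n) : Arr4 n := fun i j k l =>
  pd i (fun y => γ y j k l) x - pd j (fun y => γ y i k l) x
    + pd k (fun y => γ y i j l) x - pd l (fun y => γ y i j k) x

/-- The squared norm `|T|_g² = g^{ia} g^{jb} g^{kc} g^{ld} T_{ijkl} T_{abcd}`. -/
def normSq4 (w : Arr2 n) (T : Arr4 n) : ℝ :=
  ∑ i, ∑ j, ∑ k, ∑ l, ∑ a, ∑ b, ∑ c, ∑ d,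
    inv w i a * inv w j b * inv w k c * inv w l d * T i j k l * T a b c d

/-- `μ^{IJ}(w) D_I D_J`. -/
def quadForm (μ : Arr2 n → Fin n → Fin n → Fin n → Arr3 n) (w : Arr2 n) (D : Arr3 n) : ℝ :=
  ∑ i, ∑ j, ∑ k, ∑ a, ∑ b, ∑ c, μ w i j k a b c * D i j k * D a b c

/-- The vector `X^l = β^{ijkl}(w) D_{ijk}`. -/
def contraction (β : Arr2 n → Arr4 n) (w : Arr2 n) (D : Arr3 n) : Fin n → ℝ := fun l =>
  ∑ i, ∑ j, ∑ k, β w i j k l * D i j k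

/-- The divergence `|det g|^{-1/2} ∂_l (|det g|^{1/2} X^l)` of a vector field. -/
def divergence (G : Coord n → Arr2 n) (X : Coord n → Fin n → ℝ) (x : Coord n) : ℝ :=
  (√|(Matrix.of (G x)).det|)⁻¹ * ∑ l, pd l (fun y => √|(Matrix.of (G y)).det| * X y l) x

/-! ### Invariance of coefficients under linear changes of coordinates

Under a change of coordinates with Jacobian matrix `A = (∂x^a/∂x̃^i)` the components of a
`(0,r)`-tensor at a point are multiplied by `r` copies of `A`. -/

/-- The components in the new coordinates of a `(0,2)`-tensor. -/
def change2 (A : Matrix (Fin n) (Fin n) ℝ) (w : Arr2 n) : Arr2 n := fun i j =>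
  ∑ a, ∑ b, A a i * A b j * w a b

/-- The components in the new coordinates of a `(0,3)`-tensor. -/
def change3 (A : Matrix (Fin n) (Fin n) ℝ) (D : Arr3 n) : Arr3 n := fun i j k =>
  ∑ a, ∑ b, ∑ c, A a i * A b j * A c k * D a b c

/-- `w` is the component matrix of a Lorentz inner product. -/
def IsLorentz (w : Arr2 n) : Prop :=
  ∃ A : Matrix (Fin n) (Fin n) ℝ, A.det ≠ 0 ∧ w = change2 A (minkowski n)

/-- The value `μ^{IJ}(g_{ab}) D_I D_J` does not depend on the choice of coordinates. -/
def IsQuadraticInvariant (μ : Arr2 n → Fin n → Fin n → Fin n → Arr3 n) : Prop :=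
  ∀ w : Arr2 n, IsLorentz w → ∀ A : Matrix (Fin n) (Fin n) ℝ, A.det ≠ 0 → ∀ D : Arr3 n,
    quadForm μ (change2 A w) (change3 A D) = quadForm μ w D

/-- The vector with components `X^l = β^{ijkl}(g_{ab}) D_{ijk}` does not depend on the choice of
coordinates: `X^a = (∂x^a/∂x̃^l) X̃^l`. -/
def IsVectorInvariant (β : Arr2 n → Arr4 n) : Prop :=
  ∀ w : Arr2 n, IsLorentz w → ∀ A : Matrix (Fin n) (Fin n) ℝ, A.det ≠ 0 → ∀ D : Arr3 n,
    A.mulVec (contraction β (change2 A w) (change3 A D)) = contraction β w D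

end Coordinates

/-- In every coordinate system of the smooth manifold `M`, the function `f` is given by
`L(g_{ij}, g_{ij,k}, g_{ij,kl}, Γ_{ijk}, Γ_{ijk,l})`. -/
def IsGivenBy {n : ℕ} {M : Type*} [TopologicalSpace M] [ChartedSpace (Coord n) M]
    [IsManifold (𝓡 n) ∞ M] (L : JetSpace n → ℝ) (g : LorentzMetric n M)
    (cov : AffineConnection n M) (f : M → ℝ) : Prop :=
  ∀ e ∈ IsManifold.maximalAtlas (𝓡 n) ∞ M, ∀ p ∈ e.source,
    L (jet (metricComp g e) (connectionComp g cov e) (e p)) = f p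

end BrayLagrangian

end

open BrayLagrangian

/-!
The hypothesis is used only for metrics and connections on `ℝⁿ`. For a jet of a metric at the
origin with vanishing first derivatives and a `1`-jet of a connection there is a Lorentz metric
`Φᵀ η Φ` and a connection on `ℝⁿ` with these jets (`exists_frame`, `value_jet_eq`). In the
coordinates `x̃` with `x = A x̃ + ½ S(x̃, x̃) + ⅙ T(x̃, x̃, x̃)` the same metric and connection have
another jet, and `L` takes the same value on it. In terms of the metric, its derivatives, the
difference array `D` and its first derivatives this says that `L` is invariant under linear
changes (`value_linear_change`) and under the shifts by `S` and `T` (`value_shift`).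

At the Minkowski matrix `η`, `L` is a quadratic polynomial in the derivatives. Since the
`T`-shift acts linearly and `T` and `-T` are both allowed, and since the `S`-shift has odd and even
parts in `S`, most mixed coefficients vanish (`normal_form_eta`). The change of coordinates `-1`
fixes the arrays of even rank and reverses `D`, so no term is of odd degree in `D`; in particular
there is no trace term linear in `D`. What remains is

* a part linear in `∂∂g` which vanishes on the `T`-shifts, hence satisfies a cyclic identity;
  an invariant functional of this kind is a multiple of the scalar curvature
  (`exists_eq_curvatureTrace`);
* a part quadratic in `∂D` which vanishes on the `S`-shifts, hence alternates in all four indices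
  (`antisymm_of_derivShift`); an invariant form of this kind is a multiple of `|dγ|²`
  (`exists_eq_normSq4`);
* a part linear in `∂D`, with coefficients `β`, and a part quadratic in `D`, with coefficients `μ`.

The two statements on invariants need only the reflections in `e_i` and in `2 e_i + e_j`: the first
kill the coefficients in which an index occurs an odd number of times, the second compare the
remaining ones.

Every Lorentz matrix is the image of `η` under a linear change, which gives the normal form at
all jets with vanishing first derivatives of the metric (`exists_value_normal_form`). An arbitrary
jet is reduced to this case by the shift with `S` the Levi-Civita symbols (`exists_value_jet`). This
shift turns `∂∂g` into `∂∂g` minus a term quadratic in the Levi-Civita symbols, whose trace is the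
scalar curvature (`scalarCurvature_eq`), and `∂D` into the covariant derivative of `D`, which
`β` contracts to a divergence (`divergence_contraction`); the latter is the invariance of `β`
differentiated along `1 + t B`, where `B` is the matrix of Levi-Civita symbols with a fixed last
index.
-/

open scoped Manifold ContDiff Topology

noncomputable section

namespace BrayLagrangian

variable {n : ℕ}

/-! ### Metrics and connections on `ℝⁿ` with given components -/

/-- The continuous bilinear form `∑ w_{ij} u_i v_j` on `ℝⁿ`. -/
def bilin (w : Arr2 n) : Coord n →L[ℝ] Coord n →L[ℝ] ℝ :=
  ∑ i, ∑ j, w i j • (EuclideanSpace.proj i : Coord n →L[ℝ] ℝ).smulRight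
    (EuclideanSpace.proj j : Coord n →L[ℝ] ℝ)

lemma bilin_apply (w : Arr2 n) (u v : Coord n) : bilin w u v = ∑ i, ∑ j, w i j * u i * v j := by
  simp [bilin, mul_assoc]

lemma contDiff_smul_fixed {E F : Type*} [NormedAddCommGroup E] [NormedSpace ℝ E]
    [NormedAddCommGroup F] [NormedSpace ℝ F] {k : ℕ∞ω}
    {f : E → ℝ} (hf : ContDiff ℝ k f) (c : F) :
        ContDiff ℝ k (fun x => f x • c) := hf.smul contDiff_const

lemma contDiff_bilin {k : ℕ∞ω} {G : Coord n → Arr2 n} (hG : ∀ i j, ContDiff ℝ k fun x => G x i j) :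
    ContDiff ℝ k (fun x => bilin (G x)) := by
  unfold BrayLagrangian.bilin
  refine ContDiff.sum fun i _ => ContDiff.sum fun j _ => ?_
  have h := contDiff_smul_fixed (hG i j) ((EuclideanSpace.proj i : Coord n →L[ℝ] ℝ).smulRight
    (EuclideanSpace.proj j : Coord n →L[ℝ] ℝ))
  exact h

lemma contMDiff_bilinSection {G : Coord n → Coord n →L[ℝ] Coord n →L[ℝ] ℝ} (hG : ContDiff ℝ ∞ G) :
    ContMDiff (𝓡 n) ((𝓡 n).prod 𝓘(ℝ, Coord n →L[ℝ] Coord n →L[ℝ] ℝ)) ∞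
    (fun p => Bundle.TotalSpace.mk' (Coord n →L[ℝ] Coord n →L[ℝ] ℝ)
      (E := fun q : Coord n => TangentSpace (𝓡 n) q →L[ℝ] TangentSpace (𝓡 n) q →L[ℝ] ℝ) p
          (G p)) := by
  intro x
  refine (contMDiffAt_hom_bundle _).2 ⟨contMDiffAt_id, ?_⟩
  have hcov : ∀ (b : Coord n) (f : Coord n →L[ℝ] ℝ), ContinuousLinearMap.inCoordinates (Coord n)
      (TangentSpace (𝓡 n)) ℝ (Bundle.Trivial (Coord n) ℝ) x b x b f = f := by
    intro b f
    ext v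
    have h1 : (trivializationAt (Coord n) (TangentSpace (𝓡 n)) x).symmL ℝ b v = v :=
      congrArg (fun T : Coord n →L[ℝ] Coord n => T v) (TangentBundle.symmL_model_space x b)
    have h2 : ContinuousLinearMap.inCoordinates (Coord n)
      (TangentSpace (𝓡 n)) ℝ (Bundle.Trivial (Coord n) ℝ) x b x b f v =
        (trivializationAt ℝ (Bundle.Trivial (Coord n) ℝ) x).continuousLinearMapAt ℝ b
        (f ((trivializationAt (Coord n) (TangentSpace (𝓡 n)) x).symmL ℝ b v)) := rfl
    rw [h2]
    refine (congrArg
      (fun r => (trivializationAt ℝ (Bundle.Trivial (Coord n) ℝ) x).continuousLinearMapAt ℝ b (f r))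
        h1).trans ?_
    simp
  have key :
    (fun b => ContinuousLinearMap.inCoordinates (Coord n) (TangentSpace (𝓡 n)) (Coord n →L[ℝ] ℝ)
      (fun q : Coord n => TangentSpace (𝓡 n) q →L[ℝ] ℝ) x b x b (G b)) = G := by
    funext b
    ext v : 1
    have h1 : (trivializationAt (Coord n) (TangentSpace (𝓡 n)) x).symmL ℝ b v = v :=
      congrArg (fun T : Coord n →L[ℝ] Coord n => T v) (TangentBundle.symmL_model_space x b)
    have h2 : ContinuousLinearMap.inCoordinates (Coord n) (TangentSpace (𝓡 n)) (Coord n →L[ℝ] ℝ)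
      (fun q : Coord n => TangentSpace (𝓡 n) q →L[ℝ] ℝ) x b x b (G b) v =
        (trivializationAt (Coord n →L[ℝ] ℝ) (fun q : Coord n => TangentSpace (𝓡 n) q →L[ℝ] ℝ)
          x).continuousLinearMapAt ℝ b
        (G b ((trivializationAt (Coord n) (TangentSpace (𝓡 n)) x).symmL ℝ b v)) := rfl
    rw [h2]
    refine (congrArg
      (fun r => (trivializationAt (Coord n →L[ℝ] ℝ) (fun q : Coord n => TangentSpace (𝓡 n) q →L[ℝ]
        ℝ) x).continuousLinearMapAt ℝ b (G b r)) h1).trans ?_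
    have h3 : ∀ f : TangentSpace (𝓡 n) b →L[ℝ] ℝ,
        (trivializationAt (Coord n →L[ℝ] ℝ) (fun q : Coord n => TangentSpace (𝓡 n) q →L[ℝ] ℝ)
          x).continuousLinearMapAt ℝ b f = ContinuousLinearMap.inCoordinates (Coord n)
            (TangentSpace (𝓡 n)) ℝ (Bundle.Trivial (Coord n) ℝ) x b x b f := fun f => by
      rw [Bundle.Trivialization.continuousLinearMapAt_apply,
        Bundle.Trivialization.linearMapAt_apply,
        if_pos (by simp [hom_trivializationAt_baseSet, chartAt_self_eq])]
      rfl
    exact (h3 (G b v)).trans (hcov b (G b v))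
  exact (congrArg (fun f => ContMDiffAt (𝓡 n) 𝓘(ℝ, Coord n →L[ℝ] Coord n →L[ℝ] ℝ) ∞ f x) key).mpr
    hG.contMDiff.contMDiffAt

/-- The Minkowski matrix as an array. -/
def eta (n : ℕ) : Arr2 n := fun i j => minkowski n i j

lemma eta_symm (i j : Fin n) : eta n i j = eta n j i := by
  simp only [eta, minkowski, Matrix.diagonal_apply]
  by_cases h : i = j
  · simp [h]
  · simp [h, Ne.symm h]

lemma change2_symm (A : Matrix (Fin n) (Fin n) ℝ) {w : Arr2 n} (hw : ∀ i j, w i j = w j i) (i j) :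
    change2 A w i j = change2 A w j i := by
  unfold change2
  rw [Finset.sum_comm]
  refine Finset.sum_congr rfl fun a _ => Finset.sum_congr rfl fun b _ => ?_
  rw [hw]; ring

lemma change2_eq (A : Matrix (Fin n) (Fin n) ℝ) (w : Arr2 n) :
    change2 A w = A.transpose * Matrix.of w * A := by
  ext i j
  simp only [change2, Matrix.mul_apply, Matrix.transpose_apply, Matrix.of_apply, Finset.sum_mul]
  rw [Finset.sum_comm]
  refine Finset.sum_congr rfl fun a _ => Finset.sum_congr rfl fun b _ => ?_
  ring

lemma change2_change2 (A B : Matrix (Fin n) (Fin n) ℝ) (w : Arr2 n) :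
    change2 B (change2 A w) = change2 (A * B) w := by
  rw [change2_eq, change2_eq, change2_eq, Matrix.transpose_mul]
  change B.transpose * (A.transpose * Matrix.of w * A) * B = _
  simp only [Matrix.mul_assoc]

lemma change2_one (w : Arr2 n) : change2 1 w = w := by
  rw [change2_eq]; simp; rfl

lemma bilin_symm {w : Arr2 n} (hw : ∀ i j, w i j = w j i) (u v : Coord n) :
    bilin w u v = bilin w v u := by
  rw [bilin_apply, bilin_apply, Finset.sum_comm]
  refine Finset.sum_congr rfl fun a _ => Finset.sum_congr rfl fun b _ => ?_
  rw [hw]; ring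

/-- The Lorentz metric on `ℝⁿ` with components `Φᵀ η Φ`, for a smooth field `Φ` of invertible
matrices. The columns of `Φ⁻¹` form a Lorentz frame at each point. -/
def metricOfFrame (Φ : Coord n → Matrix (Fin n) (Fin n) ℝ)
    (hΦ : ∀ i j, ContDiff ℝ ∞ fun x => Φ x i j) (hdet : ∀ x, (Φ x).det ≠ 0) :
    LorentzMetric n (Coord n) where
  val p := bilin (change2 (Φ p) (eta n))
  symm p v w := bilin_symm (change2_symm _ eta_symm) v w
  lorentz p := by
    have hu : IsUnit (Φ p)⁻¹ := by
      rw [Matrix.isUnit_iff_isUnit_det, Matrix.det_nonsing_inv]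
      simpa using hdet p
    have hinj : LinearIndependent ℝ (fun i => (WithLp.toLp 2 ((Φ p)⁻¹.col i) : Coord n)) := by
      have := Matrix.linearIndependent_cols_of_isUnit hu
      exact this.map' (WithLp.linearEquiv 2 ℝ (Fin n → ℝ)).symm.toLinearMap (LinearEquiv.ker _)
    let b : Module.Basis (Fin n) ℝ (Coord n) :=
      Module.Basis.mk hinj (hinj.span_eq_top_of_card_eq_finrank' (by simp)).ge
    -- In the frame of the columns of `Φ⁻¹` the matrix is `(Φ⁻¹)ᵀ (Φᵀ η Φ) Φ⁻¹ = η`.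
    refine ⟨b, fun i j => ?_⟩
    have hb : ∀ i, b i = (WithLp.toLp 2 ((Φ p)⁻¹.col i) : Coord n) := by intro i; simp [b]
    change bilin _ (b i) (b j) = eta n i j
    rw [bilin_apply, hb, hb]
    have := congrFun (congrFun (change2_change2 (Φ p) (Φ p)⁻¹ (eta n)) i) j
    rw [Matrix.mul_nonsing_inv _ (by simpa using hdet p), change2_one] at this
    rw [← this]
    refine Finset.sum_congr rfl fun a _ => Finset.sum_congr rfl fun b _ => ?_
    change change2 (Φ p) (eta n) a b * (Φ p)⁻¹ a i * (Φ p)⁻¹ b j = (Φ p)⁻¹ a i * (Φ p)⁻¹ b j * _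
    ring
  contMDiff := contMDiff_bilinSection (contDiff_bilin (by intro i j; unfold change2; fun_prop))

lemma contMDiff_endSection {A : Coord n → Coord n →L[ℝ] Coord n} (hG : ContDiff ℝ ∞ A) :
    ContMDiff (𝓡 n) ((𝓡 n).prod 𝓘(ℝ, Coord n →L[ℝ] Coord n)) ∞
    (fun p => Bundle.TotalSpace.mk' (Coord n →L[ℝ] Coord n)
      (E := fun q : Coord n => TangentSpace (𝓡 n) q →L[ℝ] TangentSpace (𝓡 n) q) p (A p)) := by
  intro x
  refine (contMDiffAt_hom_bundle _).2 ⟨contMDiffAt_id, ?_⟩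
  have key : (fun b => ContinuousLinearMap.inCoordinates (Coord n) (TangentSpace (𝓡 n)) (Coord n)
      (TangentSpace (𝓡 n)) x b x b (A b)) = A := by
    funext b
    exact inCoordinates_tangent_bundle_core_model_space x b x b (A b)
  exact (congrArg (fun f => ContMDiffAt (𝓡 n) 𝓘(ℝ, Coord n →L[ℝ] Coord n) ∞ f x) key).mpr
    hG.contMDiff.contMDiffAt

lemma mdiffAt_section_iff {σ : Π x : Coord n, TangentSpace (𝓡 n) x} {x : Coord n} :
    MDifferentiableAt (𝓡 n) ((𝓡 n).prod (𝓡 n))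
        (fun p => Bundle.TotalSpace.mk' (Coord n) (E := fun q : Coord n => TangentSpace (𝓡 n) q) p
          (σ p)) x ↔ DifferentiableAt ℝ (fun y => (σ y : Coord n)) x := by
  have key : (fun b => (trivializationAt (Coord n) (TangentSpace (𝓡 n)) x
      ⟨b, σ b⟩).2) = fun y => (σ y : Coord n) := by
    funext b
    exact congrArg Prod.snd (trivializationAt_model_space_apply (I := 𝓡 n)
      (⟨b, σ b⟩ : TangentBundle (𝓡 n) (Coord n)) x)
  refine (mdifferentiableAt_section (𝓡 n) σ).trans
    (Iff.trans ?_ mdifferentiableAt_iff_differentiableAt)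
  exact iff_of_eq (congrArg (fun f => MDifferentiableAt (𝓡 n) (𝓡 n) f x) key)

lemma leibniz_aux_add {σ σ' : Coord n → Coord n} {x : Coord n} (h : DifferentiableAt ℝ σ x)
    (h' : DifferentiableAt ℝ σ' x) (A : Coord n →L[ℝ] Coord n →L[ℝ] Coord n) :
    fderiv ℝ (fun y => σ y + σ' y) x + A (σ x + σ' x) = (fderiv ℝ σ x + A (σ x)) +
        (fderiv ℝ σ' x + A (σ' x)) := by
  rw [fderiv_fun_add h h', map_add]; abel

lemma leibniz_aux_smul {σ : Coord n → Coord n} {g : Coord n → ℝ} {x : Coord n}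
    (h : DifferentiableAt ℝ σ x) (h' : DifferentiableAt ℝ g x)
      (A : Coord n →L[ℝ] Coord n →L[ℝ] Coord n) :
    fderiv ℝ (fun y => g y • σ y) x + A (g x • σ x) = g x • (fderiv ℝ σ x + A (σ x)) +
        (fderiv ℝ g x).smulRight (σ x) := by
  rw [fderiv_fun_smul h' h, map_smul, smul_add]; abel

/-- The connection `∇σ = dσ + A(σ)` on `ℝⁿ`, for a field `A` of bilinear maps whose first argument
is the section and whose second argument is the direction. -/
def connOf (A : Coord n → Coord n →L[ℝ] Coord n →L[ℝ] Coord n) : AffineConnection n (Coord n) where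
  toFun σ x := fderiv ℝ (fun y => (σ y : Coord n)) x + A x (σ x)
  isCovariantDerivativeOnUniv := {
    add := by
      intro σ σ' x h h' _
      rw [mdiffAt_section_iff] at h h'
      exact leibniz_aux_add h h' (A x)
    leibniz := by
      intro σ g x h h' _
      rw [mdiffAt_section_iff] at h
      rw [mdifferentiableAt_iff_differentiableAt] at h'
      have e : mvfderiv (𝓡 n) g x = fderiv ℝ g x := by
        simp only [mvfderiv, mfderiv_eq_fderiv]; rfl
      rw [e]
      exact leibniz_aux_smul h h' (A x) }

lemma connOf_contMDiff {A : Coord n → Coord n →L[ℝ] Coord n →L[ℝ] Coord n} (hA : ContDiff ℝ ∞ A) :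
    (connOf A).ContMDiffCovariantDerivative ∞ where
  contMDiff := ⟨by
     intro σ hσ
     have : ContDiff ℝ ∞ (fun y => (σ y : Coord n)) := by
       have := contMDiff_vectorSpace_iff_contDiff.1 (contMDiffOn_univ.1 hσ)
       simpa using this
     apply ContMDiff.contMDiffOn
     apply contMDiff_endSection (A := fun x => fderiv ℝ (fun y => (σ y : Coord n)) x + A x (σ x))
     exact (this.fderiv_right (m := ∞) (by simp)).add (hA.clm_apply this)⟩

/-! ### Components in the charts of `ℝⁿ` -/

/-- The inverse function theorem in the language of charts: a smooth map with invertible derivative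
at `a` is, near `a`, the inverse of a chart of `ℝⁿ`. -/
lemma exists_chart {φ : Coord n → Coord n} (hφ : ContDiff ℝ ∞ φ) {a : Coord n}
    (h0 : (fderiv ℝ φ a).IsInvertible) :
    ∃ ψ : OpenPartialHomeomorph (Coord n) (Coord n), a ∈ ψ.source ∧ (ψ : Coord n → Coord n) = φ ∧
     (∀ x ∈ ψ.source, (fderiv ℝ φ x).IsInvertible) ∧ ψ.symm ∈ IsManifold.maximalAtlas (𝓡 n) ∞
         (Coord n) := by
  obtain ⟨f', hf'⟩ := h0
  have hd : HasFDerivAt φ (f' : Coord n →L[ℝ] Coord n) a := by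
    rw [hf']; exact (hφ.differentiable (by simp)).differentiableAt.hasFDerivAt
  let ψ₀ := hφ.contDiffAt.toOpenPartialHomeomorph φ hd (by simp)
  have hcont : Continuous (fderiv ℝ φ) := hφ.continuous_fderiv (by simp)
  let U : Set (Coord n) :=
    fderiv ℝ φ ⁻¹' Set.range (fun e : Coord n ≃L[ℝ] Coord n => (e : Coord n →L[ℝ] Coord n))
  have hU : IsOpen U := ContinuousLinearEquiv.isOpen.preimage hcont
  let ψ := ψ₀.restrOpen U hU
  have hψ : (ψ : Coord n → Coord n) = φ := rfl
  have hsrc : ψ.source = ψ₀.source ∩ U := rfl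
  have hinv : ∀ x ∈ ψ.source, (fderiv ℝ φ x).IsInvertible := by
    intro x hx
    rw [hsrc] at hx
    obtain ⟨e, he⟩ := hx.2
    exact ⟨e, he⟩
  refine ⟨ψ, ⟨hφ.contDiffAt.mem_toOpenPartialHomeomorph_source hd (by simp), f', hf'⟩, hψ, hinv, ?_⟩
  have hsymm : ContDiffOn ℝ ∞ ψ.symm ψ.target := by
    intro y hy
    obtain ⟨e, he⟩ := hinv _ (ψ.map_target hy)
    refine (ψ.contDiffAt_symm (f₀' := e) hy ?_ ?_).contDiffWithinAt
    · rw [he, hψ]; exact (hφ.differentiable (by simp)).differentiableAt.hasFDerivAt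
    · rw [hψ]; exact hφ.contDiffAt
  have key : ψ.symm ∈ contDiffGroupoid ∞ (𝓡 n) := by
    rw [contDiffGroupoid, mem_groupoid_of_pregroupoid]
    simp [contDiffPregroupoid]
    exact ⟨hsymm, hφ.contDiffOn⟩
  have := StructureGroupoid.mem_maximalAtlas_of_mem_groupoid (contDiffGroupoid ∞ (𝓡 n)) key
  exact this

/-- In the chart `φ⁻¹` the coordinate fields are the columns of the derivative of `φ`. -/
lemma coordField_symm {φ : Coord n → Coord n} (hφ : ContDiff ℝ ∞ φ)
    {ψ : OpenPartialHomeomorph (Coord n) (Coord n)}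
    (hψ : (ψ : Coord n → Coord n) = φ) (hinv : ∀ x ∈ ψ.source, (fderiv ℝ φ x).IsInvertible)
        {x : Coord n} (hx : x ∈ ψ.source)
    (i : Fin n) : coordField ψ.symm i (φ x) = fderiv ℝ φ x (EuclideanSpace.single i 1) := by
  obtain ⟨e, he⟩ := hinv x hx
  have h1 : HasFDerivAt ψ.symm (e.symm : Coord n →L[ℝ] Coord n) (φ x) := by
    have hx' : φ x ∈ ψ.target := by rw [← hψ]; exact ψ.map_source hx
    refine ψ.hasFDerivAt_symm hx' ?_
    rw [he, ← hψ, ψ.left_inv hx, hψ]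
    exact (hφ.differentiable (by simp)).differentiableAt.hasFDerivAt
  have h2 : mfderiv (𝓡 n) (𝓡 n) ψ.symm (φ x) = (e.symm : Coord n →L[ℝ] Coord n) := by
    rw [mfderiv_eq_fderiv]; exact h1.fderiv
  have h4 : ContinuousLinearMap.inverse (mfderiv (𝓡 n) (𝓡 n) ψ.symm (φ x)) = fderiv ℝ φ x := by
    rw [h2, ← he]; exact ContinuousLinearMap.inverse_equiv e.symm
  exact congrArg (fun T : Coord n →L[ℝ] Coord n => T (EuclideanSpace.single i 1)) h4

lemma metricComp_symm {φ : Coord n → Coord n} (hφ : ContDiff ℝ ∞ φ)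
    {ψ : OpenPartialHomeomorph (Coord n) (Coord n)}
    (hψ : (ψ : Coord n → Coord n) = φ) (hinv : ∀ x ∈ ψ.source, (fderiv ℝ φ x).IsInvertible)
        {x : Coord n} (hx : x ∈ ψ.source)
    (g : LorentzMetric n (Coord n)) {G : Coord n → Arr2 n} (hg : ∀ p, g.val p = bilin (G p)) (i j) :
    metricComp g ψ.symm x i j = bilin (G (φ x)) (fderiv ℝ φ x (EuclideanSpace.single i 1))
        (fderiv ℝ φ x (EuclideanSpace.single j 1)) := by
  unfold metricComp
  rw [OpenPartialHomeomorph.symm_symm, hψ, coordField_symm hφ hψ hinv hx, coordField_symm hφ hψ hinv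
    hx, hg]
  rfl

lemma connectionComp_symm {φ : Coord n → Coord n} (hφ : ContDiff ℝ ∞ φ)
    {ψ : OpenPartialHomeomorph (Coord n) (Coord n)}
    (hψ : (ψ : Coord n → Coord n) = φ) (hinv : ∀ x ∈ ψ.source, (fderiv ℝ φ x).IsInvertible)
        {x : Coord n} (hx : x ∈ ψ.source)
    (g : LorentzMetric n (Coord n)) {G : Coord n → Arr2 n} (hg : ∀ p, g.val p = bilin (G p))
    (A : Coord n → Coord n →L[ℝ] Coord n →L[ℝ] Coord n) (i j k) :
    connectionComp g (connOf A) ψ.symm x i j k = bilin (G (φ x))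
    (fderiv ℝ (fun y => fderiv ℝ φ y (EuclideanSpace.single j 1)) x (EuclideanSpace.single i 1) +
        A (φ x) (fderiv ℝ φ x (EuclideanSpace.single j 1))
          (fderiv ℝ φ x (EuclideanSpace.single i 1)))
            (fderiv ℝ φ x (EuclideanSpace.single k 1)) := by
  obtain ⟨e, he⟩ := hinv x hx
  have h1 : HasFDerivAt ψ.symm (e.symm : Coord n →L[ℝ] Coord n) (φ x) := by
    have hx' : φ x ∈ ψ.target := by rw [← hψ]; exact ψ.map_source hx
    refine ψ.hasFDerivAt_symm hx' ?_
    rw [he, ← hψ, ψ.left_inv hx, hψ]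
    exact (hφ.differentiable (by simp)).differentiableAt.hasFDerivAt
  have hev : (fun q => (coordField ψ.symm j q : Coord n)) =ᶠ[𝓝 (φ x)] fun q =>
    fderiv ℝ φ (ψ.symm q) (EuclideanSpace.single j 1) := by
    have hx' : φ x ∈ ψ.target := by rw [← hψ]; exact ψ.map_source hx
    filter_upwards [ψ.open_target.mem_nhds hx'] with q hq
    have := coordField_symm hφ hψ hinv (ψ.map_target hq) j
    rw [← hψ, ψ.right_inv hq] at this
    rw [this, hψ]
  have hs : ψ.symm (φ x) = x := by rw [← hψ]; exact ψ.left_inv hx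
  have h2 : fderiv ℝ (fun q => (coordField ψ.symm j q : Coord n)) (φ x)
    (fderiv ℝ φ x (EuclideanSpace.single i 1)) =
     fderiv ℝ (fun y => fderiv ℝ φ y (EuclideanSpace.single j 1)) x
       (EuclideanSpace.single i 1) := by
    rw [hev.fderiv_eq]
    have hd : DifferentiableAt ℝ (fun y => fderiv ℝ φ y (EuclideanSpace.single j 1))
      (ψ.symm (φ x)) := by
      have : ContDiff ℝ ∞ (fun y => fderiv ℝ φ y (EuclideanSpace.single j 1)) :=
        (hφ.fderiv_right (m := ∞) (by simp)).clm_apply contDiff_const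
      exact (this.differentiable (by simp)).differentiableAt
    have := (hd.hasFDerivAt.comp (φ x) h1).fderiv
    rw [show (fun q => fderiv ℝ φ (ψ.symm q) (EuclideanSpace.single j 1)) =
      (fun y => fderiv ℝ φ y (EuclideanSpace.single j 1)) ∘ ψ.symm from rfl, this, hs, ← he]
    simp
  unfold connectionComp
  rw [OpenPartialHomeomorph.symm_symm, hψ, coordField_symm hφ hψ hinv hx, coordField_symm hφ hψ hinv
    hx, hg]
  have h3 : (connOf A) (coordField ψ.symm j) (φ x) (fderiv ℝ φ x (EuclideanSpace.single i 1)) =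
    fderiv ℝ (fun q => (coordField ψ.symm j q : Coord n)) (φ x)
      (fderiv ℝ φ x (EuclideanSpace.single i 1)) + A (φ x) (coordField ψ.symm j (φ x))
        (fderiv ℝ φ x (EuclideanSpace.single i 1)) := rfl
  rw [coordField_symm hφ hψ hinv hx, h2] at h3
  exact congrArg (fun v => bilin (G (φ x)) v _) h3

/-! ### Partial derivatives -/

lemma pd_add {f g : Coord n → ℝ} {x : Coord n} (hf : DifferentiableAt ℝ f x)
    (hg : DifferentiableAt ℝ g x) (k : Fin n) :
    pd k (fun y => f y + g y) x = pd k f x + pd k g x := by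
  simp [pd, fderiv_fun_add hf hg]

lemma pd_sub {f g : Coord n → ℝ} {x : Coord n} (hf : DifferentiableAt ℝ f x)
    (hg : DifferentiableAt ℝ g x) (k : Fin n) :
    pd k (fun y => f y - g y) x = pd k f x - pd k g x := by
  simp [pd, fderiv_fun_sub hf hg]

lemma pd_mul {f g : Coord n → ℝ} {x : Coord n} (hf : DifferentiableAt ℝ f x)
    (hg : DifferentiableAt ℝ g x) (k : Fin n) :
    pd k (fun y => f y * g y) x = pd k f x * g x + f x * pd k g x := by
  simp [pd, fderiv_fun_mul hf hg]; ring

lemma pd_const (c : ℝ) (x : Coord n) (k : Fin n) : pd k (fun _ => c) x = 0 := by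
  simp [pd]

lemma pd_sum {ι : Type*} {s : Finset ι} {f : ι → Coord n → ℝ} {x : Coord n}
    (hf : ∀ i ∈ s, DifferentiableAt ℝ (f i) x) (k : Fin n) :
    pd k (fun y => ∑ i ∈ s, f i y) x = ∑ i ∈ s, pd k (f i) x := by
  simp [pd, fderiv_fun_sum hf]

lemma pd_coord (j k : Fin n) (x : Coord n) : pd k (fun y => y j) x = if j = k then 1 else 0 := by
  have h : HasFDerivAt (fun y : Coord n => y j) (EuclideanSpace.proj j : Coord n →L[ℝ] ℝ) x :=
    (EuclideanSpace.proj j : Coord n →L[ℝ] ℝ).hasFDerivAt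
  rw [pd, h.fderiv]
  exact PiLp.single_apply 2 ℝ k (1 : ℝ) j

lemma pd_congr {f g : Coord n → ℝ} {x : Coord n} (h : f =ᶠ[𝓝 x] g) (k : Fin n) :
    pd k f x = pd k g x := by
  simp [pd, h.fderiv_eq]

lemma pd_eventuallyEq {f g : Coord n → ℝ} {x : Coord n} (h : f =ᶠ[𝓝 x] g) (k : Fin n) :
    pd k f =ᶠ[𝓝 x] pd k g := by
  filter_upwards [h.eventuallyEq_nhds] with y hy using pd_congr hy k

lemma contDiff_pd {f : Coord n → ℝ} (hf : ContDiff ℝ ∞ f) (k : Fin n) : ContDiff ℝ ∞ (pd k f) :=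
  (hf.fderiv_right (m := ∞) (by simp)).clm_apply contDiff_const

lemma fderiv_apply_eq_sum_pd {f : Coord n → ℝ} (x v : Coord n) :
    fderiv ℝ f x v = ∑ k, v k * pd k f x := by
  conv_lhs => rw [← (EuclideanSpace.basisFun (Fin n) ℝ).sum_repr v]
  simp [pd]

lemma pd_comp {f : Coord n → ℝ} {φ : Coord n → Coord n} {x : Coord n}
    (hf : DifferentiableAt ℝ f (φ x)) (hφ : DifferentiableAt ℝ φ x) (k : Fin n) :
    pd k (fun y => f (φ y)) x = ∑ a, pd k (fun y => φ y a) x * pd a f (φ x) := by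
  have h := (hf.hasFDerivAt.comp x hφ.hasFDerivAt).fderiv
  have h2 : ∀ a, pd k (fun y => φ y a) x = fderiv ℝ φ x (EuclideanSpace.single k 1) a := by
    intro a
    have : HasFDerivAt (fun y => φ y a) ((EuclideanSpace.proj a : Coord n →L[ℝ] ℝ).comp
      (fderiv ℝ φ x)) x :=
      (EuclideanSpace.proj a : Coord n →L[ℝ] ℝ).hasFDerivAt.comp x hφ.hasFDerivAt
    rw [pd, this.fderiv]; rfl
  simp only [h2]
  rw [← fderiv_apply_eq_sum_pd]
  rw [pd, show (fun y => f (φ y)) = f ∘ φ from rfl, h]; rfl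

/-! ### Functions with prescribed jets at the origin -/

/-- `f` is smooth on `ℝⁿ`, and its value, first and second partial derivatives at the origin are
`c`, `l` and `h`. -/
structure HasJet2 (f : Coord n → ℝ) (c : ℝ) (l : Fin n → ℝ) (h : Fin n → Fin n → ℝ) : Prop where
  contDiff : ContDiff ℝ ∞ f
  val : f 0 = c
  fst : ∀ k, pd k f 0 = l k
  snd : ∀ k m, pd m (pd k f) 0 = h k m

/-- `f` is smooth on `ℝⁿ`, and its value and first partial derivatives at the origin are `c` and
`l`. -/
structure HasJet1 (f : Coord n → ℝ) (c : ℝ) (l : Fin n → ℝ) : Prop where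
  contDiff : ContDiff ℝ ∞ f
  val : f 0 = c
  fst : ∀ k, pd k f 0 = l k

lemma differentiableAt_of_contDiff {f : Coord n → ℝ} (hf : ContDiff ℝ ∞ f) (x : Coord n) :
    DifferentiableAt ℝ f x :=
  (hf.differentiable (by simp)).differentiableAt

lemma HasJet2.toJet1 {f : Coord n → ℝ} {c l h} (H : HasJet2 f c l h) :
    HasJet1 f c l := ⟨H.1, H.2, H.3⟩

lemma HasJet2.congr {f : Coord n → ℝ} {c l h c' l' h'} (H : HasJet2 f c l h) (hc : c = c')
    (hl : ∀ k, l k = l' k) (hh : ∀ k m, h k m = h' k m) : HasJet2 f c' l' h' :=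
  ⟨H.1, hc ▸ H.2, fun k => (H.3 k).trans (hl k), fun k m => (H.4 k m).trans (hh k m)⟩

lemma HasJet1.congr {f : Coord n → ℝ} {c l c' l'} (H : HasJet1 f c l) (hc : c = c')
    (hl : ∀ k, l k = l' k) : HasJet1 f c' l' :=
  ⟨H.1, hc ▸ H.2, fun k => (H.3 k).trans (hl k)⟩

lemma HasJet1.mul {f g : Coord n → ℝ} {c l c' l'} (H : HasJet1 f c l) (H' : HasJet1 g c' l') :
    HasJet1 (fun x => f x * g x) (c * c') (fun k => l k * c' + c * l' k) where
  contDiff := H.1.mul H'.1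
  val := by rw [H.2, H'.2]
  fst k := by
    rw [pd_mul (differentiableAt_of_contDiff H.1 _) (differentiableAt_of_contDiff H'.1 _), H.3,
      H'.3, H.2, H'.2]

lemma HasJet1.add {f g : Coord n → ℝ} {c l c' l'} (H : HasJet1 f c l) (H' : HasJet1 g c' l') :
    HasJet1 (fun x => f x + g x) (c + c') (fun k => l k + l' k) where
  contDiff := H.1.add H'.1
  val := by rw [H.2, H'.2]
  fst k := by
    rw [pd_add (differentiableAt_of_contDiff H.1 _) (differentiableAt_of_contDiff H'.1 _), H.3,
      H'.3]

lemma HasJet1.sum {ι : Type*} {s : Finset ι} {f : ι → Coord n → ℝ} {c : ι → ℝ} {l : ι → Fin n → ℝ}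
    (H : ∀ i, HasJet1 (f i) (c i) (l i)) :
    HasJet1 (fun x => ∑ i ∈ s, f i x) (∑ i ∈ s, c i) (fun k => ∑ i ∈ s, l i k) where
  contDiff := ContDiff.sum fun i _ => (H i).1
  val := by simp [(H _).2]
  fst k := by rw [pd_sum (fun i _ => differentiableAt_of_contDiff (H i).1 _)]; simp [(H _).3]

lemma HasJet2.mul {f g : Coord n → ℝ} {c l h c' l' h'} (H : HasJet2 f c l h)
    (H' : HasJet2 g c' l' h') :
    HasJet2 (fun x => f x * g x) (c * c') (fun k => l k * c' + c * l' k)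
      (fun k m => h k m * c' + l k * l' m + l m * l' k + c * h' k m) where
  contDiff := H.1.mul H'.1
  val := by rw [H.2, H'.2]
  fst k := by
    rw [pd_mul (differentiableAt_of_contDiff H.1 _) (differentiableAt_of_contDiff H'.1 _), H.3,
      H'.3, H.2, H'.2]
  snd k m := by
    have : pd k (fun x => f x * g x) = fun x => pd k f x * g x + f x * pd k g x := by
      ext x; rw [pd_mul (differentiableAt_of_contDiff H.1 _) (differentiableAt_of_contDiff H'.1 _)]
    have h1 := contDiff_pd H.1 k
    have h2 := contDiff_pd H'.1 k
    rw [this, pd_add (differentiableAt_of_contDiff (h1.mul H'.1) _)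
      (differentiableAt_of_contDiff (H.1.mul h2) _),
      pd_mul (differentiableAt_of_contDiff h1 _) (differentiableAt_of_contDiff H'.1 _),
      pd_mul (differentiableAt_of_contDiff H.1 _) (differentiableAt_of_contDiff h2 _), H.4, H'.4,
      H.3, H'.3, H.2, H'.2, H.3, H'.3]
    ring

lemma HasJet2.add {f g : Coord n → ℝ} {c l h c' l' h'} (H : HasJet2 f c l h)
    (H' : HasJet2 g c' l' h') :
    HasJet2 (fun x => f x + g x) (c + c') (fun k => l k + l' k) (fun k m => h k m + h' k m) where
  contDiff := H.1.add H'.1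
  val := by rw [H.2, H'.2]
  fst k := by
    rw [pd_add (differentiableAt_of_contDiff H.1 _) (differentiableAt_of_contDiff H'.1 _), H.3,
      H'.3]
  snd k m := by
    have : pd k (fun x => f x + g x) = fun x => pd k f x + pd k g x := by
      ext x; rw [pd_add (differentiableAt_of_contDiff H.1 _) (differentiableAt_of_contDiff H'.1 _)]
    rw [this, pd_add (differentiableAt_of_contDiff (contDiff_pd H.1 k) _)
      (differentiableAt_of_contDiff (contDiff_pd H'.1 k) _), H.4, H'.4]

lemma HasJet2.sum {ι : Type*} {s : Finset ι} {f : ι → Coord n → ℝ} {c : ι → ℝ} {l : ι → Fin n → ℝ}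
    {h : ι → Fin n → Fin n → ℝ} (H : ∀ i, HasJet2 (f i) (c i) (l i) (h i)) :
    HasJet2 (fun x => ∑ i ∈ s, f i x) (∑ i ∈ s, c i) (fun k => ∑ i ∈ s, l i k)
      (fun k m => ∑ i ∈ s, h i k m) where
  contDiff := ContDiff.sum fun i _ => (H i).1
  val := by simp [(H _).2]
  fst k := by rw [pd_sum (fun i _ => differentiableAt_of_contDiff (H i).1 _)]; simp [(H _).3]
  snd k m := by
    have : pd k (fun x => ∑ i ∈ s, f i x) = fun x => ∑ i ∈ s, pd k (f i) x := by
      ext x; rw [pd_sum (fun i _ => differentiableAt_of_contDiff (H i).1 _)]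
    rw [this, pd_sum (fun i _ => differentiableAt_of_contDiff (contDiff_pd (H i).1 k) _)]
    simp [(H _).4]

lemma hasJet2_const (c : ℝ) : HasJet2 (fun _ : Coord n => c) c (fun _ => 0) (fun _ _ => 0) :=
  ⟨contDiff_const, rfl, fun k => pd_const c 0 k, fun k m => by
    have : pd k (fun _ : Coord n => c) = fun _ => 0 := funext fun x => pd_const c x k
    rw [this, pd_const]⟩

lemma hasJet2_coord (j : Fin n) :
    HasJet2 (fun x : Coord n => x j) 0 (fun k => if j = k then 1 else 0) (fun _ _ => 0) :=
  ⟨by fun_prop, rfl, fun k => pd_coord j k 0, fun k m => by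
    have : pd k (fun x : Coord n => x j) = fun _ => if j = k then 1 else 0 :=
      funext fun x => pd_coord j k x
    rw [this, pd_const]⟩

/-- The chain rule at a critical point: the second derivatives of `φ` do not enter. -/
lemma HasJet2.comp_of_critical {f : Coord n → ℝ} {c h} (H : HasJet2 f c (fun _ => 0) h)
    {φ : Coord n → Coord n} (hφ : ContDiff ℝ ∞ φ) (h0 : φ 0 = 0)
    {A : Matrix (Fin n) (Fin n) ℝ} (hA : ∀ a k, pd k (fun y => φ y a) 0 = A a k) :
    HasJet2 (fun x => f (φ x)) c (fun _ => 0) (fun k m => ∑ a, ∑ b, h a b * A a k * A b m) := by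
  have hφd : ∀ x, DifferentiableAt ℝ φ x := fun x => (hφ.differentiable (by simp)).differentiableAt
  have hφa : ∀ a, ContDiff ℝ ∞ (fun y => φ y a) := fun a => by fun_prop
  have hpd : ∀ k, pd k (fun x => f (φ x)) = fun x => ∑ a, pd k (fun y => φ y a) x * pd a f (φ x) :=
    fun k =>
    funext fun x => pd_comp (differentiableAt_of_contDiff H.1 _) (hφd x) k
  have hc : ∀ a, ContDiff ℝ ∞ (fun x => pd a f (φ x)) := fun a => (contDiff_pd H.1 a).comp hφ
  refine ⟨H.1.comp hφ, by rw [h0, H.2], fun k => ?_, fun k m => ?_⟩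
  · rw [hpd k]; simp [h0, H.3]
  · rw [hpd k, pd_sum (fun a _ => differentiableAt_of_contDiff ((contDiff_pd (hφa a) k).mul (hc a))
      _)]
    refine Finset.sum_congr rfl fun a _ => ?_
    rw [pd_mul (differentiableAt_of_contDiff (contDiff_pd (hφa a) k) _)
      (differentiableAt_of_contDiff (hc a) _), h0, H.3, mul_zero, zero_add, hA,
       pd_comp (f := pd a f) (differentiableAt_of_contDiff (contDiff_pd H.1 a) _) (hφd 0),
         Finset.mul_sum]
    refine Finset.sum_congr rfl fun b _ => ?_
    rw [hA, h0, H.4]; ring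

lemma HasJet1.comp {f : Coord n → ℝ} {c l} (H : HasJet1 f c l) {φ : Coord n → Coord n}
    (hφ : ContDiff ℝ ∞ φ) (h0 : φ 0 = 0)
    {A : Matrix (Fin n) (Fin n) ℝ} (hA : ∀ a k, pd k (fun y => φ y a) 0 = A a k) :
    HasJet1 (fun x => f (φ x)) c (fun k => ∑ a, l a * A a k) := by
  have hφd : ∀ x, DifferentiableAt ℝ φ x := fun x => (hφ.differentiable (by simp)).differentiableAt
  refine ⟨H.1.comp hφ, by rw [h0, H.2], fun k => ?_⟩
  rw [pd_comp (differentiableAt_of_contDiff H.1 _) (hφd 0)]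
  refine Finset.sum_congr rfl fun a _ => ?_
  rw [hA, h0, H.3]; ring

lemma HasJet2.jet1_pd {f : Coord n → ℝ} {c l h} (H : HasJet2 f c l h) (k : Fin n) :
    HasJet1 (pd k f) (l k) (h k) :=
  ⟨contDiff_pd H.1 k, H.3 k, H.4 k⟩

lemma HasJet2.const_mul {f : Coord n → ℝ} {c l h} (H : HasJet2 f c l h) (r : ℝ) :
    HasJet2 (fun x => r * f x) (r * c) (fun k => r * l k) (fun k m => r * h k m) :=
  ((hasJet2_const r).mul H).congr rfl (by intro k; ring) (by intro k m; ring)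

/-! ### Cubic changes of coordinates -/

/-- The map `x ↦ A x + ½ S(x, x) + ⅙ T(x, x, x)`; the first index of `S` and `T` is the component of
the result. -/
def cubicMap (A : Matrix (Fin n) (Fin n) ℝ) (S : Arr3 n) (T : Arr4 n) (x : Coord n) : Coord n :=
  WithLp.toLp 2 fun a => ∑ i, A a i * x i + (∑ i, ∑ j, S a i j * (x i * x j)) / 2
    + (∑ i, ∑ j, ∑ k, T a i j k * (x i * x j * x k)) / 6

lemma contDiff_cubicMap (A : Matrix (Fin n) (Fin n) ℝ) (S : Arr3 n) (T : Arr4 n) :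
    ContDiff ℝ ∞ (cubicMap A S T) := by
  rw [contDiff_euclidean]
  intro a
  unfold cubicMap
  simp only
  fun_prop

lemma cubicMap_zero (A : Matrix (Fin n) (Fin n) ℝ) (S : Arr3 n) (T : Arr4 n) :
    cubicMap A S T 0 = 0 := by
  ext a; simp [cubicMap]

lemma pd_cubicMap (A : Matrix (Fin n) (Fin n) ℝ) {S : Arr3 n} {T : Arr4 n}
    (hS : ∀ a i j, S a i j = S a j i)
    (hT : ∀ a i j k, T a i j k = T a j i k) (hT' : ∀ a i j k, T a i j k = T a i k j) (a m : Fin n)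
        (x : Coord n) :
    pd m (fun y => cubicMap A S T y a) x = A a m + ∑ j, S a m j * x j +
        (∑ j, ∑ k, T a m j k * (x j * x k)) / 2 := by
  have d1 : ∀ i, DifferentiableAt ℝ (fun y : Coord n => y i) x := fun i => by fun_prop
  have p1 : pd m (fun y : Coord n => ∑ i, A a i * y i) x = A a m := by
    rw [pd_sum (fun i _ => by fun_prop)]
    simp only [pd_mul (differentiableAt_const _) (d1 _), pd_const, pd_coord]
    simp
  have p2 : pd m (fun y : Coord n => ∑ i, ∑ j, S a i j * (y i * y j)) x = 2 * ∑ j, S a m j *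
    x j := by
    rw [pd_sum (fun i _ => by fun_prop)]
    have : ∀ i, pd m (fun y : Coord n => ∑ j, S a i j * (y i * y j)) x =
      (if i = m then ∑ j, S a m j * x j else 0) + S a m i * x i := by
      intro i
      rw [pd_sum (fun j _ => by fun_prop)]
      have : ∀ j, pd m (fun y : Coord n => S a i j * (y i * y j)) x =
        (if i = m then S a i j * x j else 0) + (if j = m then S a i j * x i else 0) := by
        intro j
        rw [pd_mul (differentiableAt_const _) (by fun_prop), pd_const, pd_mul (d1 i) (d1 j),
          pd_coord, pd_coord]
        split_ifs <;> ring
      simp only [this, Finset.sum_add_distrib, Finset.sum_ite_eq', Finset.mem_univ, if_true]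
      rw [hS a i m]
      split_ifs with h
      · subst h; simp
      · simp
    simp only [this, Finset.sum_add_distrib, Finset.sum_ite_eq', Finset.mem_univ, if_true]
    ring
  have p3 : pd m (fun y : Coord n => ∑ i, ∑ j, ∑ k, T a i j k * (y i * y j * y k)) x = 3 *
    ∑ j, ∑ k, T a m j k * (x j * x k) := by
    rw [pd_sum (fun i _ => by fun_prop)]
    have : ∀ i, pd m (fun y : Coord n => ∑ j, ∑ k, T a i j k * (y i * y j * y k)) x
        = (if i = m then ∑ j, ∑ k, T a m j k * (x j * x k) else 0) + ∑ k, T a m i k * (x i * x k) +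
          ∑ k, T a m i k * (x i * x k) := by
      intro i
      rw [pd_sum (fun j _ => by fun_prop)]
      have : ∀ j, pd m (fun y : Coord n => ∑ k, T a i j k * (y i * y j * y k)) x
         = (if i = m then ∑ k, T a i j k * (x j * x k) else 0) +
           (if j = m then ∑ k, T a i j k * (x i * x k) else 0) + T a i j m * (x i * x j) := by
        intro j
        rw [pd_sum (fun k _ => by fun_prop)]
        have : ∀ k, pd m (fun y : Coord n => T a i j k * (y i * y j * y k)) x
         = (if i = m then T a i j k * (x j * x k) else 0) +
           (if j = m then T a i j k * (x i * x k) else 0) +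
             (if k = m then T a i j k * (x i * x j) else 0) := by
          intro k
          rw [pd_mul (differentiableAt_const _) (by fun_prop), pd_const,
            pd_mul (by fun_prop) (d1 k), pd_mul (d1 i) (d1 j), pd_coord, pd_coord, pd_coord]
          split_ifs <;> ring
        simp only [this, Finset.sum_add_distrib, Finset.sum_ite_eq', Finset.mem_univ, if_true]
        congr 2 <;> split_ifs <;> simp
      simp only [this, Finset.sum_add_distrib, Finset.sum_ite_eq', Finset.mem_univ, if_true]
      congr 1
      · congr 1
        · split_ifs with h
          · subst h; rfl
          · simp
        · exact Finset.sum_congr rfl fun k _ => by rw [hT a i m k]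
      · exact Finset.sum_congr rfl fun k _ => by rw [hT' a i k m, hT a i m k]
    simp only [this, Finset.sum_add_distrib, Finset.sum_ite_eq', Finset.mem_univ, if_true]
    ring
  have e : (fun y => cubicMap A S T y a) = fun y :
    Coord n => (∑ i, A a i * y i + (∑ i, ∑ j, S a i j * (y i * y j)) * 2⁻¹)
    + (∑ i, ∑ j, ∑ k, T a i j k * (y i * y j * y k)) * 6⁻¹ := by
    ext y; simp [cubicMap, div_eq_mul_inv]
  rw [e, pd_add (by fun_prop) (by fun_prop), pd_add (by fun_prop) (by fun_prop),
    pd_mul (by fun_prop) (by fun_prop), pd_mul (by fun_prop) (by fun_prop), p1, p2, p3, pd_const,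
      pd_const]
  ring

lemma hasJet2_pd_cubicMap (A : Matrix (Fin n) (Fin n) ℝ) {S : Arr3 n} {T : Arr4 n}
    (hS : ∀ a i j, S a i j = S a j i)
    (hT : ∀ a i j k, T a i j k = T a j i k) (hT' : ∀ a i j k, T a i j k = T a i k j) (a m : Fin n) :
    HasJet2 (pd m (fun y => cubicMap A S T y a)) (A a m) (S a m) (T a m) := by
  rw [show pd m (fun y => cubicMap A S T y a) = _ from funext (pd_cubicMap A hS hT hT' a m)]
  have h1 : HasJet2 (fun x : Coord n => ∑ j, S a m j * x j) _ _ _ :=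
    HasJet2.sum fun j => (hasJet2_coord j).const_mul (S a m j)
  have h2 : HasJet2 (fun x : Coord n => ∑ j, ∑ k, T a m j k * (x j * x k)) _ _ _ :=
    HasJet2.sum fun j => HasJet2.sum fun k => ((hasJet2_coord j).mul (hasJet2_coord k)).const_mul
      (T a m j k)
  have h3 := ((hasJet2_const (A a m)).add h1).add (h2.const_mul 2⁻¹)
  have e :
    (fun x : Coord n => A a m + ∑ j, S a m j * x j + 2⁻¹ * ∑ j, ∑ k, T a m j k * (x j * x k)) =
      fun x => A a m + ∑ j, S a m j * x j + (∑ j, ∑ k, T a m j k * (x j * x k)) / 2 := by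
    ext x; ring
  rw [e] at h3
  refine h3.congr (by simp) (fun k => by simp) (fun k l => ?_)
  simp [mul_add, Finset.sum_add_distrib]
  rw [hT' a m l k]; ring

/-- Jets are local. The smoothness of `g` is a hypothesis, as it is a global condition. -/
lemma HasJet2.of_eventuallyEq {f g : Coord n → ℝ} {c l h} (H : HasJet2 f c l h)
    (hg : ContDiff ℝ ∞ g) (e : g =ᶠ[𝓝 0] f) : HasJet2 g c l h :=
  ⟨hg, e.eq_of_nhds.trans H.2, fun k => (pd_congr e k).trans (H.3 k),
    fun k m => (pd_congr (pd_eventuallyEq e k) m).trans (H.4 k m)⟩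

/-! ### Lorentz metrics with prescribed second derivatives -/

lemma inv_mul_self {w : Arr2 n} (hw : (Matrix.of w).det ≠ 0) (i j : Fin n) :
    ∑ a, inv w i a * w a j = if i = j then 1 else 0 := by
  have := congrFun (congrFun (Matrix.nonsing_inv_mul (Matrix.of w) (by simpa using hw)) i) j
  rw [Matrix.mul_apply, Matrix.one_apply] at this
  exact this

lemma self_mul_inv {w : Arr2 n} (hw : (Matrix.of w).det ≠ 0) (i j : Fin n) :
    ∑ a, w i a * inv w a j = if i = j then 1 else 0 := by
  have := congrFun (congrFun (Matrix.mul_nonsing_inv (Matrix.of w) (by simpa using hw)) i) j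
  rw [Matrix.mul_apply, Matrix.one_apply] at this
  exact this

lemma det_change2 (A : Matrix (Fin n) (Fin n) ℝ) (w : Arr2 n) :
    (Matrix.of (change2 A w)).det = A.det ^ 2 * (Matrix.of w).det := by
  rw [change2_eq]
  change (A.transpose * Matrix.of w * A).det = _
  rw [Matrix.det_mul, Matrix.det_mul, Matrix.det_transpose]; ring

lemma det_eta_ne_zero : (Matrix.of (eta n)).det ≠ 0 := by
  change (minkowski n).det ≠ 0
  rw [minkowski, Matrix.det_diagonal, Finset.prod_ne_zero_iff]
  intro i _; split_ifs <;> norm_num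

/-- Every `2`-jet of a Lorentz metric with vanishing first derivatives is the jet of a metric
`Φᵀ η Φ` defined on the whole of `ℝⁿ`. -/
lemma exists_frame {A₀ : Matrix (Fin n) (Fin n) ℝ} (hA₀ : A₀.det ≠ 0) {w : Arr2 n}
    (hw : w = change2 A₀ (eta n)) {X : Arr4 n}
    (hX : ∀ i j k l, X i j k l = X j i k l) (hX' : ∀ i j k l, X i j k l = X i j l k) :
    ∃ Φ : Coord n → Matrix (Fin n) (Fin n) ℝ, (∀ i j, ContDiff ℝ ∞ fun x => Φ x i j) ∧
        (∀ x, (Φ x).det ≠ 0) ∧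
     ∀ i j, HasJet2 (fun x => change2 (Φ x) (eta n) i j) (w i j) (fun _ => 0) (X i j) := by
  have hwd : (Matrix.of w).det ≠ 0 := by
    rw [hw, det_change2]; exact mul_ne_zero (pow_ne_zero _ hA₀) det_eta_ne_zero
  have hws : ∀ i j, w i j = w j i := by rw [hw]; exact change2_symm _ eta_symm
  -- Put `Φ = A₀ (1 + N)` with `N` quadratic near the origin. Then `Φᵀ η Φ = w + w N + (w N)ᵀ + …`
  -- has second derivatives `X` if those of `w N` are `X / 2`. The quadratic form
  -- `P = w⁻¹ X(x, x)` has second derivatives `2 w⁻¹ X`, hence `N = P / 4` near the origin.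
  let P : Coord n → Matrix (Fin n) (Fin n) ℝ :=
    fun x a i => ∑ k, ∑ m, (∑ b, inv w a b * X b i k m) * (x k * x m)
  have hP :
    ∀ a i, HasJet2 (fun x => P x a i) 0 (fun _ => 0)
      (fun k m => 2 * (∑ b, inv w a b * X b i k m)) := by
    intro a i
    have h : HasJet2 (fun x => P x a i) _ _ _ := HasJet2.sum fun k => HasJet2.sum fun m =>
      ((hasJet2_coord k).mul (hasJet2_coord m)).const_mul (∑ b, inv w a b * X b i k m)
    refine h.congr (by simp) (by simp) fun k m => ?_
    simp only [mul_zero, zero_add, add_zero, mul_add, Finset.sum_add_distrib, mul_ite,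
      mul_one, Finset.sum_ite_eq', Finset.mem_univ, if_true]
    rw [two_mul]
    congr 1
    exact Finset.sum_congr rfl fun b _ => by rw [hX']
  -- The determinant is nonzero for small perturbations of the identity.
  have hdet : ∃ δ > 0, ∀ N : Matrix (Fin n) (Fin n) ℝ, (∀ i j, |N i j| < δ) → (1 + N).det ≠ 0 := by
    have hc : Continuous fun N : Fin n → Fin n → ℝ => (1 + Matrix.of N).det := by
      apply Continuous.matrix_det
      exact continuous_const.add
        (continuous_matrix fun i j => by simp only [Matrix.of_apply]; fun_prop)
    have ho := hc.isOpen_preimage _ (isOpen_compl_singleton (x := (0:ℝ)))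
    obtain ⟨δ, hδ, hb⟩ := Metric.isOpen_iff.1 ho 0 (by simp)
    refine ⟨δ, hδ, fun N hN => ?_⟩
    have : (fun i j => N i j) ∈ Metric.ball (0 : Fin n → Fin n → ℝ) δ := by
      rw [mem_ball_zero_iff, pi_norm_lt_iff hδ]
      intro i; rw [pi_norm_lt_iff hδ]; intro j; exact hN i j
    exact hb this
  obtain ⟨δ, hδ, hdet⟩ := hdet
  have hnear : ∀ᶠ x in 𝓝 (0 : Coord n), ∀ a i, |4⁻¹ * P x a i| < δ := by
    rw [Filter.eventually_all]; intro a; rw [Filter.eventually_all]; intro i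
    have hc : Continuous fun x => |4⁻¹ * P x a i| :=
      (continuous_const.mul (hP a i).1.continuous).abs
    have : |4⁻¹ * P 0 a i| < δ := by rw [(hP a i).2]; simpa using hδ
    exact hc.continuousAt.eventually (Iio_mem_nhds this)
  obtain ⟨r, hr, hball⟩ := Metric.eventually_nhds_iff_ball.1 hnear
  -- A cut-off keeps `N` so small that `1 + N` is invertible everywhere.
  let χ : ContDiffBump (0 : Coord n) := ⟨r / 2, r, by positivity, by linarith⟩
  let N : Coord n → Matrix (Fin n) (Fin n) ℝ := fun x a i => χ x * (4⁻¹ * P x a i)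
  have hN :
    ∀ a i, HasJet2 (fun x => N x a i) 0 (fun _ => 0)
      (fun k m => (∑ b, inv w a b * X b i k m) / 2) := by
    intro a i
    have hχ : HasJet2 (fun x => χ x) 1 (fun _ => 0) (fun _ _ => 0) :=
      (hasJet2_const 1).of_eventuallyEq χ.contDiff χ.eventuallyEq_one
    refine (hχ.mul ((hP a i).const_mul 4⁻¹)).congr (by simp) (by simp) fun k m => ?_
    ring
  have hN1 : ∀ a i, HasJet2 (fun x => (1 + N x) a i) (if a = i then 1 else 0) (fun _ => 0)
    (fun k m => (∑ b, inv w a b * X b i k m) / 2) := by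
    intro a i
    have : (fun x => (1 + N x) a i) = fun x => (if a = i then 1 else 0) + N x a i := by
      ext x; rw [Matrix.add_apply, Matrix.one_apply]
    rw [this]
    exact ((hasJet2_const _).add (hN a i)).congr (by simp) (by simp) (by simp)
  refine ⟨fun x => A₀ * (1 + N x), fun i j => ?_, fun x => ?_, fun i j => ?_⟩
  · simp only [Matrix.mul_apply]
    exact ContDiff.sum fun a _ => contDiff_const.mul (hN1 a j).1
  · rw [Matrix.det_mul]
    refine mul_ne_zero hA₀ ?_
    apply hdet
    intro a i
    by_cases hx : x ∈ Metric.ball (0 : Coord n) r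
    · refine lt_of_le_of_lt ?_ (hball x hx a i)
      change |χ x * (4⁻¹ * P x a i)| ≤ _
      rw [abs_mul, abs_of_nonneg χ.nonneg]
      exact mul_le_of_le_one_left (abs_nonneg _) χ.le_one
    · have : χ x = 0 := χ.zero_of_le_dist (by simpa using hx)
      change |χ x * (4⁻¹ * P x a i)| < δ
      rw [this]; simpa using hδ
  · have e : (fun x => change2 (A₀ * (1 + N x)) (eta n) i j) = fun x => ∑ a, ∑ b, w a b *
      ((1 + N x) a i * (1 + N x) b j) := by
      ext x
      rw [← change2_change2, ← hw]
      simp only [change2]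
      exact Finset.sum_congr rfl fun a _ => Finset.sum_congr rfl fun b _ => by ring
    rw [e]
    have h : HasJet2 (fun x => ∑ a, ∑ b, w a b * ((1 + N x) a i * (1 + N x) b j)) _ _ _ :=
      HasJet2.sum fun a => HasJet2.sum fun b =>
      ((hN1 a i).mul (hN1 b j)).const_mul (w a b)
    refine h.congr (by simp) (by simp) fun k m => ?_
    simp only [mul_zero, add_zero, mul_add, Finset.sum_add_distrib, mul_ite, ite_mul, mul_one,
      one_mul, zero_mul, Finset.sum_ite_eq', Finset.sum_ite_irrel, Finset.sum_const_zero,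
        Finset.mem_univ, if_true]
    have key : ∀ i j, ∑ b, w i b * ((∑ c, inv w b c * X c j k m) / 2) = X i j k m / 2 := by
      intro i j
      simp only [Finset.sum_div, Finset.mul_sum]
      rw [Finset.sum_comm]
      have : ∀ c, ∑ b, w i b * (inv w b c * X c j k m / 2) = (if i = c then 1 else 0) *
        (X c j k m / 2) := by
        intro c
        rw [← self_mul_inv hwd, Finset.sum_mul]
        exact Finset.sum_congr rfl fun b _ => by ring
      simp [this]
    rw [key i j]
    have : ∑ a, w a j * ((∑ c, inv w a c * X c i k m) / 2) = X i j k m / 2 := by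
      rw [hX, ← key j i]
      exact Finset.sum_congr rfl fun b _ => by rw [hws]
    rw [this]; ring

/-! ### Changes of coordinates for metrics and connections on `ℝⁿ` -/

/-- The bilinear map with components `γ^a_{cd} v_c u_d`. In line with `connOf`, the first argument
`u` is the section and goes with the last index of `γ`. -/
def christoffelMap (γ : Arr3 n) : Coord n →L[ℝ] Coord n →L[ℝ] Coord n :=
  ∑ a, ∑ c, ∑ d, γ a c d • (EuclideanSpace.proj d : Coord n →L[ℝ] ℝ).smulRight
    ((EuclideanSpace.proj c : Coord n →L[ℝ] ℝ).smulRight (EuclideanSpace.single a (1 : ℝ)))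

lemma christoffelMap_apply (γ : Arr3 n) (u v : Coord n) (a : Fin n) :
    christoffelMap γ u v a = ∑ c, ∑ d, γ a c d * v c * u d := by
  have h : christoffelMap γ u v a = ∑ b, if a = b then ∑ c, ∑ d, γ b c d * (u d * v c) else 0 := by
    simp only [christoffelMap, FunLike.coe_sum, FunLike.coe_smul, Finset.sum_apply, Pi.smul_apply,
      ContinuousLinearMap.smulRight_apply, WithLp.ofLp_sum, WithLp.ofLp_smul, PiLp.proj_apply,
        PiLp.single_apply, smul_eq_mul]
    refine Finset.sum_congr rfl fun b _ => ?_
    split_ifs with h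
    · simp
    · simp
  rw [h]
  simp only [Finset.sum_ite_eq, Finset.mem_univ, if_true]
  exact Finset.sum_congr rfl fun c _ => Finset.sum_congr rfl fun d _ => by ring

lemma contDiff_christoffelMap {γ : Coord n → Arr3 n}
    (hγ : ∀ a c d, ContDiff ℝ ∞ fun x => γ x a c d) :
    ContDiff ℝ ∞ fun x => christoffelMap (γ x) := by
  unfold christoffelMap
  refine ContDiff.sum fun a _ => ContDiff.sum fun c _ => ContDiff.sum fun d _ => ?_
  exact contDiff_smul_fixed (hγ a c d) _

/-- The components of the metric `G` in the coordinates `x̃` with `x = φ(x̃)`. -/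
def pullMetric (G : Coord n → Arr2 n) (φ : Coord n → Coord n) (x : Coord n) : Arr2 n := fun i j =>
  ∑ a, ∑ b, G (φ x) a b * (pd i (fun y => φ y a) x * pd j (fun y => φ y b) x)

/-- The components `Γ_{ijk}` of the connection with Christoffel symbols `γ`, lowered with the metric
`G`, in the coordinates `x̃` with `x = φ(x̃)`. -/
def pullConnection (G : Coord n → Arr2 n) (γ : Coord n → Arr3 n) (φ : Coord n → Coord n)
    (x : Coord n) : Arr3 n := fun i j k =>
  ∑ a, ∑ b, G (φ x) a b * ((pd i (pd j (fun y => φ y a)) x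
    + ∑ c, ∑ d, γ (φ x) a c d * (pd i (fun y => φ y c) x * pd j (fun y => φ y d) x)) *
      pd k (fun y => φ y b) x)

lemma fderiv_apply_coord {φ : Coord n → Coord n} {x : Coord n} (hφ : DifferentiableAt ℝ φ x)
    (v : Coord n) (a : Fin n) :
    fderiv ℝ φ x v a = fderiv ℝ (fun y => φ y a) x v := by
  have : HasFDerivAt (fun y => φ y a) ((EuclideanSpace.proj a : Coord n →L[ℝ] ℝ).comp
    (fderiv ℝ φ x)) x :=
    (EuclideanSpace.proj a : Coord n →L[ℝ] ℝ).hasFDerivAt.comp x hφ.hasFDerivAt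
  rw [this.fderiv]; rfl

/-- The jet depends only on the germs of the components. -/
lemma jet_congr {G G' : Coord n → Arr2 n} {C C' : Coord n → Arr3 n} {x : Coord n}
    (hG : G =ᶠ[𝓝 x] G') (hC : C =ᶠ[𝓝 x] C') :
    jet G C x = jet G' C' x := by
  have h1 : ∀ i j, (fun y => G y i j) =ᶠ[𝓝 x] fun y => G' y i j := fun i j => hG.mono fun y hy => by
    simp [hy]
  have h2 : ∀ i j k, (fun y => C y i j k) =ᶠ[𝓝 x] fun y => C' y i j k :=
    fun i j k => hC.mono fun y hy => by simp [hy]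
  unfold jet
  rw [hG.eq_of_nhds, hC.eq_of_nhds]
  congr 1
  congr 1
  · ext i j k; exact pd_congr (h1 i j) k
  congr 1
  · ext i j k l; exact pd_congr (pd_eventuallyEq (h1 i j) k) l
  congr 1
  · ext i j k l; exact pd_congr (h2 i j k) l

/-- For all Lorentz metrics and connections on all manifolds, `L` applied to the components in a
chart gives a smooth function which does not depend on the chart. -/
def IsCoordinateInvariant (L : JetSpace n → ℝ) : Prop :=
  ∀ (M : Type) [TopologicalSpace M] [T2Space M] [SecondCountableTopology M]
      [ChartedSpace (Coord n) M] [IsManifold (𝓡 n) ∞ M]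
      (g : LorentzMetric n M) (cov : AffineConnection n M)
      [cov.ContMDiffCovariantDerivative ∞],
      ∃ f : M → ℝ, ContMDiff (𝓡 n) 𝓘(ℝ, ℝ) ∞ f ∧ IsGivenBy L g cov f

/-- For a metric `Φᵀ η Φ` and a connection on `ℝⁿ`, the value of `L` on the jet in the coordinates
`x̃` with `x = φ(x̃)` depends only on the point, by the hypothesis for the chart `φ⁻¹`. -/
lemma exists_value {L : JetSpace n → ℝ} (hL : IsCoordinateInvariant L)
    {Φ : Coord n → Matrix (Fin n) (Fin n) ℝ} (hΦ : ∀ i j, ContDiff ℝ ∞ fun x => Φ x i j)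
    (hdet : ∀ x, (Φ x).det ≠ 0) {γ : Coord n → Arr3 n}
        (hγ : ∀ a c d, ContDiff ℝ ∞ fun x => γ x a c d) :
    ∃ f : Coord n → ℝ, ∀ (φ : Coord n → Coord n) (x : Coord n), ContDiff ℝ ∞ φ →
        (fderiv ℝ φ x).IsInvertible →
     L (jet (pullMetric (fun y => change2 (Φ y) (eta n)) φ)
         (pullConnection (fun y => change2 (Φ y) (eta n)) γ φ) x) = f (φ x) := by
  let g := metricOfFrame Φ hΦ hdet
  have := connOf_contMDiff (contDiff_christoffelMap hγ)
  obtain ⟨f, -, hf⟩ := hL (Coord n) g (connOf fun x => christoffelMap (γ x))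
  refine ⟨f, fun φ x hφ hx => ?_⟩
  obtain ⟨ψ, hxψ, hψ, hinv, hmem⟩ := exists_chart hφ hx
  have hφx : φ x ∈ ψ.symm.source := by rw [← hψ]; exact ψ.map_source hxψ
  rw [← hf ψ.symm hmem (φ x) hφx]
  have hs : ψ.symm (φ x) = x := by rw [← hψ]; exact ψ.left_inv hxψ
  rw [hs]
  have hd : ∀ x, DifferentiableAt ℝ φ x := fun x => (hφ.differentiable (by simp)).differentiableAt
  congr 1
  have hpd : ∀ y i a, fderiv ℝ φ y (EuclideanSpace.single i 1) a = pd i (fun z => φ z a) y :=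
    fun y i a => by
    rw [fderiv_apply_coord (hd y)]; rfl
  apply jet_congr
  · filter_upwards [ψ.open_source.mem_nhds hxψ] with y hy
    ext i j
    rw [metricComp_symm hφ hψ hinv hy g (G := fun y => change2 (Φ y) (eta n)) (fun _ => rfl),
      bilin_apply]
    unfold pullMetric
    refine Finset.sum_congr rfl fun a _ => Finset.sum_congr rfl fun b _ => ?_
    rw [hpd, hpd]; ring
  · filter_upwards [ψ.open_source.mem_nhds hxψ] with y hy
    ext i j k
    rw [connectionComp_symm hφ hψ hinv hy g (G := fun y => change2 (Φ y) (eta n)) (fun _ => rfl),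
      bilin_apply]
    unfold pullConnection
    refine Finset.sum_congr rfl fun a _ => Finset.sum_congr rfl fun b _ => ?_
    rw [hpd, mul_assoc]
    congr 2
    have hd2 : DifferentiableAt ℝ (fun y => fderiv ℝ φ y (EuclideanSpace.single j 1)) y := by
      have : ContDiff ℝ ∞ (fun y => fderiv ℝ φ y (EuclideanSpace.single j 1)) :=
        (hφ.fderiv_right (m := ∞) (by simp)).clm_apply contDiff_const
      exact (this.differentiable (by simp)).differentiableAt
    rw [PiLp.add_apply, christoffelMap_apply, fderiv_apply_coord hd2]
    congr 1
    · have : (fun z => fderiv ℝ φ z (EuclideanSpace.single j 1) a) = pd j (fun y => φ y a) :=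
        funext fun z => hpd z j a
      rw [this]; rfl
    · refine Finset.sum_congr rfl fun c _ => Finset.sum_congr rfl fun d _ => ?_
      rw [hpd, hpd]; ring

lemma isInvertible_fderiv_cubicMap {A : Matrix (Fin n) (Fin n) ℝ} (hA : A.det ≠ 0) {S : Arr3 n}
    {T : Arr4 n} (hS : ∀ a i j, S a i j = S a j i)
    (hT : ∀ a i j k, T a i j k = T a j i k) (hT' : ∀ a i j k, T a i j k = T a i k j) :
    (fderiv ℝ (cubicMap A S T) 0).IsInvertible := by
  have hd : DifferentiableAt ℝ (cubicMap A S T) 0 :=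
    ((contDiff_cubicMap A S T).differentiable (by simp)).differentiableAt
  let e₀ : (Fin n → ℝ) ≃ₗ[ℝ] (Fin n → ℝ) :=
    Matrix.toLinearEquiv' A (Matrix.invertibleOfIsUnitDet A (by simpa using hA))
  let e : Coord n ≃ₗ[ℝ] Coord n :=
    (WithLp.linearEquiv 2 ℝ (Fin n → ℝ)).trans (e₀.trans (WithLp.linearEquiv 2 ℝ (Fin n → ℝ)).symm)
  refine ⟨e.toContinuousLinearEquiv, ?_⟩
  ext v a
  rw [fderiv_apply_coord hd, fderiv_apply_eq_sum_pd]
  simp only [(hasJet2_pd_cubicMap A hS hT hT' a _).2]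
  change (A.mulVec v.ofLp) a = _
  simp only [Matrix.mulVec, dotProduct, mul_comm]

/-! ### Jets after a cubic change of coordinates -/

/-- The components in the new coordinates of a `(0,4)`-tensor. -/
def change4 (A : Matrix (Fin n) (Fin n) ℝ) (X : Arr4 n) : Arr4 n := fun i j k l =>
  ∑ a, ∑ b, ∑ c, ∑ d, A a i * A b j * A c k * A d l * X a b c d

/-- The `2`-jet of a metric with vanishing first derivatives after a cubic change of coordinates. -/
lemma hasJet2_pullMetric {G : Coord n → Arr2 n} {w : Arr2 n} {X : Arr4 n}
    (hG : ∀ i j, HasJet2 (fun x => G x i j) (w i j) (fun _ => 0) (X i j))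
    (A : Matrix (Fin n) (Fin n) ℝ) {S : Arr3 n} {T : Arr4 n} (hS : ∀ a i j, S a i j = S a j i)
    (hT : ∀ a i j k, T a i j k = T a j i k) (hT' : ∀ a i j k, T a i j k = T a i k j) (i j : Fin n) :
    HasJet2 (fun x => pullMetric G (cubicMap A S T) x i j) (change2 A w i j)
     (fun k => ∑ a, ∑ b, w a b * (S a i k * A b j + A a i * S b j k))
     (fun k m => change4 A X i j k m + ∑ a, ∑ b, w a b *
         (T a i k m * A b j + S a i k * S b j m + S a i m * S b j k + A a i * T b j k m)) := by
  have hφ := contDiff_cubicMap A S T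
  have h0 := cubicMap_zero A S T
  have hA : ∀ a k, pd k (fun y => cubicMap A S T y a) 0 = A a k :=
    fun a k => (hasJet2_pd_cubicMap A hS hT hT' a k).2
  have h : HasJet2 (fun x => pullMetric G (cubicMap A S T) x i j) _ _ _ :=
    HasJet2.sum fun a => HasJet2.sum fun b =>
    ((hG a b).comp_of_critical hφ h0 hA).mul
      ((hasJet2_pd_cubicMap A hS hT hT' a i).mul (hasJet2_pd_cubicMap A hS hT hT' b j))
  refine h.congr ?_ (fun k => ?_) (fun k m => ?_)
  · unfold change2
    exact Finset.sum_congr rfl fun a _ => Finset.sum_congr rfl fun b _ => by ring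
  · exact Finset.sum_congr rfl fun a _ => Finset.sum_congr rfl fun b _ => by ring
  · unfold change4
    simp only [← Finset.sum_add_distrib]
    refine Finset.sum_congr rfl fun a _ => Finset.sum_congr rfl fun b _ => ?_
    have : ∑ c, ∑ d, A a i * A b j * A c k * A d m * X a b c d =
      (∑ c, ∑ d, X a b c d * A c k * A d m) * (A a i * A b j) := by
      simp only [Finset.sum_mul]
      exact Finset.sum_congr rfl fun c _ => Finset.sum_congr rfl fun d _ => by ring
    rw [this]; ring

/-- The `1`-jet of the lowered connection components after a cubic change of coordinates, when the
first derivatives of the metric vanish. In terms of the Christoffel symbols `γ` this jet involves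
only their lowered value `C` and derivative `C₁`. -/
lemma hasJet1_pullConnection {G : Coord n → Arr2 n} {w : Arr2 n} {X : Arr4 n}
    (hG : ∀ i j, HasJet2 (fun x => G x i j) (w i j) (fun _ => 0) (X i j))
    {γ : Coord n → Arr3 n} {γ₀ : Arr3 n} {γ₁ : Arr4 n}
        (hγ : ∀ a i j, HasJet1 (fun x => γ x a i j) (γ₀ a i j) (γ₁ a i j))
    {C : Arr3 n} {C₁ : Arr4 n} (hC : ∀ i j k, ∑ a, w a k * γ₀ a i j = C i j k)
        (hC₁ : ∀ i j k l, ∑ a, w a k * γ₁ a i j l = C₁ i j k l)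
    (A : Matrix (Fin n) (Fin n) ℝ) {S : Arr3 n} {T : Arr4 n} (hS : ∀ a i j, S a i j = S a j i)
    (hT : ∀ a i j k, T a i j k = T a j i k) (hT' : ∀ a i j k, T a i j k = T a i k j)
        (i j k : Fin n) :
    HasJet1 (fun x => pullConnection G γ (cubicMap A S T) x i j k)
        (change3 A C i j k + ∑ a, ∑ b, w a b * (S a j i * A b k))
     (fun m => change4 A C₁ i j k m + ∑ c, ∑ d, ∑ b, C c d b *
         (S c i m * A d j * A b k + A c i * S d j m * A b k + A c i * A d j * S b k m)
       + ∑ a, ∑ b, w a b * (T a j i m * A b k + S a j i * S b k m)) := by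
  have hφ := contDiff_cubicMap A S T
  have h0 := cubicMap_zero A S T
  have hA : ∀ a k, pd k (fun y => cubicMap A S T y a) 0 = A a k :=
    fun a k => (hasJet2_pd_cubicMap A hS hT hT' a k).2
  have h : HasJet1 (fun x => pullConnection G γ (cubicMap A S T) x i j k) _ _ :=
    HasJet1.sum fun a => HasJet1.sum fun b =>
    ((hG a b).comp_of_critical hφ h0 hA).toJet1.mul
      ((((hasJet2_pd_cubicMap A hS hT hT' a j).jet1_pd i).add
        (HasJet1.sum fun c => HasJet1.sum fun d =>
        ((hγ a c d).comp hφ h0 hA).mul ((hasJet2_pd_cubicMap A hS hT hT' c i).toJet1.mul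
          (hasJet2_pd_cubicMap A hS hT hT' d j).toJet1))).mul
      (hasJet2_pd_cubicMap A hS hT hT' b k).toJet1)
  have move : ∀ (F : Fin n → Fin n → Fin n → Fin n → ℝ), ∑ a, ∑ b, ∑ c, ∑ d, F a b c d =
    ∑ c, ∑ d, ∑ b, ∑ a, F a b c d := by
    intro F
    calc ∑ a, ∑ b, ∑ c, ∑ d, F a b c d = ∑ a, ∑ c, ∑ d, ∑ b, F a b c d := by
          refine Finset.sum_congr rfl fun a _ => ?_
          rw [Finset.sum_comm]
          exact Finset.sum_congr rfl fun c _ => Finset.sum_comm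
      _ = ∑ c, ∑ d, ∑ a, ∑ b, F a b c d := by
          rw [Finset.sum_comm]
          exact Finset.sum_congr rfl fun c _ => Finset.sum_comm
      _ = _ := Finset.sum_congr rfl fun c _ => Finset.sum_congr rfl fun d _ => Finset.sum_comm
  refine h.congr ?_ (fun m => ?_)
  · have e : ∀ a b, w a b * ((S a j i + ∑ c, ∑ d, γ₀ a c d * (A c i * A d j)) * A b k)
        = ∑ c, ∑ d, w a b * γ₀ a c d * (A c i * A d j * A b k) + w a b * (S a j i * A b k) := by
      intro a b
      simp only [add_mul, mul_add, Finset.sum_mul, Finset.mul_sum]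
      rw [add_comm]
      congr 1
      exact Finset.sum_congr rfl fun c _ => Finset.sum_congr rfl fun d _ => by ring
    simp only [e, Finset.sum_add_distrib]
    rw [move]
    congr 1
    unfold change3
    refine Finset.sum_congr rfl fun c _ => Finset.sum_congr rfl fun d _ =>
      Finset.sum_congr rfl fun b _ => ?_
    rw [← Finset.sum_mul, hC]; ring
  · have e : ∀ a b, 0 * ((S a j i + ∑ c, ∑ d, γ₀ a c d * (A c i * A d j)) * A b k) + w a b *
      ((T a j i m + ∑ c, ∑ d, ((∑ l, γ₁ a c d l * A l m) * (A c i * A d j) + γ₀ a c d *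
        (S c i m * A d j + A c i * S d j m))) * A b k
            + (S a j i + ∑ c, ∑ d, γ₀ a c d * (A c i * A d j)) * S b k m)
        = ∑ c, ∑ d, ((∑ l, w a b * γ₁ a c d l * (A c i * A d j * A b k * A l m)) + w a b *
          γ₀ a c d * (S c i m * A d j * A b k + A c i * S d j m * A b k + A c i * A d j * S b k m))
            +
          w a b * (T a j i m * A b k + S a j i * S b k m) := by
      intro a b
      have e1 : ∀ c d, (∑ l, w a b * γ₁ a c d l * (A c i * A d j * A b k * A l m)) = w a b *
        ((∑ l, γ₁ a c d l * A l m) * (A c i * A d j) * A b k) := by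
        intro c d
        simp only [Finset.sum_mul, Finset.mul_sum]
        exact Finset.sum_congr rfl fun l _ => by ring
      simp only [e1]
      have e2 : ∀ (F : Fin n → Fin n → ℝ) (r s : ℝ), r * ((∑ c, ∑ d, F c d) * s) = ∑ c, ∑ d, r *
        (F c d * s) := by
        intro F r s; simp only [Finset.sum_mul, Finset.mul_sum]
      have e3 : ∀ z u t p r s q v : ℝ, 0 * z + u * ((t + p) * r + (s + q) * v) =
        (u * (p * r) + u * (q * v)) + u * (t * r + s * v) := by
        intros; ring
      rw [e3, e2, e2, ← Finset.sum_add_distrib]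
      congr 1
      · refine Finset.sum_congr rfl fun c _ => ?_
        rw [← Finset.sum_add_distrib]
        exact Finset.sum_congr rfl fun d _ => by ring
    refine (Finset.sum_congr rfl fun a _ => Finset.sum_congr rfl fun b _ => e a b).trans ?_
    simp only [Finset.sum_add_distrib]
    rw [move]
    congr 1
    congr 1
    · unfold change4
      refine Finset.sum_congr rfl fun c _ => Finset.sum_congr rfl fun d _ =>
        Finset.sum_congr rfl fun b _ => ?_
      rw [Finset.sum_comm]
      refine Finset.sum_congr rfl fun l _ => ?_
      rw [← Finset.sum_mul, hC₁]; ring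
    · rw [move]
      refine Finset.sum_congr rfl fun c _ => Finset.sum_congr rfl fun d _ =>
        Finset.sum_congr rfl fun b _ => ?_
      rw [← Finset.sum_mul, hC]

/-- The jets in all coordinates `x = A x̃ + ½ S(x̃, x̃) + ⅙ T(x̃, x̃, x̃)` of one metric, with jet
`(w, 0, X)`, and one connection, with jet `(C, C₁)`, are assigned the same value by `L`. -/
lemma value_jet_eq {L : JetSpace n → ℝ} (hL : IsCoordinateInvariant L)
    {A₀ : Matrix (Fin n) (Fin n) ℝ} (hA₀ : A₀.det ≠ 0) {w : Arr2 n} (hw : w = change2 A₀ (eta n))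
      {X : Arr4 n}
    (hX : ∀ i j k l, X i j k l = X j i k l) (hX' : ∀ i j k l, X i j k l = X i j l k) (C : Arr3 n)
        (C₁ : Arr4 n) :
    ∃ r : ℝ, ∀ (A : Matrix (Fin n) (Fin n) ℝ) (S : Arr3 n) (T : Arr4 n), A.det ≠ 0 →
        (∀ a i j, S a i j = S a j i) →
    (∀ a i j k, T a i j k = T a j i k) → (∀ a i j k, T a i j k = T a i k j) →
    L (change2 A w, fun i j k => ∑ a, ∑ b, w a b * (S a i k * A b j + A a i * S b j k),
     fun i j k m => change4 A X i j k m + ∑ a, ∑ b, w a b *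
         (T a i k m * A b j + S a i k * S b j m + S a i m * S b j k + A a i * T b j k m),
     fun i j k => change3 A C i j k + ∑ a, ∑ b, w a b * (S a j i * A b k),
     fun i j k m => change4 A C₁ i j k m + ∑ c, ∑ d, ∑ b, C c d b *
         (S c i m * A d j * A b k + A c i * S d j m * A b k + A c i * A d j * S b k m)
       + ∑ a, ∑ b, w a b * (T a j i m * A b k + S a j i * S b k m)) = r := by
  have hwd : (Matrix.of w).det ≠ 0 := by
    rw [hw, det_change2]; exact mul_ne_zero (pow_ne_zero _ hA₀) det_eta_ne_zero
  have hws : ∀ i j, w i j = w j i := by rw [hw]; exact change2_symm _ eta_symm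
  obtain ⟨Φ, hΦ, hdet, hG⟩ := exists_frame hA₀ hw hX hX'
  -- Christoffel symbols which are affine functions and whose lowered `1`-jet is `(C, C₁)`.
  let γ : Coord n → Arr3 n := fun x a c d => ∑ b, inv w a b * (C c d b + ∑ l, C₁ c d b l * x l)
  have hγ : ∀ a c d, HasJet1 (fun x => γ x a c d) (∑ b, inv w a b * C c d b)
    (fun l => ∑ b, inv w a b * C₁ c d b l) := by
    intro a c d
    have h : HasJet2 (fun x => γ x a c d) _ _ _ :=
      HasJet2.sum fun b =>
        ((hasJet2_const (C c d b)).add (HasJet2.sum fun l => (hasJet2_coord l).const_mul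
          (C₁ c d b l))).const_mul (inv w a b)
    exact h.toJet1.congr (by simp) (by simp)
  -- Lowering an index that was raised.
  have low : ∀ (F : Fin n → ℝ) k, ∑ a, w a k * ∑ b, inv w a b * F b = F k := by
    intro F k
    simp only [Finset.mul_sum]
    rw [Finset.sum_comm]
    have : ∀ b, ∑ a, w a k * (inv w a b * F b) = (if k = b then 1 else 0) * F b := by
      intro b
      rw [← self_mul_inv hwd, Finset.sum_mul]
      exact Finset.sum_congr rfl fun a _ => by rw [hws]; ring
    simp [this]
  obtain ⟨f, hf⟩ := exists_value hL hΦ hdet (fun a c d => (hγ a c d).1)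
  refine ⟨f 0, fun A S T hA hS hT hT' => ?_⟩
  have := hf (cubicMap A S T) 0 (contDiff_cubicMap A S T)
    (isInvertible_fderiv_cubicMap hA hS hT hT')
  rw [cubicMap_zero] at this
  rw [← this]
  congr 1
  have hg := hasJet2_pullMetric hG A hS hT hT'
  have hc := hasJet1_pullConnection hG hγ (fun i j k => low _ k)
    (fun i j k l => low (fun b => C₁ i j b l) k) A hS hT hT'
  unfold jet
  ext i j k l
  · exact (hg i j).2.symm
  · exact ((hg i j).3 k).symm
  · exact ((hg i j).4 k l).symm
  · exact (hc i j k).2.symm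
  · exact ((hc i j k).3 l).symm

/-! ### Invariance in terms of the difference array -/

/-- The change of `g_{ij,k}` under `x = x̃ + ½ S(x̃, x̃)`, when `∂g = 0` in the coordinates `x`. -/
def metricShift (w : Arr2 n) (S : Arr3 n) :
    Arr3 n := fun i j k => ∑ a, (w a j * S a i k + w i a * S a j k)

/-- The part of the change of `g_{ij,kl}` quadratic in the second derivatives `S` of the coordinate
change. -/
def metricQuad (w : Arr2 n) (S : Arr3 n) :
    Arr4 n := fun i j k l => ∑ a, ∑ b, w a b * (S a i k * S b j l + S a i l * S b j k)

/-- The part of the change of `g_{ij,kl}` linear in the third derivatives `T` of the coordinate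
change. -/
def metricCubic (w : Arr2 n) (T : Arr4 n) :
    Arr4 n := fun i j k l => ∑ a, (w a j * T a i k l + w i a * T a j k l)

/-- The change of `D_{ijk,l}` for a tensor `D` under `x = x̃ + ½ S(x̃, x̃)`. -/
def derivShift (D : Arr3 n) (S : Arr3 n) : Arr4 n := fun i j k l =>
  ∑ a, (D a j k * S a i l + D i a k * S a j l + D i j a * S a k l)

/-- The Levi-Civita symbols of the first kind in terms of the array `s_{ijk} = g_{ij,k}`. -/
def lc3 (s : Arr3 n) : Arr3 n := fun i j k => (s j k i + s i k j - s i j k) / 2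

/-- The derivatives of the Levi-Civita symbols of the first kind in terms of the array
`x_{ijkl} = g_{ij,kl}`. -/
def lc4 (x : Arr4 n) : Arr4 n := fun i j k l => (x j k i l + x i k j l - x i j k l) / 2

/-- The jet with metric `w`, `∂g = s`, `∂∂g = x`, difference array `d`, and `y` the array of first
derivatives of the difference array. -/
def hatJet (w : Arr2 n) (s : Arr3 n) (x : Arr4 n) (d : Arr3 n) (y : Arr4 n) : JetSpace n :=
  (w, s, x, d + lc3 s, y + lc4 x)

/-- The symmetries of an array of second derivatives `g_{ij,kl}`. -/
def IsSymm4 (x : Arr4 n) :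
    Prop := (∀ i j k l, x i j k l = x j i k l) ∧ ∀ i j k l, x i j k l = x i j l k

lemma IsLorentz.symm {w : Arr2 n} (hw : IsLorentz w) (i j : Fin n) : w i j = w j i := by
  obtain ⟨A, -, rfl⟩ := hw
  exact change2_symm A eta_symm i j

lemma IsLorentz.det_ne_zero {w : Arr2 n} (hw : IsLorentz w) : (Matrix.of w).det ≠ 0 := by
  obtain ⟨A, hA, rfl⟩ := hw
  exact (det_change2 A (eta n)).trans_ne (mul_ne_zero (pow_ne_zero _ hA) det_eta_ne_zero)

lemma IsLorentz.change2 {w : Arr2 n} (hw : IsLorentz w) {A : Matrix (Fin n) (Fin n) ℝ}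
    (hA : A.det ≠ 0) : IsLorentz (change2 A w) := by
  obtain ⟨B, hB, rfl⟩ := hw
  exact ⟨B * A, by rw [Matrix.det_mul]; exact mul_ne_zero hB hA, change2_change2 B A (eta n)⟩

lemma isLorentz_eta : IsLorentz (eta n) := ⟨1, by simp, (change2_one (eta n)).symm⟩

lemma change3_one (C : Arr3 n) : change3 1 C = C := by
  ext i j k; simp [change3, Matrix.one_apply]

lemma change4_one (C : Arr4 n) : change4 1 C = C := by
  ext i j k l; simp [change4, Matrix.one_apply]

lemma change4_add (A : Matrix (Fin n) (Fin n) ℝ) (x y : Arr4 n) :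
    change4 A (x + y) = change4 A x + change4 A y := by
  ext i j k l; simp [change4, mul_add, Finset.sum_add_distrib]

lemma change4_swap12 (A : Matrix (Fin n) (Fin n) ℝ) (x : Arr4 n) (i j k l : Fin n) :
    change4 A (fun i j k l => x j i k l) i j k l = change4 A x j i k l := by
  unfold change4
  rw [Finset.sum_comm]
  exact Finset.sum_congr rfl fun a _ => Finset.sum_congr rfl fun b _ => Finset.sum_congr rfl fun c
    _ => Finset.sum_congr rfl fun d _ => by ring

lemma change4_swap23 (A : Matrix (Fin n) (Fin n) ℝ) (x : Arr4 n) (i j k l : Fin n) :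
    change4 A (fun i j k l => x i k j l) i j k l = change4 A x i k j l := by
  unfold change4
  refine Finset.sum_congr rfl fun a _ => ?_
  rw [Finset.sum_comm]
  exact Finset.sum_congr rfl fun b _ => Finset.sum_congr rfl fun c _ => Finset.sum_congr rfl fun d
    _ => by ring

lemma change4_swap34 (A : Matrix (Fin n) (Fin n) ℝ) (x : Arr4 n) (i j k l : Fin n) :
    change4 A (fun i j k l => x i j l k) i j k l = change4 A x i j l k := by
  unfold change4
  refine Finset.sum_congr rfl fun a _ => Finset.sum_congr rfl fun b _ => ?_
  rw [Finset.sum_comm]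
  exact Finset.sum_congr rfl fun c _ => Finset.sum_congr rfl fun d _ => by ring

lemma IsSymm4.change4 {x : Arr4 n} (hx : IsSymm4 x) (A : Matrix (Fin n) (Fin n) ℝ) :
    IsSymm4 (change4 A x) := by
  constructor
  · intro i j k l
    rw [← change4_swap12]; congr 1; ext a b c d; exact (hx.1 a b c d).symm
  · intro i j k l
    rw [← change4_swap34]; congr 1; ext a b c d; exact (hx.2 a b c d).symm

lemma change4_lc4 (A : Matrix (Fin n) (Fin n) ℝ) (x : Arr4 n) :
    change4 A (lc4 x) = lc4 (change4 A x) := by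
  have h1 : ∀ i j k l, change4 A (fun i j k l => x i k j l) i j k l = change4 A x i k j l :=
    change4_swap23 A x
  have h2 : ∀ i j k l, change4 A (fun i j k l => x j k i l) i j k l = change4 A x j k i l := by
    intro i j k l
    have := change4_swap12 A (fun i j k l => x i k j l) i j k l
    rw [this, h1]
  ext i j k l
  have e : change4 A (lc4 x) i j k l =
    (change4 A (fun i j k l => x j k i l) i j k l + change4 A (fun i j k l => x i k j l) i j k
      l - change4 A x i j k l) / 2 := by
    simp only [change4, lc4, ← Finset.sum_add_distrib, ← Finset.sum_sub_distrib, Finset.sum_div]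
    exact Finset.sum_congr rfl fun a _ => Finset.sum_congr rfl fun b _ => Finset.sum_congr rfl fun c
      _ => Finset.sum_congr rfl fun d _ => by ring
  rw [e, h1, h2]; rfl

lemma lc3_zero : lc3 (0 : Arr3 n) = 0 := by
  ext i j k; simp [lc3]

/-- Invariance of `L` under linear changes of coordinates: the difference array and its first
derivatives transform as tensors. -/
theorem value_linear_change {L : JetSpace n → ℝ} (hL : IsCoordinateInvariant L) {w : Arr2 n}
    (hw : IsLorentz w) {x : Arr4 n} (hx : IsSymm4 x) (d : Arr3 n) (y : Arr4 n)
    {A : Matrix (Fin n) (Fin n) ℝ} (hA : A.det ≠ 0) :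
    L (hatJet (change2 A w) 0 (change4 A x) (change3 A d) (change4 A y)) =
        L (hatJet w 0 x d y) := by
  obtain ⟨A₀, hA₀, hw⟩ := hw
  obtain ⟨r, hr⟩ := value_jet_eq hL hA₀ hw hx.1 hx.2 d (y + lc4 x)
  have h1 := hr A 0 0 hA (fun _ _ _ => rfl) (fun _ _ _ _ => rfl) (fun _ _ _ _ => rfl)
  have h2 := hr 1 0 0 (by simp) (fun _ _ _ => rfl) (fun _ _ _ _ => rfl) (fun _ _ _ _ => rfl)
  rw [← h2] at h1
  simp only [Pi.zero_apply, zero_mul, mul_zero, add_zero, Finset.sum_const_zero, change2_one,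
    change3_one, change4_one] at h1
  unfold hatJet
  rw [lc3_zero, add_zero, add_zero, ← change4_lc4, ← change4_add]
  exact h1

/-- Invariance of `L` under `x = x̃ + ½ S(x̃, x̃) + ⅙ T(x̃, x̃, x̃)`: the difference array `d` does
not change, and its derivative does not see `T`. -/
theorem value_shift {L : JetSpace n → ℝ} (hL : IsCoordinateInvariant L) {w : Arr2 n}
    (hw : IsLorentz w) {x : Arr4 n} (hx : IsSymm4 x) (d : Arr3 n) (y : Arr4 n)
    {S : Arr3 n} {T : Arr4 n} (hS : ∀ a i j, S a i j = S a j i)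
    (hT : ∀ a i j k, T a i j k = T a j i k) (hT' : ∀ a i j k, T a i j k = T a i k j) :
    L (hatJet w (metricShift w S) (x + metricQuad w S + metricCubic w T) d (y + derivShift d S)) =
        L (hatJet w 0 x d y) := by
  have hws := hw.symm
  obtain ⟨A₀, hA₀, hw⟩ := hw
  obtain ⟨r, hr⟩ := value_jet_eq hL hA₀ hw hx.1 hx.2 d (y + lc4 x)
  have h1 := hr 1 S T (by simp) hS hT hT'
  have h2 := hr 1 0 0 (by simp) (fun _ _ _ => rfl) (fun _ _ _ _ => rfl) (fun _ _ _ _ => rfl)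
  rw [← h2] at h1
  simp only [Pi.zero_apply, zero_mul, mul_zero, add_zero, Finset.sum_const_zero, change2_one,
    change3_one, change4_one] at h1
  unfold hatJet
  rw [lc3_zero, add_zero]
  refine Eq.trans (congrArg L ?_) h1
  -- The transformation formulas with `A = 1`, one for each component of the jet.
  have e1 : metricShift w S = fun i j k => ∑ a, ∑ b, w a b *
    (S a i k * (1 : Matrix (Fin n) (Fin n) ℝ) b j + (1 : Matrix (Fin n) (Fin n) ℝ) a i *
      S b j k) := by
    ext i j k
    simp [metricShift, Matrix.one_apply, mul_add, Finset.sum_add_distrib]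
  have e2 : x + metricQuad w S + metricCubic w T = fun i j k m => x i j k m + ∑ a, ∑ b, w a b *
    (T a i k m * (1 : Matrix (Fin n) (Fin n) ℝ) b j + S a i k * S b j m + S a i m * S b j k +
      (1 : Matrix (Fin n) (Fin n) ℝ) a i * T b j k m) := by
    ext i j k m
    simp [metricQuad, metricCubic, Matrix.one_apply, mul_add, Finset.sum_add_distrib]
    ring
  have e3 : d + lc3 (metricShift w S) = fun i j k => d i j k + ∑ a, ∑ b, w a b *
    (S a j i * (1 : Matrix (Fin n) (Fin n) ℝ) b k) := by
    ext i j k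
    simp only [Pi.add_apply, lc3, metricShift, Matrix.one_apply, mul_ite, mul_one, mul_zero,
      Finset.sum_ite_eq', Finset.mem_univ, if_true]
    congr 1
    rw [← Finset.sum_add_distrib, ← Finset.sum_sub_distrib, Finset.sum_div]
    refine Finset.sum_congr rfl fun a _ => ?_
    rw [hS a i j, hS a k i, hS a k j, hws j a]; ring
  have e4 : y + derivShift d S + lc4 (x + metricQuad w S + metricCubic w T) = fun i j k m =>
    (y + lc4 x) i j k m + ∑ c, ∑ e, ∑ b, d c e b *
      (S c i m * (1 : Matrix (Fin n) (Fin n) ℝ) e j * (1 : Matrix (Fin n) (Fin n) ℝ) b k +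
        (1 : Matrix (Fin n) (Fin n) ℝ) c i * S e j m * (1 : Matrix (Fin n) (Fin n) ℝ) b k +
          (1 : Matrix (Fin n) (Fin n) ℝ) c i * (1 : Matrix (Fin n) (Fin n) ℝ) e j * S b k m)
       + ∑ a, ∑ b, w a b *
         (T a j i m * (1 : Matrix (Fin n) (Fin n) ℝ) b k + S a j i * S b k m) := by
    ext i j k m
    -- The terms quadratic in `S` and linear in `T` of the connection components are what `lc4`
    -- makes of those of the metric, so they do not affect the derivative of the difference array.
    have q : lc4 (metricQuad w S) i j k m = ∑ a, ∑ b, w a b * (S a j i * S b k m) := by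
      have sw : ∀ i j k l, ∑ a, ∑ b, w a b * (S a i k * S b j l) = ∑ a, ∑ b, w a b *
        (S a j l * S b i k) := by
        intro i j k l
        rw [Finset.sum_comm]
        exact Finset.sum_congr rfl fun a _ => Finset.sum_congr rfl fun b _ => by rw [hws]; ring
      have r : ∀ i j k l, metricQuad w S i j k l = ∑ a, ∑ b, w a b * (S a i k * S b j l) +
        ∑ a, ∑ b, w a b * (S a i l * S b j k) := by
        intro i j k l; simp only [metricQuad, mul_add, Finset.sum_add_distrib]
      simp only [lc4, r]
      rw [sw i k m j, sw i j m k, sw i j k m]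
      simp only [hS _ k i, hS _ k j, hS _ j i]
      ring
    have t : lc4 (metricCubic w T) i j k m = ∑ a, w a k * T a j i m := by
      simp only [lc4, metricCubic]
      rw [← Finset.sum_add_distrib, ← Finset.sum_sub_distrib, Finset.sum_div]
      refine Finset.sum_congr rfl fun a _ => ?_
      rw [hT a i j, hT a k i, hT a k j, hws j a]; ring
    have s : lc4 (x + metricQuad w S + metricCubic w T) i j k m = lc4 x i j k m +
      lc4 (metricQuad w S) i j k m + lc4 (metricCubic w T) i j k m := by
      simp only [lc4, Pi.add_apply]; ring
    have u : derivShift d S i j k m = ∑ c, ∑ e, ∑ b, d c e b *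
      (S c i m * (1 : Matrix (Fin n) (Fin n) ℝ) e j * (1 : Matrix (Fin n) (Fin n) ℝ) b k +
        (1 : Matrix (Fin n) (Fin n) ℝ) c i * S e j m * (1 : Matrix (Fin n) (Fin n) ℝ) b k +
          (1 : Matrix (Fin n) (Fin n) ℝ) c i * (1 : Matrix (Fin n) (Fin n) ℝ) e j * S b k m) := by
      simp [derivShift, Matrix.one_apply, mul_add, Finset.sum_add_distrib]
    have v :
      ∑ a, ∑ b, w a b * (T a j i m * (1 : Matrix (Fin n) (Fin n) ℝ) b k + S a j i * S b k m) =
        ∑ a, w a k * T a j i m + ∑ a, ∑ b, w a b * (S a j i * S b k m) := by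
      simp [Matrix.one_apply, mul_add, Finset.sum_add_distrib]
    rw [Pi.add_apply, Pi.add_apply, Pi.add_apply, Pi.add_apply, Pi.add_apply, Pi.add_apply,
      Pi.add_apply, Pi.add_apply, s, q, t, u, v]
    simp only [Pi.add_apply]; ring
  rw [← e1, ← e2, ← e3, ← e4]

/-! ### Linear functionals on arrays of four indices -/

/-- The covector `e_i` of the standard dual basis. -/
def stdCovector (i : Fin n) : Fin n → ℝ := fun a => if a = i then 1 else 0

/-- The tensor product `u ⊗ v ⊗ w ⊗ z` of four covectors. -/
def tensor4 (u v w z : Fin n → ℝ) : Arr4 n := fun i j k l => u i * v j * w k * z l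

/-- The array with entry `1` at `(i, j, k, l)` and `0` elsewhere. -/
def basis4 (i j k l : Fin n) :
    Arr4 n := tensor4 (stdCovector i) (stdCovector j) (stdCovector k) (stdCovector l)

lemma eq_sum_basis4 (x : Arr4 n) : x = ∑ i, ∑ j, ∑ k, ∑ l, x i j k l • basis4 i j k l := by
  ext a b c d
  simp [basis4, tensor4, stdCovector]

lemma map_eq_sum_basis4 (f : Arr4 n →ₗ[ℝ] ℝ) (x : Arr4 n) :
    f x = ∑ i, ∑ j, ∑ k, ∑ l, x i j k l * f (basis4 i j k l) := by
  conv_lhs => rw [eq_sum_basis4 x]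
  simp only [map_sum, map_smul, smul_eq_mul]

lemma sum4_swap12 (F : Fin n → Fin n → Fin n → Fin n → ℝ) :
    ∑ i, ∑ j, ∑ k, ∑ l, F j i k l = ∑ i, ∑ j, ∑ k, ∑ l, F i j k l :=
  Finset.sum_comm

lemma sum4_swap23 (F : Fin n → Fin n → Fin n → Fin n → ℝ) :
    ∑ i, ∑ j, ∑ k, ∑ l, F i k j l = ∑ i, ∑ j, ∑ k, ∑ l, F i j k l :=
  Finset.sum_congr rfl fun _ _ => Finset.sum_comm

lemma sum4_swap34 (F : Fin n → Fin n → Fin n → Fin n → ℝ) :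
    ∑ i, ∑ j, ∑ k, ∑ l, F i j l k = ∑ i, ∑ j, ∑ k, ∑ l, F i j k l :=
  Finset.sum_congr rfl fun _ _ => Finset.sum_congr rfl fun _ _ => Finset.sum_comm

lemma sum4_swap24 (F : Fin n → Fin n → Fin n → Fin n → ℝ) :
    ∑ i, ∑ j, ∑ k, ∑ l, F i l k j = ∑ i, ∑ j, ∑ k, ∑ l, F i j k l := by
  rw [← sum4_swap34 (fun i j k l => F i l k j), ← sum4_swap23 (fun i j k l => F i k l j),
    sum4_swap34 (fun i j k l => F i j l k), sum4_swap34]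

lemma sum4_swap14 (F : Fin n → Fin n → Fin n → Fin n → ℝ) :
    ∑ i, ∑ j, ∑ k, ∑ l, F l j k i = ∑ i, ∑ j, ∑ k, ∑ l, F i j k l := by
  calc ∑ i, ∑ j, ∑ k, ∑ l, F l j k i = ∑ i, ∑ j, ∑ k, ∑ l, F l i k j :=
    sum4_swap12 (fun i j k l => F l i k j)
    _ = ∑ i, ∑ j, ∑ k, ∑ l, F j i k l := sum4_swap24 (fun i j k l => F j i k l)
    _ = _ := sum4_swap12 F

/-- The coefficients `c` of a functional which vanishes on all arrays `derivShift d S` are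
antisymmetric in their last index and each other one. For `S` with
`S^a_{il} = δ^a_i z_l + δ^a_l z_i` one gets `3 c_{ijkl} + c_{ljki} + c_{ilkj} + c_{ijlk} = 0`; this
suffices, as it makes the sum of the squares of the three symmetrized coefficients vanish. -/
lemma antisymm_of_derivShift {f : Arr4 n →ₗ[ℝ] ℝ}
    (hf : ∀ (d S : Arr3 n), (∀ a i j, S a i j = S a j i) → f (derivShift d S) = 0)
      (i j k l : Fin n) :
    f (basis4 l j k i) = - f (basis4 i j k l) ∧ f (basis4 i l k j) = - f (basis4 i j k l) ∧
        f (basis4 i j l k) = - f (basis4 i j k l) := by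
  set c : Fin n → Fin n → Fin n → Fin n → ℝ := fun i j k l => f (basis4 i j k l) with hc
  have key : ∀ i j k l, 3 * c i j k l + c l j k i + c i l k j + c i j l k = 0 := by
    intro p q r m
    -- The test arrays `d = e_p ⊗ e_q ⊗ e_r` and `z = e_m`.
    have h := hf (fun i j k => stdCovector p i * stdCovector q j * stdCovector r k)
      (fun a i l => (if a = i then stdCovector m l else 0) + (if a = l then stdCovector m i else 0))
        (by
      intro a i j; ring)
    have e : derivShift (fun i j k => stdCovector p i * stdCovector q j * stdCovector r k)
      (fun a i l => (if a = i then stdCovector m l else 0) + (if a = l then stdCovector m i else 0))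
        = (3 : ℝ) • basis4 p q r m + basis4 m q r p + basis4 p m r q + basis4 p q m r := by
      ext i j k l
      simp only [derivShift, mul_add, Finset.sum_add_distrib, mul_ite, mul_zero, Finset.sum_ite_eq',
        Finset.mem_univ, if_true, Pi.add_apply, Pi.smul_apply, basis4, tensor4, smul_eq_mul]
      ring
    rw [e, map_add, map_add, map_add, map_smul] at h
    exact h
  have hsum :
    ∑ i, ∑ j, ∑ k, ∑ l, ((c i j k l + c l j k i) ^ 2 + (c i j k l + c i l k j) ^ 2 +
      (c i j k l + c i j l k) ^ 2) = 0 := by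
    -- By `key`, the sum of the three squares is a sum of differences of squares
    -- which cancel by renaming the indices.
    have e : ∀ i j k l, (c i j k l + c l j k i) ^ 2 + (c i j k l + c i l k j) ^ 2 +
      (c i j k l + c i j l k) ^ 2
       = (c l j k i ^ 2 - c i j k l ^ 2) + (c i l k j ^ 2 - c i j k l ^ 2) +
         (c i j l k ^ 2 - c i j k l ^ 2) := by
      intro i j k l
      linear_combination (2 * c i j k l) * key i j k l
    simp only [e, Finset.sum_add_distrib, Finset.sum_sub_distrib]
    rw [sum4_swap14 (fun i j k l => c i j k l ^ 2), sum4_swap24 (fun i j k l => c i j k l ^ 2),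
      sum4_swap34 (fun i j k l => c i j k l ^ 2)]
    ring
  have nn : ∀ i j k l, 0 ≤ (c i j k l + c l j k i) ^ 2 + (c i j k l + c i l k j) ^ 2 +
    (c i j k l + c i j l k) ^ 2 := fun i j k l => by positivity
  rw [Finset.sum_eq_zero_iff_of_nonneg (fun i _ => Finset.sum_nonneg fun j _ => Finset.sum_nonneg
    fun k _ => Finset.sum_nonneg fun l _ => nn i j k l)] at hsum
  have h1 := hsum i (Finset.mem_univ i)
  rw [Finset.sum_eq_zero_iff_of_nonneg (fun j _ => Finset.sum_nonneg fun k _ => Finset.sum_nonneg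
    fun l _ => nn i j k l)] at h1
  have h2 := h1 j (Finset.mem_univ j)
  rw [Finset.sum_eq_zero_iff_of_nonneg (fun k _ => Finset.sum_nonneg fun l _ => nn i j k l)] at h2
  have h3 := h2 k (Finset.mem_univ k)
  rw [Finset.sum_eq_zero_iff_of_nonneg (fun l _ => nn i j k l)] at h3
  have h4 := h3 l (Finset.mem_univ l)
  have s1 := sq_nonneg (c i j k l + c l j k i)
  have s2 := sq_nonneg (c i j k l + c i l k j)
  have s3 := sq_nonneg (c i j k l + c i j l k)
  have t1 : c i j k l + c l j k i = 0 := pow_eq_zero_iff two_ne_zero |>.1 (by linarith)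
  have t2 : c i j k l + c i l k j = 0 := pow_eq_zero_iff two_ne_zero |>.1 (by linarith)
  have t3 : c i j k l + c i j l k = 0 := pow_eq_zero_iff two_ne_zero |>.1 (by linarith)
  exact ⟨by linarith, by linarith, by linarith⟩

/-- The projection onto the arrays with the symmetries of second derivatives of the metric. -/
def symm4 : Arr4 n →ₗ[ℝ] Arr4 n where
  toFun x := fun i j k l => (x i j k l + x j i k l + x i j l k + x j i l k) / 4
  map_add' x y := by ext i j k l; simp only [Pi.add_apply]; ring
  map_smul' r x := by ext i j k l; simp only [Pi.smul_apply, smul_eq_mul, RingHom.id_apply]; ring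

lemma symm4_apply (x : Arr4 n) (i j k l) :
    symm4 x i j k l = (x i j k l + x j i k l + x i j l k + x j i l k) / 4 := rfl

lemma isSymm4_symm4 (x : Arr4 n) : IsSymm4 (symm4 x) :=
  ⟨fun i j k l => by rw [symm4_apply, symm4_apply]; ring,
    fun i j k l => by rw [symm4_apply, symm4_apply]; ring⟩

lemma symm4_of_isSymm4 {x : Arr4 n} (hx : IsSymm4 x) : symm4 x = x := by
  ext i j k l
  rw [symm4_apply, hx.1 j i k l, hx.2 i j l k, hx.2 j i l k, hx.1 j i k l]; ring

lemma symm4_basis4_swap12 (i j k l : Fin n) : symm4 (basis4 j i k l) = symm4 (basis4 i j k l) := by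
  ext a b c d; simp only [symm4_apply, basis4, tensor4]; ring

lemma symm4_basis4_swap34 (i j k l : Fin n) : symm4 (basis4 i j l k) = symm4 (basis4 i j k l) := by
  ext a b c d; simp only [symm4_apply, basis4, tensor4]; ring

lemma map_symm_eq_sum (f : Arr4 n →ₗ[ℝ] ℝ) {x : Arr4 n} (hx : IsSymm4 x) :
    f x = ∑ i, ∑ j, ∑ k, ∑ l, x i j k l * f (symm4 (basis4 i j k l)) := by
  have := map_eq_sum_basis4 (f ∘ₗ symm4) x
  simpa [symm4_of_isSymm4 hx] using this

/-- The diagonal entries of the Minkowski matrix. -/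
def eps (i : Fin n) : ℝ := if (i : ℕ) = 0 then -1 else 1

lemma eta_apply (i j : Fin n) : eta n i j = if i = j then eps i else 0 := by
  simp [eta, minkowski, Matrix.diagonal_apply, eps]

lemma eps_mul_self (i : Fin n) : eps i * eps i = 1 := by
  unfold eps; split_ifs <;> norm_num

lemma isSymm4_metricQuad {w : Arr2 n} (hw : ∀ i j, w i j = w j i) (S : Arr3 n) :
    IsSymm4 (metricQuad w S) :=
  ⟨fun i j k l => by
    unfold metricQuad
    rw [Finset.sum_comm]
    refine Finset.sum_congr rfl fun a _ => Finset.sum_congr rfl fun b _ => ?_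
    rw [hw]; ring, fun i j k l => by
    unfold metricQuad
    refine Finset.sum_congr rfl fun a _ => Finset.sum_congr rfl fun b _ => ?_
    ring⟩

/-- A functional which vanishes on the shifts by `T` satisfies a cyclic identity. -/
lemma cyclic_of_metricCubic {f : Arr4 n →ₗ[ℝ] ℝ}
    (hf : ∀ T : Arr4 n, (∀ a i j k, T a i j k = T a j i k) → (∀ a i j k, T a i j k = T a i k j) →
      f (metricCubic (eta n) T) = 0) (i j k l : Fin n) :
    f (symm4 (basis4 i j k l)) + f (symm4 (basis4 k j i l)) + f (symm4 (basis4 l j i k)) = 0 := by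
  -- The test array is `T^a = η^{aj} t` with `t` the symmetrization of `e_i ⊗ e_k ⊗ e_l`, so that
  -- lowering the first index gives `e_j ⊗ t`.
  let t : Fin n → Fin n → Fin n → ℝ := fun p r s =>
    stdCovector i p * stdCovector k r * stdCovector l s + stdCovector i p * stdCovector l r *
      stdCovector k s
    + stdCovector k p * stdCovector i r * stdCovector l s + stdCovector k p * stdCovector l r *
      stdCovector i s
    + stdCovector l p * stdCovector i r * stdCovector k s + stdCovector l p * stdCovector k r *
      stdCovector i s
  have ht : ∀ p r s, t p r s = t r p s := fun p r s => by simp only [t]; ring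
  have ht' : ∀ p r s, t p r s = t p s r := fun p r s => by simp only [t]; ring
  have h := hf (fun a p r s => (if a = j then eps j else 0) * t p r s) (fun a p r s => by rw [ht])
    (fun a p r s => by rw [ht'])
  have e : metricCubic (eta n) (fun a p r s => (if a = j then eps j else 0) * t p r s) =
     (4 : ℝ) • symm4 (basis4 i j k l) + (4 : ℝ) • symm4 (basis4 k j i l) +
       (4 : ℝ) • symm4 (basis4 l j i k) := by
    ext p q r s
    have e1 : ∀ q r', ∑ a, eta n a q * ((if a = j then eps j else 0) * r') = stdCovector j q *
      r' := by
      intro q r'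
      simp only [eta_apply, stdCovector, ite_mul, zero_mul, mul_ite, mul_zero, Finset.sum_ite_eq',
        Finset.mem_univ, if_true, one_mul]
      split_ifs with h1 h2 h2
      · rw [← mul_assoc, eps_mul_self, one_mul]
      · exact absurd h1.symm h2
      · exact absurd h2.symm h1
      · rfl
    unfold metricCubic
    simp only [eta_symm p]
    rw [Finset.sum_add_distrib, e1, e1]
    simp only [Pi.add_apply, Pi.smul_apply, smul_eq_mul, symm4_apply, basis4, tensor4, t]
    ring
  rw [e, map_add, map_add, map_smul, map_smul, map_smul] at h
  simp only [smul_eq_mul] at h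
  linarith

/-- The identity satisfied by a functional which vanishes on the shifts quadratic in `S`. -/
lemma exchange_of_metricQuad {f : Arr4 n →ₗ[ℝ] ℝ}
    (hf : ∀ S : Arr3 n, (∀ a i j, S a i j = S a j i) → f (metricQuad (eta n) S) = 0)
      (i j k l : Fin n) :
    f (symm4 (basis4 i j k l)) + f (symm4 (basis4 i l k j)) + f (symm4 (basis4 k j i l)) +
        f (symm4 (basis4 k l i j)) = 0 := by
  -- The test arrays are `S^a = δ^a_i Y` with `Y` a symmetric matrix. They give a quadratic
  -- expression in `Y`, which is polarized at `e_i e_k` and `e_j e_l`.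
  let g : Arr2 n → Arr4 n := fun Y => fun p q r s => Y p r * Y q s + Y p s * Y q r
  have hg : ∀ Y : Arr2 n, (∀ p r, Y p r = Y r p) → f (g Y) = 0 := by
    intro Y hY
    have h := hf (fun a p r => (if a = i then 1 else 0) * Y p r) (fun a p r => by rw [hY])
    have e : metricQuad (eta n) (fun a p r => (if a = i then 1 else 0) * Y p r) = eps i • g Y := by
      ext p q r s
      have e1 :
        ∀ a b, eta n a b * ((if a = i then 1 else 0) * Y p r * ((if b = i then 1 else 0) * Y q s) +
          (if a = i then 1 else 0) * Y p s * ((if b = i then 1 else 0) * Y q r))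
          = if b = i then (if a = i then eps i * (Y p r * Y q s + Y p s * Y q r) else 0) else
            0 := by
        intro a b
        rw [eta_apply]
        by_cases h1 : a = i
        · by_cases h2 : b = i
          · subst h1; simp [h2]
          · simp [h2]
        · simp [h1]
      simp only [metricQuad, e1, Finset.sum_ite_eq', Finset.mem_univ, if_true, Pi.smul_apply,
        smul_eq_mul, g]
    rw [e, map_smul, smul_eq_mul] at h
    exact (mul_eq_zero.1 h).resolve_left (by unfold eps; split_ifs <;> norm_num)
  let Y₁ : Arr2 n := fun p r => stdCovector i p * stdCovector k r + stdCovector k p *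
    stdCovector i r
  let Y₂ : Arr2 n := fun p r => stdCovector j p * stdCovector l r + stdCovector l p *
    stdCovector j r
  have h1 := hg Y₁ (fun p r => by simp only [Y₁]; ring)
  have h2 := hg Y₂ (fun p r => by simp only [Y₂]; ring)
  have h3 := hg (Y₁ + Y₂) (fun p r => by simp only [Y₁, Y₂, Pi.add_apply]; ring)
  have e : g (Y₁ + Y₂) = g Y₁ + g Y₂ + (4 : ℝ) • symm4 (basis4 i j k l) +
    (4 : ℝ) • symm4 (basis4 i l k j) + (4 : ℝ) • symm4 (basis4 k j i l) +
      (4 : ℝ) • symm4 (basis4 k l i j) := by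
    ext p q r s
    simp only [g, Y₁, Y₂, Pi.add_apply, Pi.smul_apply, smul_eq_mul, symm4_apply, basis4, tensor4]
    ring
  rw [e] at h3
  simp only [map_add, map_smul, smul_eq_mul, h1, h2] at h3
  linarith

/-- No nonzero functional of the symmetric arrays vanishes both on the shifts by `T` and on those
quadratic in `S`. -/
lemma map_symm_eq_zero {f : Arr4 n →ₗ[ℝ] ℝ} (hf : ∀ T : Arr4 n, (∀ a i j k, T a i j k = T a j i k) →
    (∀ a i j k, T a i j k = T a i k j) → f (metricCubic (eta n) T) = 0)
    (hf' : ∀ S : Arr3 n, (∀ a i j, S a i j = S a j i) → f (metricQuad (eta n) S) = 0) {x : Arr4 n}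
        (hx : IsSymm4 x) : f x = 0 := by
  rw [map_symm_eq_sum f hx]
  have : ∀ i j k l, f (symm4 (basis4 i j k l)) = 0 := by
    intro i j k l
    -- The exchange relation for `(k, i, j, l)` and two cyclic relations leave `-2` times the goal.
    have h1 := exchange_of_metricQuad hf' k i l j
    have h2 := cyclic_of_metricCubic hf k i l j
    have h3 := cyclic_of_metricCubic hf k j l i
    have s := fun i j k l => congrArg f (symm4_basis4_swap12 (n := n) i j k l)
    have s' := fun i j k l => congrArg f (symm4_basis4_swap34 (n := n) i j k l)
    have a1 := s i j k l
    have a2 := s' i j k l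
    have a3 := s' j i k l
    have a4 := s' l i k j
    have a5 := s' l j k i
    have a6 := s' k i l j
    have a7 := s' k j l i
    linarith
  simp [this]

/-! ### Reflections of Minkowski space -/

/-- The reflection of `(ℝⁿ, η)` in the hyperplane orthogonal to `v`, which has to be non-null: at a
null vector the matrix is `1`, by division by zero. -/
def reflectionMatrix (v : Fin n → ℝ) : Matrix (Fin n) (Fin n) ℝ := fun a p =>
  (if a = p then 1 else 0) - 2 / (∑ b, eps b * v b ^ 2) * (v a * (eps p * v p))

lemma change2_reflectionMatrix {v : Fin n → ℝ} (hv : ∑ b, eps b * v b ^ 2 ≠ 0) :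
    change2 (reflectionMatrix v) (eta n) = eta n := by
  ext p q
  set D := ∑ b, eps b * v b ^ 2 with hD
  have e : change2 (reflectionMatrix v) (eta n) p q =
    ∑ a, ((if a = p then 1 else 0) - 2 / D * (v a * (eps p * v p))) *
      ((if a = q then 1 else 0) - 2 / D * (v a * (eps q * v q))) * eps a := by
    simp only [change2, reflectionMatrix, eta_apply, mul_ite, mul_zero, Finset.sum_ite_eq,
      Finset.mem_univ, if_true, ← hD]
  have e2 : ∀ a, ((if a = p then 1 else 0) - 2 / D * (v a * (eps p * v p))) *
    ((if a = q then 1 else 0) - 2 / D * (v a * (eps q * v q))) * eps a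
    = (if a = p then (if a = q then eps a else 0) else 0) - (if a = p then 2 / D *
      (v a * (eps q * v q)) * eps a else 0) - (if a = q then 2 / D * (v a * (eps p * v p)) *
        eps a else 0)
      + 4 / D ^ 2 * (eps p * v p * (eps q * v q)) * (eps a * v a ^ 2) := by
    intro a
    split_ifs <;> ring
  rw [e]
  simp only [e2, Finset.sum_add_distrib, Finset.sum_sub_distrib, Finset.sum_ite_eq',
    Finset.mem_univ, if_true, ← Finset.mul_sum, ← hD, eta_apply]
  field_simp
  ring

lemma sum4_mul (p q r s : Fin n → ℝ) : ∑ a, ∑ b, ∑ c, ∑ d, p a * q b * r c * s d = (∑ a, p a) *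
    (∑ b, q b) * (∑ c, r c) * (∑ d, s d) := by
  simp only [← Finset.mul_sum, ← Finset.sum_mul]

lemma change4_tensor4 (A : Matrix (Fin n) (Fin n) ℝ) (u v w z : Fin n → ℝ) :
    change4 A (tensor4 u v w z) = tensor4 (Matrix.vecMul u A) (Matrix.vecMul v A)
        (Matrix.vecMul w A) (Matrix.vecMul z A) := by
  ext i j k l
  simp only [change4, tensor4, Matrix.vecMul, dotProduct]
  rw [← sum4_mul]
  exact Finset.sum_congr rfl fun a _ => Finset.sum_congr rfl fun b _ => Finset.sum_congr rfl fun c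
    _ => Finset.sum_congr rfl fun d _ => by ring

lemma vecMul_stdCovector (A : Matrix (Fin n) (Fin n) ℝ) (i : Fin n) :
    Matrix.vecMul (stdCovector i) A = A i := by
  ext p; simp [Matrix.vecMul, dotProduct, stdCovector]

lemma eps_cases (i : Fin n) : eps i = 1 ∨ eps i = -1 := by
  unfold eps; split_ifs <;> simp

/-- The reflection in `e_p`. -/
lemma exists_sign_change (p : Fin n) : ∃ A : Matrix (Fin n) (Fin n) ℝ, change2 A (eta n) = eta n ∧
    ∀ i, Matrix.vecMul (stdCovector i) A = (if i = p then (-1 : ℝ) else 1) • stdCovector i := by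
  have hD : ∑ b, eps b * stdCovector p b ^ 2 = eps p := by simp [stdCovector]
  have hp : eps p ≠ 0 := by rcases eps_cases p with h | h <;> simp [h]
  refine ⟨reflectionMatrix (stdCovector p), change2_reflectionMatrix (by rw [hD]; exact hp),
    fun i => ?_⟩
  rw [vecMul_stdCovector]
  ext q
  simp only [reflectionMatrix, hD, Pi.smul_apply, smul_eq_mul]
  simp only [stdCovector]
  by_cases h1 : i = p
  · subst h1
    by_cases h2 : q = i
    · subst h2; simp only [if_true]; field_simp; norm_num
    · simp [h2, Ne.symm h2]
  · by_cases h2 : q = i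
    · subst h2; simp [h1]
    · simp [h1, h2, Ne.symm h2]

/-- A Lorentz transformation which moves only `e_i` and `e_j` and mixes them: the reflection in
`2 e_i + e_j`. The vector `e_i + e_j` would not do, since it can be null. -/
lemma exists_mixing {i j : Fin n} (hij : i ≠ j) :
    ∃ A : Matrix (Fin n) (Fin n) ℝ, change2 A (eta n) = eta n ∧
    (∀ k, k ≠ i → k ≠ j → Matrix.vecMul (stdCovector k) A = stdCovector k) ∧
    ∃ s t : ℝ, Matrix.vecMul (stdCovector i) A = s • stdCovector i + t • stdCovector j ∧
      t ≠ 0 ∧ s ^ 2 + eps i * eps j * t ^ 2 = 1 := by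
  set v : Fin n → ℝ := (2 : ℝ) • stdCovector i + stdCovector j with hv
  have vi : v i = 2 := by simp [hv, stdCovector, hij]
  have vj : v j = 1 := by simp [hv, stdCovector, hij.symm]
  have vk : ∀ k, k ≠ i → k ≠ j → v k = 0 := fun k h1 h2 => by simp [hv, stdCovector, h1, h2]
  have hD : ∑ b, eps b * v b ^ 2 = 4 * eps i + eps j := by
    have : ∀ b, eps b * v b ^ 2 = (if b = i then 4 * eps i else 0) +
      (if b = j then eps j else 0) := by
      intro b
      by_cases h1 : b = i
      · subst h1; rw [vi, if_pos rfl, if_neg hij]; ring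
      · by_cases h2 : b = j
        · subst h2; rw [vj, if_pos rfl, if_neg h1]; ring
        · rw [vk b h1 h2, if_neg h1, if_neg h2]; ring
    simp only [this, Finset.sum_add_distrib, Finset.sum_ite_eq', Finset.mem_univ, if_true]
  -- `η(v, v)` is one of `±4 ± 1`.
  have hp : 4 * eps i + eps j ≠ 0 := by
    rcases eps_cases i with h | h <;> rcases eps_cases j with h' | h' <;> rw [h, h'] <;> norm_num
  refine ⟨reflectionMatrix v, change2_reflectionMatrix (by rw [hD]; exact hp), fun k h1 h2 => ?_,
    1 - 8 * eps i / (4 * eps i + eps j), - 4 * eps j / (4 * eps i + eps j), ?_, ?_, ?_⟩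
  · rw [vecMul_stdCovector]
    ext q
    simp only [reflectionMatrix, vk k h1 h2, stdCovector, eq_comm (a := k)]
    ring
  · rw [vecMul_stdCovector]
    ext q
    simp only [reflectionMatrix, hD, vi, stdCovector, Pi.add_apply, Pi.smul_apply, smul_eq_mul]
    by_cases h1 : q = i
    · subst h1; rw [vi, if_pos rfl, if_neg hij]; ring
    · by_cases h2 : q = j
      · subst h2; rw [vj, if_neg hij, if_neg h1, if_pos rfl]; ring
      · rw [vk q h1 h2, if_neg h1, if_neg h2, if_neg (Ne.symm h1)]; ring
  · rcases eps_cases j with h' | h' <;> rw [h'] at hp ⊢ <;> exact div_ne_zero (by norm_num) hp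
  · rcases eps_cases i with h | h <;> rcases eps_cases j with h' | h' <;> rw [h, h'] <;> norm_num

/-- If a transformation as in `exists_mixing` preserves a diagonal quantity with values `x` at `e_i`
and `y` at `e_j`, without a mixed term, then these values agree up to the signs `ε`. -/
lemma eq_of_mixing {s t x y : ℝ} {i j : Fin n} (ht : t ≠ 0)
    (hst : s ^ 2 + eps i * eps j * t ^ 2 = 1) (h : s ^ 2 * x + t ^ 2 * y = x) :
    eps j * y = eps i * x := by
  have h2 : t ^ 2 * (y - eps i * eps j * x) = 0 := by linear_combination h - x * hst
  have h3 := (mul_eq_zero.1 h2).resolve_left (pow_ne_zero 2 ht)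
  linear_combination eps j * h3 + eps i * x * eps_mul_self j

lemma tensor4_smul₁ (r : ℝ) (u v w z : Fin n → ℝ) :
    tensor4 (r • u) v w z = r • tensor4 u v w z := by
  ext i j k l; simp only [tensor4, Pi.smul_apply, smul_eq_mul]; ring

lemma tensor4_smul₂ (r : ℝ) (u v w z : Fin n → ℝ) :
    tensor4 u (r • v) w z = r • tensor4 u v w z := by
  ext i j k l; simp only [tensor4, Pi.smul_apply, smul_eq_mul]; ring

lemma tensor4_smul₃ (r : ℝ) (u v w z : Fin n → ℝ) :
    tensor4 u v (r • w) z = r • tensor4 u v w z := by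
  ext i j k l; simp only [tensor4, Pi.smul_apply, smul_eq_mul]; ring

lemma tensor4_smul₄ (r : ℝ) (u v w z : Fin n → ℝ) :
    tensor4 u v w (r • z) = r • tensor4 u v w z := by
  ext i j k l; simp only [tensor4, Pi.smul_apply, smul_eq_mul]; ring

lemma tensor4_add₁ (u u' v w z : Fin n → ℝ) :
    tensor4 (u + u') v w z = tensor4 u v w z + tensor4 u' v w z := by
  ext i j k l; simp only [tensor4, Pi.add_apply]; ring

lemma tensor4_add₂ (u v v' w z : Fin n → ℝ) :
    tensor4 u (v + v') w z = tensor4 u v w z + tensor4 u v' w z := by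
  ext i j k l; simp only [tensor4, Pi.add_apply]; ring

/-- The factor by which the reflection in `e_p` multiplies `e_i`. -/
def flipSign (p i : Fin n) : ℝ := if i = p then -1 else 1

lemma flipSign_cases (p i : Fin n) : flipSign p i = 1 ∨ flipSign p i = -1 := by
  unfold flipSign; split_ifs <;> simp

lemma exists_flipSign (p : Fin n) : ∃ A : Matrix (Fin n) (Fin n) ℝ, change2 A (eta n) = eta n ∧
    ∀ i j k l, change4 A (basis4 i j k l) =
        (flipSign p i * flipSign p j * flipSign p k * flipSign p l) • basis4 i j
        k l := by
  obtain ⟨A, hA, h⟩ := exists_sign_change p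
  refine ⟨A, hA, fun i j k l => ?_⟩
  rw [basis4, change4_tensor4, h, h, h, h, tensor4_smul₁, tensor4_smul₂, tensor4_smul₃,
    tensor4_smul₄]
  simp only [smul_smul, flipSign, mul_assoc]

section ScalarInvariants

variable {f : Arr4 n →ₗ[ℝ] ℝ}

/-- A coefficient of an invariant functional vanishes unless each index occurs an even number of
times. -/
lemma coeff_eq_flipSign (hf : ∀ A : Matrix (Fin n) (Fin n) ℝ, change2 A (eta n) = eta n →
    ∀ x, f (change4 A x) = f x) (p i j k l : Fin n) :
    f (basis4 i j k l) = flipSign p i * flipSign p j * flipSign p k * flipSign p l *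
        f (basis4 i j k l) := by
  obtain ⟨A, hA, h⟩ := exists_flipSign p
  conv_lhs => rw [← hf A hA, h, map_smul, smul_eq_mul]

/-! ### Invariant functionals of the second derivatives of the metric -/

/-- The contraction `g^{ij} g^{kr} (x_{jrik} - x_{ijkr})`. On the second derivatives of a metric
with vanishing first derivatives it is the scalar curvature. -/
def curvatureTrace (w : Arr2 n) (x : Arr4 n) : ℝ :=
  ∑ i, ∑ j, ∑ k, ∑ r, inv w i j * inv w k r * (x j r i k - x i j k r)

lemma inv_eta (i j : Fin n) : inv (eta n) i j = eta n i j := by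
  have : (Matrix.of (eta n))⁻¹ = Matrix.of (eta n) := by
    apply Matrix.inv_eq_left_inv
    ext i j
    simp only [Matrix.mul_apply, Matrix.of_apply, eta_apply, Matrix.one_apply, ite_mul, zero_mul,
      mul_ite, mul_zero]
    by_cases h : i = j
    · subst h; simp [eps_mul_self]
    · simp [h]
  exact congrFun (congrFun this i) j

lemma curvatureTrace_eta (x : Arr4 n) :
    curvatureTrace (eta n) x = ∑ i, ∑ k, eps i * eps k * (x i k i k - x i i k k) := by
  simp [curvatureTrace, inv_eta, eta_apply]

/-- The Lorentz invariant functionals of symmetric arrays which satisfy the cyclic identity are the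
multiples of the scalar curvature. -/
lemma exists_eq_curvatureTrace (hs : ∀ x, f (symm4 x) = f x)
    (hf : ∀ A : Matrix (Fin n) (Fin n) ℝ, change2 A (eta n) = eta n → ∀ x, f (change4 A x) = f x)
    (hc : ∀ i j k l, f (basis4 i j k l) + f (basis4 k j i l) + f (basis4 l j i k) = 0) :
    ∃ b : ℝ, ∀ x, IsSymm4 x → f x = b * curvatureTrace (eta n) x := by
  have s12 : ∀ i j k l, f (basis4 j i k l) = f (basis4 i j k l) := fun i j k l => by
    rw [← hs, symm4_basis4_swap12, hs]
  have s34 : ∀ i j k l, f (basis4 i j l k) = f (basis4 i j k l) := fun i j k l => by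
    rw [← hs, symm4_basis4_swap34, hs]
  have hflip := coeff_eq_flipSign hf
  -- By the cyclic identity the coefficients at `(i, k, i, k)` determine those at `(i, i, k, k)`.
  have hdiag : ∀ i k, f (basis4 i i k k) = - 2 * f (basis4 i k i k) := by
    intro i k
    have := hc i i k k
    rw [s12 i k] at this
    linarith
  have hdiag' : ∀ i, f (basis4 i i i i) = 0 := by
    intro i; have := hdiag i i; linarith
  -- Up to signs, the coefficient at `(i, i, k, k)` is the same for all `i ≠ k`: mix `e_i` with
  -- `e_j`, and note that the coefficient at `(i, j, k, k)` vanishes by a sign change.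
  set v : Fin n → Fin n → ℝ := fun i k => eps i * eps k * f (basis4 i i k k) with hvdef
  have vsymm : ∀ i k, v i k = v k i := by
    intro i k
    simp only [hvdef]
    rw [hdiag, hdiag k i, s12, s34]; ring
  have vchange : ∀ i j k, i ≠ k → j ≠ k → v i k = v j k := by
    intro i j k hi hj
    by_cases hij : i = j
    · rw [hij]
    obtain ⟨A, hA, hk, s, t, hit, ht, hst⟩ := exists_mixing hij
    have h := hf A hA (basis4 i i k k)
    have z1 : f (basis4 i j k k) = 0 := by
      have := hflip i i j k k
      simp only [flipSign, if_true, if_neg (Ne.symm hij), if_neg (Ne.symm hi)] at this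
      linarith
    rw [basis4, change4_tensor4, hit, hk k (Ne.symm hi) (Ne.symm hj)] at h
    simp only [tensor4_add₁, tensor4_add₂, tensor4_smul₁, tensor4_smul₂, map_add, map_smul,
      smul_eq_mul] at h
    change s * (s * f (basis4 i i k k) + t * f (basis4 j i k k)) + t *
      (s * f (basis4 i j k k) + t * f (basis4 j j k k)) = f (basis4 i i k k) at h
    rw [s12 i j, z1] at h
    have := eq_of_mixing (i := i) (j := j) (x := f (basis4 i i k k)) (y := f (basis4 j j k k)) ht
      hst (by linarith)
    simp only [hvdef]
    linear_combination (- eps k) * this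
  have vconst : ∀ i k j l, i ≠ k → j ≠ l → v i k = v j l := by
    intro i k j l h1 h2
    by_cases h3 : j = k
    · by_cases h4 : l = i
      · rw [h3, h4, vsymm]
      · rw [vsymm i k, vchange k l i (Ne.symm h1) h4, vsymm l i, vchange i j l (Ne.symm h4) h2]
    · rw [vchange i j k h1 h3, vsymm j k, vchange k l j (Ne.symm h3) (Ne.symm h2), vsymm]
  obtain ⟨v₀, hv₀⟩ : ∃ v₀, ∀ i k, i ≠ k → v i k = v₀ := by
    -- The constant is arbitrary if `n ≤ 1`.
    by_cases h : ∃ i k : Fin n, i ≠ k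
    · obtain ⟨i, k, h⟩ := h
      exact ⟨v i k, fun j l h' => vconst j l i k h' h⟩
    · push Not at h
      exact ⟨0, fun i k h' => absurd (h i k) h'⟩
  -- All coefficients: those with an index occurring an odd number of times vanish, and those with
  -- all indices equal vanish by the cyclic identity.
  have coeff : ∀ i j k l, f (basis4 i j k l) = v₀ *
    ((if j = i then if l = k then eps i * eps k else 0 else 0)
      - (1 / 2) * ((if k = i then if l = j then eps i * eps j else 0 else 0) +
        (if l = i then if k = j then eps i * eps j else 0 else 0))) := by
    have hv : ∀ i k, i ≠ k → f (basis4 i i k k) = v₀ * (eps i * eps k) := by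
      intro i k h
      rw [← hv₀ i k h]
      simp only [hvdef]
      linear_combination (- f (basis4 i i k k) * eps k * eps k) *
        eps_mul_self i - f (basis4 i i k k) * eps_mul_self k
    intro i j k l
    by_cases h1 : j = i
    · subst h1
      by_cases h2 : l = k
      · subst h2
        by_cases h3 : l = j
        · subst h3; simp [hdiag']; right; ring
        · rw [hv _ _ (Ne.symm h3)]; simp [h3]
      · have := hflip k j j k l
        have e : flipSign k l = 1 := by simp [flipSign, h2]
        have e' : flipSign k k = -1 := by simp [flipSign]
        rw [e, e'] at this
        have e2 : flipSign k j * flipSign k j = 1 := by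
          rcases flipSign_cases k j with h | h <;> rw [h] <;> norm_num
        rw [e2] at this
        rw [show f (basis4 j j k l) = 0 by linarith]
        by_cases h3 : k = j
        · subst h3; simp [h2]
        · simp [h2, h3]
    · by_cases h2 : k = i
      · subst h2
        by_cases h3 : l = j
        · subst h3
          have := hdiag k l
          rw [hv _ _ (Ne.symm h1)] at this
          simp [h1]
          linarith
        · have := hflip j k j k l
          have e : flipSign j l = 1 := by simp [flipSign, h3]
          have e' : flipSign j j = -1 := by simp [flipSign]
          have e2 : flipSign j k = 1 := by simp [flipSign, Ne.symm h1]
          rw [e, e', e2] at this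
          rw [show f (basis4 k j k l) = 0 by linarith]
          simp [h1, h3, Ne.symm h1]
      · by_cases h3 : l = i
        · subst h3
          by_cases h4 : k = j
          · subst h4
            have := hdiag l k
            rw [hv _ _ (Ne.symm h1)] at this
            rw [s34]
            simp [h1]
            linarith
          · have := hflip j l j k l
            have e : flipSign j l = 1 := by simp [flipSign, Ne.symm h1]
            have e' : flipSign j j = -1 := by simp [flipSign]
            have e2 : flipSign j k = 1 := by simp [flipSign, h4]
            rw [e, e', e2] at this
            rw [show f (basis4 l j k l) = 0 by linarith]
            simp [h1, h4, h2]
        · have := hflip i i j k l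
          simp only [flipSign, if_true, if_neg h1, if_neg h2, if_neg h3] at this
          rw [show f (basis4 i j k l) = 0 by linarith]
          simp [h1, h2, h3]
  refine ⟨- v₀, fun x hx => ?_⟩
  have key : ∀ x : Arr4 n, f x = v₀ *
    (∑ i, ∑ k, eps i * eps k * (x i i k k - (1 / 2) * (x i k i k + x i k k i))) := by
    intro x
    rw [map_eq_sum_basis4 f x]
    simp only [coeff, Finset.mul_sum]
    have e : ∀ i j k l, x i j k l * (v₀ * ((if j = i then if l = k then eps i * eps k else 0 else 0)
      - (1 / 2) * ((if k = i then if l = j then eps i * eps j else 0 else 0) +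
        (if l = i then if k = j then eps i * eps j else 0 else 0))))
      = (if l = k then if j = i then v₀ * (eps i * eps k * x i j k l) else 0 else 0)
        - ((if l = j then if k = i then v₀ * (eps i * eps j * x i j k l) / 2 else 0 else 0) +
          (if l = i then if k = j then v₀ * (eps i * eps j * x i j k l) / 2 else 0 else 0)) := by
      intro i j k l
      split_ifs <;> ring
    simp only [e, Finset.sum_add_distrib, Finset.sum_sub_distrib, Finset.sum_ite_eq',
      Finset.mem_univ, if_true]
    have e1 :
      ∑ i : Fin n, ∑ j : Fin n, ∑ k, (if j = i then v₀ * (eps i * eps k * x i j k k) else 0) =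
        ∑ i, ∑ k, v₀ * (eps i * eps k * x i i k k) := by
      refine Finset.sum_congr rfl fun i _ => ?_
      rw [Finset.sum_comm]
      simp
    rw [e1]
    simp only [← Finset.sum_add_distrib, ← Finset.sum_sub_distrib]
    refine Finset.sum_congr rfl fun i _ => Finset.sum_congr rfl fun j _ => ?_
    ring
  rw [key, curvatureTrace_eta, Finset.mul_sum, Finset.mul_sum]
  refine Finset.sum_congr rfl fun i _ => ?_
  rw [Finset.mul_sum, Finset.mul_sum]
  refine Finset.sum_congr rfl fun j _ => ?_
  rw [hx.2 i j j i]
  ring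

end ScalarInvariants

/-! ### Invariant forms on 4-forms -/

/-- The exterior derivative of the antisymmetric part of `D`, in terms of the array
`y_{ijkl} = D_{ijk,l}`. -/
def extDerivArr (y : Arr4 n) : Arr4 n := fun i j k l =>
  antisymmPart (fun a b c => y a b c i) j k l - antisymmPart (fun a b c => y a b c j) i k l
    + antisymmPart (fun a b c => y a b c k) i j l - antisymmPart (fun a b c => y a b c l) i j k

/-- The exterior derivative is a tensor. -/
lemma extDerivArr_derivShift (d : Arr3 n) {S : Arr3 n} (hS : ∀ a i j, S a i j = S a j i) :
    extDerivArr (derivShift d S) = 0 := by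
  ext i j k l
  simp only [extDerivArr, antisymmPart, derivShift, ← Finset.sum_add_distrib,
    ← Finset.sum_sub_distrib, Finset.sum_div, Pi.zero_apply]
  refine Finset.sum_eq_zero fun a _ => ?_
  rw [hS a j i, hS a k i, hS a l i, hS a k j, hS a l j, hS a l k]
  ring

/-- Exchange of the first two indices. -/
def swap12 : Arr4 n →ₗ[ℝ] Arr4 n where
  toFun x := fun i j k l => x j i k l
  map_add' _ _ := rfl
  map_smul' _ _ := rfl

/-- Exchange of the middle indices. -/
def swap23 : Arr4 n →ₗ[ℝ] Arr4 n where
  toFun x := fun i j k l => x i k j l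
  map_add' _ _ := rfl
  map_smul' _ _ := rfl

/-- Exchange of the last two indices. -/
def swap34 : Arr4 n →ₗ[ℝ] Arr4 n where
  toFun x := fun i j k l => x i j l k
  map_add' _ _ := rfl
  map_smul' _ _ := rfl

/-- The functional changes sign under each transposition of neighbouring indices. -/
def IsAlternating4 (f : Arr4 n →ₗ[ℝ] ℝ) : Prop :=
  (∀ x, f (swap12 x) = - f x) ∧ (∀ x, f (swap23 x) = - f x) ∧ ∀ x, f (swap34 x) = - f x

lemma isAlternating4_of_coeff {f : Arr4 n →ₗ[ℝ] ℝ}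
    (h : ∀ i j k l, f (basis4 l j k i) = - f (basis4 i j k l) ∧ f (basis4 i l k j) = - f
      (basis4 i j k l) ∧ f (basis4 i j l k) = - f (basis4 i j k l)) :
    IsAlternating4 f := by
  have h12 : ∀ i j k l, f (basis4 j i k l) = - f (basis4 i j k l) := fun i j k l => by
    have h1 := (h i j k l).1
    have h2 := (h l j k i).2.1
    have h3 := (h l i k j).1
    linarith
  have h23 : ∀ i j k l, f (basis4 i k j l) = - f (basis4 i j k l) := fun i j k l => by
    have h1 := (h i j k l).2.1
    have h2 := (h i l k j).2.2
    have h3 := (h i l j k).2.1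
    linarith
  refine ⟨fun x => ?_, fun x => ?_, fun x => ?_⟩
  · rw [map_eq_sum_basis4 f, map_eq_sum_basis4 f x, ← sum4_swap12]
    simp only [← Finset.sum_neg_distrib]
    exact Finset.sum_congr rfl fun i _ => Finset.sum_congr rfl fun j _ => Finset.sum_congr rfl fun k
      _ => Finset.sum_congr rfl fun l _ => by
      rw [h12 i j k l]; simp [swap12]
  · rw [map_eq_sum_basis4 f, map_eq_sum_basis4 f x, ← sum4_swap23]
    simp only [← Finset.sum_neg_distrib]
    exact Finset.sum_congr rfl fun i _ => Finset.sum_congr rfl fun j _ => Finset.sum_congr rfl fun k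
      _ => Finset.sum_congr rfl fun l _ => by
      rw [h23 i j k l]; simp [swap23]
  · rw [map_eq_sum_basis4 f, map_eq_sum_basis4 f x, ← sum4_swap34]
    simp only [← Finset.sum_neg_distrib]
    exact Finset.sum_congr rfl fun i _ => Finset.sum_congr rfl fun j _ => Finset.sum_congr rfl fun k
      _ => Finset.sum_congr rfl fun l _ => by
      rw [(h i j k l).2.2]; simp [swap34]

/-- `extDerivArr` through signed permutations, which is how an alternating functional acts on it. -/
lemma extDerivArr_eq (y : Arr4 n) : let z :=
    (1 / 6 : ℝ) • (y + swap12 (swap23 y) + swap23 (swap12 y) - swap12 y - swap23 y - swap12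
      (swap23 (swap12 y)))
    extDerivArr y = swap12 (swap23 (swap34 z)) - swap23 (swap34 z) + swap34 z - z := by
  ext i j k l
  simp only [extDerivArr, antisymmPart, swap12, swap23, swap34, LinearMap.coe_mk, AddHom.coe_mk,
    Pi.add_apply, Pi.sub_apply, Pi.smul_apply, smul_eq_mul]
  ring

lemma IsAlternating4.map_extDerivArr {f : Arr4 n →ₗ[ℝ] ℝ} (hf : IsAlternating4 f) (y : Arr4 n) :
    f (extDerivArr y) = - 4 * f y := by
  obtain ⟨h1, h2, h3⟩ := hf
  rw [extDerivArr_eq]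
  simp only [map_sub, map_add, map_smul, h1, h2, h3, smul_eq_mul]
  ring

lemma extDerivArr_swap12 (y : Arr4 n) (i j k l : Fin n) :
    extDerivArr y j i k l = - extDerivArr y i j k l := by
  simp only [extDerivArr, antisymmPart]; ring

lemma extDerivArr_swap23 (y : Arr4 n) (i j k l : Fin n) :
    extDerivArr y i k j l = - extDerivArr y i j k l := by
  simp only [extDerivArr, antisymmPart]; ring

lemma extDerivArr_swap34 (y : Arr4 n) (i j k l : Fin n) :
    extDerivArr y i j l k = - extDerivArr y i j k l := by
  simp only [extDerivArr, antisymmPart]; ring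

lemma IsAlternating4.swap12 {f : Arr4 n →ₗ[ℝ] ℝ} (hf : IsAlternating4 f) (i j k l : Fin n) :
    f (basis4 j i k l) = - f (basis4 i j k l) := by
  rw [← hf.1]; congr 1; ext a b c d
  simp only [BrayLagrangian.swap12, LinearMap.coe_mk, AddHom.coe_mk, basis4, tensor4]; ring

lemma IsAlternating4.swap23 {f : Arr4 n →ₗ[ℝ] ℝ} (hf : IsAlternating4 f) (i j k l : Fin n) :
    f (basis4 i k j l) = - f (basis4 i j k l) := by
  rw [← hf.2.1]; congr 1; ext a b c d
  simp only [BrayLagrangian.swap23, LinearMap.coe_mk, AddHom.coe_mk, basis4, tensor4]; ring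

lemma IsAlternating4.swap34 {f : Arr4 n →ₗ[ℝ] ℝ} (hf : IsAlternating4 f) (i j k l : Fin n) :
    f (basis4 i j l k) = - f (basis4 i j k l) := by
  rw [← hf.2.2]; congr 1; ext a b c d
  simp only [BrayLagrangian.swap34, LinearMap.coe_mk, AddHom.coe_mk, basis4, tensor4]; ring

/-- The function changes sign under each transposition of neighbouring arguments. -/
def AltFun (F : Fin n → Fin n → Fin n → Fin n → ℝ) : Prop :=
  (∀ i j k l, F j i k l = - F i j k l) ∧ (∀ i j k l, F i k j l = - F i j k l) ∧ ∀ i j k l,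
    F i j l k = - F i j k l

/-- The four indices are pairwise different. -/
def Distinct4 (i j k l : Fin n) : Prop := i ≠ j ∧ i ≠ k ∧ i ≠ l ∧ j ≠ k ∧ j ≠ l ∧ k ≠ l

lemma AltFun.eq_zero {F : Fin n → Fin n → Fin n → Fin n → ℝ} (hF : AltFun F) {i j k l : Fin n}
    (h : ¬ Distinct4 i j k l) : F i j k l = 0 := by
  obtain ⟨h1, h2, h3⟩ := hF
  unfold Distinct4 at h
  have a1 := h1 i j k l
  have a2 := h2 i j k l
  have a3 := h3 i j k l
  have b1 := h1 j i k l
  have b2 := h2 j i k l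
  have c1 := h3 i k j l
  have c2 := h1 i k j l
  have c3 := h2 i j l k
  have c4 := h1 i l j k
  have d1 := h2 i k l j
  grind

/-- The sum of a product of alternating functions, one of which is supported on the permutations of
`(i, j, k, l)`, consists of `24` equal terms. -/
lemma sum_alt_mul {Z Q : Fin n → Fin n → Fin n → Fin n → ℝ} (hZ : AltFun Z) (hQ : AltFun Q)
    {i j k l : Fin n} (hI : Distinct4 i j k l)
    (h0 : ∀ a b c d, Distinct4 a b c d → (a ≠ i ∧ b ≠ i ∧ c ≠ i ∧ d ≠ i) ∨
        (a ≠ j ∧ b ≠ j ∧ c ≠ j ∧ d ≠ j) ∨ (a ≠ k ∧ b ≠ k ∧ c ≠ k ∧ d ≠ k) ∨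
          (a ≠ l ∧ b ≠ l ∧ c ≠ l ∧ d ≠ l) → Q a b c d = 0) :
    ∑ a, ∑ b, ∑ c, ∑ d, Z a b c d * Q a b c d = 24 * (Z i j k l * Q i j k l) := by
  set F : Fin n → Fin n → Fin n → Fin n → ℝ := fun a b c d => Z a b c d * Q a b c d with hF
  have F12 : ∀ a b c d, F b a c d = F a b c d := fun a b c d => by
    simp only [hF, hZ.1 a, hQ.1 a]; ring
  have F23 : ∀ a b c d, F a c b d = F a b c d := fun a b c d => by
    simp only [hF, hZ.2.1 a b, hQ.2.1 a b]; ring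
  have F34 : ∀ a b c d, F a b d c = F a b c d := fun a b c d => by
    simp only [hF, hZ.2.2 a b c, hQ.2.2 a b c]; ring
  have Fz : ∀ a b c d, ¬ Distinct4 a b c d → F a b c d = 0 := fun a b c d h => by
    simp only [hF, hZ.eq_zero h, zero_mul]
  have Fz' :
    ∀ a b c d, ¬ ((i = a ∨ i = b ∨ i = c ∨ i = d) ∧ (j = a ∨ j = b ∨ j = c ∨ j = d) ∧
      (k = a ∨ k = b ∨ k = c ∨ k = d) ∧ (l = a ∨ l = b ∨ l = c ∨ l = d)) → F a b c d = 0 := by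
    intro a b c d h
    by_cases hd : Distinct4 a b c d
    · simp only [hF, h0 a b c d hd (by grind), mul_zero]
    · exact Fz _ _ _ _ hd
  -- A nonzero term has its indices in some order of `i, j, k, l`. There are four positions for
  -- `i`, then three for `j`, then two for `k`.
  have e : ∀ a b c d, F a b c d = (if a = i then F a b c d else 0) +
    (if b = i then F a b c d else 0) + (if c = i then F a b c d else 0) +
      (if d = i then F a b c d else 0) := by
    intro a b c d
    have := Fz a b c d
    have := Fz' a b c d
    unfold Distinct4 at *
    grind
  have s1 : ∑ a, ∑ b, ∑ c, ∑ d, F a b c d = 4 * ∑ b, ∑ c, ∑ d, F i b c d := by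
    have t1 : ∑ a, ∑ b, ∑ c, ∑ d, (if a = i then F a b c d else 0) = ∑ b, ∑ c, ∑ d, F i b c d := by
      rw [Finset.sum_eq_single i]
      · simp
      · intro a _ ha; simp [ha]
      · simp
    have t2 : ∑ a, ∑ b, ∑ c, ∑ d, (if b = i then F a b c d else 0) = ∑ b, ∑ c, ∑ d, F i b c d := by
      rw [← t1, ← sum4_swap12]; simp only [F12]
    have t3 : ∑ a, ∑ b, ∑ c, ∑ d, (if c = i then F a b c d else 0) = ∑ b, ∑ c, ∑ d, F i b c d := by
      rw [← t2, ← sum4_swap23]; simp only [F23]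
    have t4 : ∑ a, ∑ b, ∑ c, ∑ d, (if d = i then F a b c d else 0) = ∑ b, ∑ c, ∑ d, F i b c d := by
      rw [← t3, ← sum4_swap34]; simp only [F34]
    calc _ = _ := Finset.sum_congr rfl fun a _ => Finset.sum_congr rfl fun b _ =>
      Finset.sum_congr rfl fun c _ => Finset.sum_congr rfl fun d _ => e a b c d
      _ = _ := by
        simp only [Finset.sum_add_distrib, t1, t2, t3, t4]
        ring
  have s2 : ∑ b, ∑ c, ∑ d, F i b c d = 3 * ∑ c, ∑ d, F i j c d := by
    have e : ∀ b c d, F i b c d = (if b = j then F i b c d else 0) +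
      (if c = j then F i b c d else 0) + (if d = j then F i b c d else 0) := by
      intro b c d
      have := Fz i b c d
      have := Fz' i b c d
      unfold Distinct4 at *
      grind
    have t1 : ∑ b, ∑ c, ∑ d, (if b = j then F i b c d else 0) = ∑ c, ∑ d, F i j c d := by
      rw [Finset.sum_eq_single j]
      · simp
      · intro a _ ha; simp [ha]
      · simp
    have t2 : ∑ b, ∑ c, ∑ d, (if c = j then F i b c d else 0) = ∑ c, ∑ d, F i j c d := by
      rw [← t1, Finset.sum_comm]; simp only [F23]
    have t3 : ∑ b, ∑ c, ∑ d, (if d = j then F i b c d else 0) = ∑ c, ∑ d, F i j c d := by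
      rw [← t2]; refine Finset.sum_congr rfl fun b _ => ?_
      rw [Finset.sum_comm]; simp only [F34]
    calc _ = _ := Finset.sum_congr rfl fun b _ => Finset.sum_congr rfl fun c _ =>
      Finset.sum_congr rfl fun d _ => e b c d
      _ = _ := by
        simp only [Finset.sum_add_distrib, t1, t2, t3]
        ring
  have s3 : ∑ c, ∑ d, F i j c d = 2 * F i j k l := by
    have e : ∀ c d, F i j c d = (if d = l then if c = k then F i j c d else 0 else 0) +
      (if d = k then if c = l then F i j c d else 0 else 0) := by
      intro c d
      have := Fz i j c d
      have := Fz' i j c d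
      unfold Distinct4 at *
      grind
    calc _ = _ := Finset.sum_congr rfl fun c _ => Finset.sum_congr rfl fun d _ => e c d
      _ = _ := by
        simp only [Finset.sum_add_distrib, Finset.sum_ite_eq', Finset.mem_univ, if_true,
          F34 i j k l]
        ring
  rw [s1, s2, s3]; ring

/-- A symmetric function of four indices which does not change when one index is replaced, all
indices being distinct, is constant on quadruples of distinct indices. -/
lemma eq_of_exchange {v : Fin n → Fin n → Fin n → Fin n → ℝ}
    (h12 : ∀ i j k l, v j i k l = v i j k l) (h23 : ∀ i j k l, v i k j l = v i j k l)
    (h34 : ∀ i j k l, v i j l k = v i j k l)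
        (h : ∀ i j k l m, Distinct4 i k l m → Distinct4 j k l m → v i k l m = v j k l m)
    {i j k l a b c d : Fin n} (hI : Distinct4 i j k l) (hJ : Distinct4 a b c d) :
        v i j k l = v a b c d := by
  -- Replace the indices `i, j, k, l` by `a, b, c, d` one at a time, up to order.
  obtain ⟨b₁, c₁, d₁, hD₁, e₁⟩ : ∃ b₁ c₁ d₁, Distinct4 a b₁ c₁ d₁ ∧ v i j k l = v a b₁ c₁ d₁ := by
    unfold Distinct4 at *
    by_cases h1 : a = j
    · exact ⟨i, k, l, by grind, by rw [h1, h12]⟩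
    by_cases h2 : a = k
    · exact ⟨i, j, l, by grind, by rw [h2, h12 i k, h23 i j]⟩
    by_cases h3 : a = l
    · exact ⟨i, j, k, by grind, by rw [h3, h12 i l, h23 i j, h34 i j]⟩
    exact ⟨j, k, l, by grind, h _ _ _ _ _ hI (by grind)⟩
  obtain ⟨c₂, d₂, hD₂, e₂⟩ : ∃ c₂ d₂, Distinct4 a b c₂ d₂ ∧ v a b₁ c₁ d₁ = v a b c₂ d₂ := by
    unfold Distinct4 at *
    by_cases h2 : b = c₁
    · exact ⟨b₁, d₁, by grind, by rw [h2, h23]⟩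
    by_cases h3 : b = d₁
    · exact ⟨b₁, c₁, by grind, by rw [h3, h23 a b₁, h34 a b₁]⟩
    exact ⟨c₁, d₁, by grind, by rw [h12 b₁, h12 b]; exact h _ _ _ _ _ (by grind) (by grind)⟩
  obtain ⟨d₃, hD₃, e₃⟩ : ∃ d₃, Distinct4 a b c d₃ ∧ v a b c₂ d₂ = v a b c d₃ := by
    unfold Distinct4 at *
    by_cases h3 : c = d₂
    · exact ⟨c₂, by grind, by rw [h3, h34]⟩
    refine ⟨d₂, by grind, ?_⟩
    rw [← h23 a b, ← h12 a c₂, ← h23 a b, ← h12 a c]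
    exact h _ _ _ _ _ (by grind) (by grind)
  rw [e₁, e₂, e₃, ← h34, ← h34 a b c d, ← h23 a b, ← h12 a, ← h23 a b, ← h12 a d]
  unfold Distinct4 at *
  exact h _ _ _ _ _ (by grind) (by grind)

lemma normSq4_eta (T : Arr4 n) :
    normSq4 (eta n) T = ∑ i, ∑ j, ∑ k, ∑ l, eps i * eps j * eps k * eps l * T i j k l ^ 2 := by
  simp only [normSq4, inv_eta, eta_apply]
  refine Finset.sum_congr rfl fun i _ => Finset.sum_congr rfl fun j _ => Finset.sum_congr rfl fun k
    _ => Finset.sum_congr rfl fun l _ => ?_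
  have e : ∀ a b c d, (if i = a then eps i else 0) * (if j = b then eps j else 0) *
    (if k = c then eps k else 0) * (if l = d then eps l else 0) * T i j k l * T a b c d
     = if d =
       l then (if c =
         k then (if b = j then (if a = i then eps i * eps j * eps k * eps l * T i j k l ^ 2 else 0)
           else 0) else 0) else 0 := by
    intro a b c d
    by_cases h1 : i = a
    · subst h1
      by_cases h2 : j = b
      · subst h2
        by_cases h3 : k = c
        · subst h3
          by_cases h4 : l = d
          · subst h4; simp; ring
          · simp [h4, Ne.symm h4]
        · simp [h3, Ne.symm h3]
      · simp [h2, Ne.symm h2]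
    · simp [h1, Ne.symm h1]
  simp only [e, Finset.sum_ite_eq', Finset.mem_univ, if_true]

/-- The Lorentz invariant quadratic forms on 4-forms are the multiples of the norm. -/
lemma exists_eq_normSq4 {q : Arr4 n →ₗ[ℝ] Arr4 n →ₗ[ℝ] ℝ} (hsymm : ∀ x y, q x y = q y x)
    (halt : ∀ x, IsAlternating4 (q x))
    (hinv : ∀ A : Matrix (Fin n) (Fin n) ℝ, change2 A (eta n) = eta n → ∀ x y, q (change4 A x)
        (change4 A y) = q x y) :
    ∃ c : ℝ, ∀ y, q y y = c * normSq4 (eta n) (extDerivArr y) := by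
  have hflip : ∀ p i j k l a b c d, q (basis4 i j k l) (basis4 a b c d) = flipSign p i *
    flipSign p j *
    flipSign p k * flipSign p l *
      (flipSign p a * flipSign p b * flipSign p c * flipSign p d * q (basis4 i j k l)
        (basis4 a b c d)) := by
    intro p i j k l a b c d
    obtain ⟨A, hA, h⟩ := exists_flipSign p
    conv_lhs => rw [← hinv A hA, h, h, map_smul, map_smul, LinearMap.smul_apply, smul_eq_mul,
      smul_eq_mul]
    ring
  -- A coefficient vanishes if some index occurs an odd number of times in the first quadruple
  -- and not in the second. So only the coefficients at two orderings of one quadruple survive.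
  have hzero : ∀ p i j k l a b c d, flipSign p i * flipSign p j * flipSign p k * flipSign p l = -1 →
    a ≠ p → b ≠ p →
    c ≠ p → d ≠ p → q (basis4 i j k l) (basis4 a b c d) = 0 := by
    intro p i j k l a b c d h ha hb hc hd
    have := hflip p i j k l a b c d
    rw [h] at this
    simp only [flipSign, if_neg ha, if_neg hb, if_neg hc, if_neg hd] at this
    linarith
  have hself : ∀ p : Fin n, flipSign p p = -1 := fun p => by simp [flipSign]
  have hne : ∀ p i : Fin n, i ≠ p → flipSign p i = 1 := fun p i h => by simp [flipSign, h]
  set v : Fin n → Fin n → Fin n → Fin n → ℝ := fun i j k l => eps i * eps j * eps k * eps l *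
    q (basis4 i j k l) (basis4 i j k l) with hv
  have v12 : ∀ i j k l, v j i k l = v i j k l := by
    intro i j k l
    simp only [hv]
    rw [(halt _).swap12 i j, hsymm, (halt _).swap12 i j]; ring
  have v23 : ∀ i j k l, v i k j l = v i j k l := by
    intro i j k l
    simp only [hv]
    rw [(halt _).swap23 i j, hsymm, (halt _).swap23 i j]; ring
  have v34 : ∀ i j k l, v i j l k = v i j k l := by
    intro i j k l
    simp only [hv]
    rw [(halt _).swap34 i j, hsymm, (halt _).swap34 i j]; ring
  -- Mix `e_i` with `e_j`; the mixed coefficient vanishes by the sign change in `e_i`.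
  have vex : ∀ i j k l m, Distinct4 i k l m → Distinct4 j k l m → v i k l m = v j k l m := by
    intro i j k l m hi hj
    by_cases hij : i = j
    · rw [hij]
    unfold Distinct4 at hi hj
    obtain ⟨A, hA, hk, s, t, hit, ht, hst⟩ := exists_mixing hij
    have h := hinv A hA (basis4 i k l m) (basis4 i k l m)
    have z1 : q (basis4 i k l m) (basis4 j k l m) = 0 :=
      hzero i i k l m j k l m (by rw [hself, hne i k, hne i l, hne i m] <;> grind) (by grind)
        (by grind) (by grind) (by grind)
    rw [basis4, change4_tensor4, hit, hk k (by grind) (by grind), hk l (by grind) (by grind),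
      hk m (by grind) (by grind)] at h
    simp only [tensor4_add₁, tensor4_smul₁, map_add, map_smul, LinearMap.add_apply,
      LinearMap.smul_apply, smul_eq_mul] at h
    change s * (s * q (basis4 i k l m) (basis4 i k l m) + t * q (basis4 j k l m) (basis4 i k l m)) +
      t * (s * q (basis4 i k l m) (basis4 j k l m) + t * q (basis4 j k l m) (basis4 j k l m)) =
        q (basis4 i k l m) (basis4 i k l m) at h
    rw [hsymm (basis4 j k l m) (basis4 i k l m), z1] at h
    have := eq_of_mixing (i := i) (j := j) (x := q (basis4 i k l m) (basis4 i k l m))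
      (y := q (basis4 j k l m) (basis4 j k l m)) ht hst (by linarith)
    simp only [hv]
    linear_combination (- eps k * eps l * eps m) * this
  obtain ⟨v₀, hv₀⟩ : ∃ v₀, ∀ i j k l, Distinct4 i j k l → v i j k l = v₀ := by
    by_cases h : ∃ i j k l : Fin n, Distinct4 i j k l
    · obtain ⟨i, j, k, l, h⟩ := h
      exact ⟨v i j k l, fun a b c d h' => eq_of_exchange v12 v23 v34 vex h' h⟩
    · push Not at h
      exact ⟨0, fun i j k l h' => absurd h' (h i j k l)⟩
  -- On an alternating functional `extDerivArr` acts as `-4`, whence the factor `16`; each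
  -- coefficient of `normSq4` is met by the `24` orderings of a quadruple. The quotient is `3 / 2`.
  refine ⟨3 / 2 * v₀, fun y => ?_⟩
  set Z := extDerivArr y with hZdef
  have hZ : AltFun Z := ⟨extDerivArr_swap12 y, extDerivArr_swap23 y, extDerivArr_swap34 y⟩
  have h16 : q Z Z = 16 * q y y := by
    rw [hZdef, (halt _).map_extDerivArr, hsymm, (halt _).map_extDerivArr]; ring
  have hsum : q Z Z = 24 * v₀ * normSq4 (eta n) Z := by
    rw [hsymm, map_eq_sum_basis4 (q Z), normSq4_eta, Finset.mul_sum]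
    refine Finset.sum_congr rfl fun i _ => ?_
    rw [Finset.mul_sum]
    refine Finset.sum_congr rfl fun j _ => ?_
    rw [Finset.mul_sum]
    refine Finset.sum_congr rfl fun k _ => ?_
    rw [Finset.mul_sum]
    refine Finset.sum_congr rfl fun l _ => ?_
    by_cases hI : Distinct4 i j k l
    · rw [hsymm, map_eq_sum_basis4 (q (basis4 i j k l)),
        sum_alt_mul (Q := fun a b c d => q (basis4 i j k l) (basis4 a b c d)) hZ
          ⟨(halt _).swap12, (halt _).swap23, (halt _).swap34⟩ hI, ← hv₀ i j k l hI]
      · simp only [hv]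
        have e : (1 : ℝ) = (eps i * eps i) * (eps j * eps j) * (eps k * eps k) *
          (eps l * eps l) := by
          simp [eps_mul_self]
        linear_combination (24 * Z i j k l ^ 2 * q (basis4 i j k l) (basis4 i j k l)) * e
      · intro a b c d _ h
        unfold Distinct4 at hI
        rcases h with h | h | h | h
        · exact hzero i _ _ _ _ _ _ _ _ (by rw [hself, hne i j, hne i k, hne i l] <;> grind) h.1
            h.2.1 h.2.2.1 h.2.2.2
        · exact hzero j _ _ _ _ _ _ _ _ (by rw [hself, hne j i, hne j k, hne j l] <;> grind) h.1
            h.2.1 h.2.2.1 h.2.2.2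
        · exact hzero k _ _ _ _ _ _ _ _ (by rw [hself, hne k i, hne k j, hne k l] <;> grind) h.1
            h.2.1 h.2.2.1 h.2.2.2
        · exact hzero l _ _ _ _ _ _ _ _ (by rw [hself, hne l i, hne l j, hne l k] <;> grind) h.1
            h.2.1 h.2.2.1 h.2.2.2
    · rw [hZ.eq_zero hI]; ring
  linarith

/-! ### The normal form at the Minkowski matrix -/

lemma change4_smul (A : Matrix (Fin n) (Fin n) ℝ) (r : ℝ) (x : Arr4 n) :
    change4 A (r • x) = r • change4 A x := by
  ext i j k l
  simp only [change4, Pi.smul_apply, smul_eq_mul, Finset.mul_sum]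
  exact Finset.sum_congr rfl fun a _ => Finset.sum_congr rfl fun b _ => Finset.sum_congr rfl fun c
    _ => Finset.sum_congr rfl fun d _ => by ring

lemma symm4_change4 (A : Matrix (Fin n) (Fin n) ℝ) (x : Arr4 n) :
    symm4 (change4 A x) = change4 A (symm4 x) := by
  have e : symm4 x = (1 / 4 : ℝ) • (x + (fun i j k l => x j i k l) + (fun i j k l => x i j l k) +
    (fun i j k l => x j i l k)) := by
    ext i j k l; simp only [symm4_apply, Pi.smul_apply, Pi.add_apply, smul_eq_mul]; ring
  rw [e]
  simp only [change4_smul, change4_add]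
  ext i j k l
  have h : change4 A (fun i j k l => x j i l k) i j k l = change4 A x j i l k :=
    (change4_swap12 A (fun i j k l => x i j l k) i j k l).trans (change4_swap34 A x j i k l)
  simp only [symm4_apply, Pi.smul_apply, Pi.add_apply, smul_eq_mul]
  rw [change4_swap12 A x i j k l, change4_swap34 A x i j k l, h]
  ring

lemma metricShift_zero (w : Arr2 n) : metricShift w 0 = 0 := by ext; simp [metricShift]

lemma metricQuad_zero (w : Arr2 n) : metricQuad w 0 = 0 := by ext; simp [metricQuad]

lemma metricCubic_zero (w : Arr2 n) : metricCubic w 0 = 0 := by ext; simp [metricCubic]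

lemma derivShift_zero (d : Arr3 n) : derivShift d 0 = 0 := by ext; simp [derivShift]

lemma derivShift_zero_left (S : Arr3 n) : derivShift 0 S = 0 := by ext; simp [derivShift]

lemma metricShift_neg (w : Arr2 n) (S : Arr3 n) : metricShift w (-S) = - metricShift w S := by
  ext i j k; simp only [metricShift, Pi.neg_apply, ← Finset.sum_neg_distrib]
  exact Finset.sum_congr rfl fun a _ => by ring

lemma metricQuad_neg (w : Arr2 n) (S : Arr3 n) : metricQuad w (-S) = metricQuad w S := by
  ext i j k l; simp only [metricQuad, Pi.neg_apply]; exact Finset.sum_congr rfl fun a _ =>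
    Finset.sum_congr rfl fun b _ => by ring

lemma metricCubic_neg (w : Arr2 n) (T : Arr4 n) : metricCubic w (-T) = - metricCubic w T := by
  ext i j k l; simp only [metricCubic, Pi.neg_apply, ← Finset.sum_neg_distrib]
  exact Finset.sum_congr rfl fun a _ => by ring

lemma derivShift_neg (d S : Arr3 n) : derivShift d (-S) = - derivShift d S := by
  ext i j k l; simp only [derivShift, Pi.neg_apply, ← Finset.sum_neg_distrib]
  exact Finset.sum_congr rfl fun a _ => by ring

lemma isSymm4_zero : IsSymm4 (0 : Arr4 n) := ⟨fun _ _ _ _ => rfl, fun _ _ _ _ => rfl⟩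

lemma det_ne_zero_of_change2_eta {A : Matrix (Fin n) (Fin n) ℝ} (hA : change2 A (eta n) = eta n) :
    A.det ≠ 0 := by
  intro h
  have h1 := det_change2 A (eta n)
  rw [hA, h] at h1
  apply det_eta_ne_zero (n := n)
  rw [h1]; simp

lemma change3_neg_one (d : Arr3 n) : change3 (-1) d = - d := by
  ext i j k; simp [change3, Matrix.one_apply]

lemma change4_neg_one (y : Arr4 n) : change4 (-1) y = y := by
  ext i j k l; simp [change4, Matrix.one_apply]

lemma change2_neg_one (w : Arr2 n) : change2 (-1) w = w := by
  ext i j; simp [change2, Matrix.one_apply]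

lemma change3_zero (A : Matrix (Fin n) (Fin n) ℝ) : change3 A 0 = 0 := by
  ext i j k; simp [change3]

lemma change4_zero (A : Matrix (Fin n) (Fin n) ℝ) : change4 A 0 = 0 := by
  ext i j k l; simp [change4]

/-- The normal form at `η`, as a statement on quadratic polynomials. `P s x d y` stands for the
value of the Lagrangian at `hatJet η s x d y`; `P₀`, `ℓ`, `q` are its constant, linear and bilinear
parts. -/
lemma normal_form_eta {P₀ : ℝ} {ℓ : Arr3 n × Arr4 n × Arr3 n × Arr4 n →ₗ[ℝ] ℝ}
    {q : Arr3 n × Arr4 n × Arr3 n × Arr4 n →ₗ[ℝ] Arr3 n × Arr4 n × Arr3 n × Arr4 n →ₗ[ℝ] ℝ}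
    (hq : ∀ u v, q u v = q v u) {P : Arr3 n → Arr4 n → Arr3 n → Arr4 n → ℝ}
    (hP : ∀ s x d y, P s x d y = P₀ + ℓ (s, x, d, y) + (1 / 2) * q (s, x, d, y) (s, x, d, y))
    (hlin : ∀ A : Matrix (Fin n) (Fin n) ℝ, change2 A (eta n) = eta n → ∀ x, IsSymm4 x → ∀ d y,
        P 0 (change4 A x) (change3 A d) (change4 A y) = P 0 x d y)
    (hshift : ∀ x, IsSymm4 x → ∀ d y (S : Arr3 n) (T : Arr4 n), (∀ a i j, S a i j = S a j i) →
        (∀ a i j k, T a i j k = T a j i k) → (∀ a i j k, T a i j k = T a i k j) →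
      P (metricShift (eta n) S) (x + metricQuad (eta n) S + metricCubic (eta n) T) d
          (y + derivShift d S) = P 0 x d y) :
    ∃ b c : ℝ, ∀ x, IsSymm4 x → ∀ d y, P 0 x d y = P₀ + b * curvatureTrace (eta n) x + c *
        normSq4 (eta n) (extDerivArr y) + ℓ (0, 0, 0, y) + (1 / 2) *
          q (0, 0, d, 0) (0, 0, d, 0) := by
  -- The Taylor formula of `P` at a point other than the origin.
  have hadd : ∀ (s : Arr3 n) (x : Arr4 n) (d : Arr3 n) (y : Arr4 n) (s' : Arr3 n) (x' : Arr4 n)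
    (d' : Arr3 n) (y' : Arr4 n), P (s + s') (x + x') (d + d') (y + y') = P s x d y +
      ℓ (s', x', d', y') + q (s, x, d, y) (s', x', d', y') + (1 / 2) *
        q (s', x', d', y') (s', x', d', y') := by
    intro s x d y s' x' d' y'
    have e : (s + s', x + x', d + d', y + y') = (s, x, d, y) + (s', x', d', y') := rfl
    rw [hP, hP, e]
    simp only [map_add, LinearMap.add_apply]
    rw [hq (s', x', d', y') (s, x, d, y)]
    ring
  -- Compare the shifts by `T` and by `-T`: the term quadratic in `T` cancels.
  have hT : ∀ x, IsSymm4 x → ∀ d y (T : Arr4 n), (∀ a i j k, T a i j k = T a j i k) →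
    (∀ a i j k, T a i j k = T a i k j) →
      ℓ (0, metricCubic (eta n) T, 0, 0) + q (0, x, d, y) (0, metricCubic (eta n) T, 0, 0) = 0 := by
    intro x hx d y T hT hT'
    have h1 := hshift x hx d y 0 T (fun _ _ _ => rfl) hT hT'
    have h2 := hshift x hx d y 0 (-T) (fun _ _ _ => rfl) (fun a i j k => by simp [hT a i])
      (fun a i j k => by simp [hT' a i])
    rw [metricShift_zero, metricQuad_zero, derivShift_zero, add_zero, metricCubic_neg] at h2
    rw [metricShift_zero, metricQuad_zero, derivShift_zero, add_zero] at h1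
    have a1 := hadd 0 x d y 0 (metricCubic (eta n) T) 0 0
    have a2 := hadd 0 x d y 0 (-metricCubic (eta n) T) 0 0
    have e : ((0 : Arr3 n), - metricCubic (eta n) T, (0 : Arr3 n), (0 : Arr4 n)) = - (0,
      metricCubic (eta n) T, 0, 0) := by simp
    rw [e] at a2
    simp only [add_zero, map_neg, LinearMap.neg_apply] at a1 a2 h1 h2
    linarith
  have hTl : ∀ (T : Arr4 n), (∀ a i j k, T a i j k = T a j i k) →
    (∀ a i j k, T a i j k = T a i k j) → ℓ (0, metricCubic (eta n) T, 0, 0) = 0 := by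
    intro T h h'
    have := hT 0 isSymm4_zero 0 0 T h h'
    have e : ((0 : Arr3 n), (0 : Arr4 n), (0 : Arr3 n), (0 : Arr4 n)) = 0 := rfl
    rw [e, map_zero, LinearMap.zero_apply, add_zero] at this
    exact this
  have hTq : ∀ x, IsSymm4 x → ∀ d y (T : Arr4 n), (∀ a i j k, T a i j k = T a j i k) →
    (∀ a i j k, T a i j k = T a i k j) →
      q (0, x, d, y) (0, metricCubic (eta n) T, 0, 0) = 0 := fun x hx d y T h h' => by
    have := hT x hx d y T h h'
    rwa [hTl T h h', zero_add] at this
  -- Subtract from the shift by `S` at `(x, d, y)` the one at `(0, d, 0)`: only the part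
  -- bilinear in `(x, y)` and the shift remains.
  have hS : ∀ x, IsSymm4 x → ∀ d y (S : Arr3 n), (∀ a i j, S a i j = S a j i) →
      q (0, x, 0, y) (metricShift (eta n) S, metricQuad (eta n) S, 0, derivShift d S) = 0 := by
    intro x hx d y S hS
    have h1 := hshift x hx d y S 0 hS (fun _ _ _ _ => rfl) (fun _ _ _ _ => rfl)
    have h2 := hshift 0 isSymm4_zero d 0 S 0 hS (fun _ _ _ _ => rfl) (fun _ _ _ _ => rfl)
    have a1 := hadd 0 x d y (metricShift (eta n) S) (metricQuad (eta n) S) 0 (derivShift d S)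
    have a2 := hadd 0 0 d 0 (metricShift (eta n) S) (metricQuad (eta n) S) 0 (derivShift d S)
    simp only [metricCubic_zero, add_zero, zero_add] at h1 h2 a1 a2
    have e : ((0 : Arr3 n), x, d, y) = (0, x, 0, y) + (0, 0, d, 0) := by simp
    rw [e, map_add, LinearMap.add_apply] at a1
    linarith
  -- The parts even and odd in `S` vanish separately.
  have hSneg : ∀ x, IsSymm4 x → ∀ d y (S : Arr3 n), (∀ a i j, S a i j = S a j i) →
      q (0, x, 0, y) (0, metricQuad (eta n) S, 0, 0) = 0 ∧
        q (0, x, 0, y) (metricShift (eta n) S, 0, 0, derivShift d S) = 0 := by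
    intro x hx d y S h
    have h1 := hS x hx d y S h
    have h2 := hS x hx d y (-S) (fun a i j => by simp [h a i])
    rw [metricShift_neg, metricQuad_neg, derivShift_neg] at h2
    have e1 : (metricShift (eta n) S, metricQuad (eta n) S, (0 : Arr3 n), derivShift d S) =
      (0, metricQuad (eta n) S, 0, 0) + (metricShift (eta n) S, 0, 0, derivShift d S) := by simp
    have e2 : (- metricShift (eta n) S, metricQuad (eta n) S, (0 : Arr3 n), - derivShift d S) =
      (0, metricQuad (eta n) S, 0, 0) - (metricShift (eta n) S, 0, 0, derivShift d S) := by simp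
    rw [e1, map_add] at h1
    rw [e2, map_sub] at h2
    constructor <;> linarith
  -- Subtract the case `d = 0`, in which `derivShift` vanishes.
  have hδ : ∀ x, IsSymm4 x → ∀ y (d S : Arr3 n), (∀ a i j, S a i j = S a j i) →
    q (0, x, 0, y) (0, 0, 0, derivShift d S) = 0 := by
    intro x hx y d S h
    have h1 := (hSneg x hx d y S h).2
    have h2 := (hSneg x hx 0 y S h).2
    rw [derivShift_zero_left] at h2
    have e1 : (metricShift (eta n) S, (0 : Arr4 n), (0 : Arr3 n), derivShift d S) =
      (metricShift (eta n) S, 0, 0, 0) + (0, 0, 0, derivShift d S) := by simp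
    rw [e1, map_add, h2, zero_add] at h1
    exact h1
  have hxx : ∀ x, IsSymm4 x → ∀ y x', IsSymm4 x' → q (0, x, 0, y) (0, x', 0, 0) = 0 := by
    intro x hx y x' hx'
    let ι : Arr4 n →ₗ[ℝ] Arr3 n × Arr4 n × Arr3 n × Arr4 n :=
      LinearMap.inr ℝ _ _ ∘ₗ LinearMap.inl ℝ _ _
    exact map_symm_eq_zero (f := q (0, x, 0, y) ∘ₗ ι) (fun T h h' => hTq x hx 0 y T h h')
      (fun S h => (hSneg x hx 0 y S h).1) hx'
  -- The change of coordinates `-1` reverses `d` and fixes `x` and `y`.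
  have heven : ∀ x, IsSymm4 x → ∀ d y, ℓ (0, 0, d, 0) + q (0, x, 0, y) (0, 0, d, 0) = 0 := by
    intro x hx d y
    have h := hlin (-1) (change2_neg_one _) x hx d y
    rw [change4_neg_one, change4_neg_one, change3_neg_one] at h
    have a1 := hadd 0 x 0 y 0 0 d 0
    have a2 := hadd 0 x 0 y 0 0 (-d) 0
    have e : ((0 : Arr3 n), (0 : Arr4 n), - d, (0 : Arr4 n)) = - (0, 0, d, 0) := by simp
    rw [e] at a2
    simp only [add_zero, zero_add, map_neg, LinearMap.neg_apply] at a1 a2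
    linarith
  have hd : ∀ d, ℓ (0, 0, d, 0) = 0 := by
    intro d
    have := heven 0 isSymm4_zero d 0
    have e : ((0 : Arr3 n), (0 : Arr4 n), (0 : Arr3 n), (0 : Arr4 n)) = 0 := rfl
    rwa [e, map_zero, LinearMap.zero_apply, add_zero] at this
  have hsplit : ∀ x, IsSymm4 x → ∀ d y, P 0 x d y = P₀ + ℓ (0, x, 0, 0) + ℓ (0, 0, 0, y) + (1 / 2) *
    q (0, 0, 0, y) (0, 0, 0, y) + (1 / 2) * q (0, 0, d, 0) (0, 0, d, 0) := by
    intro x hx d y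
    have a1 := hadd 0 x 0 y 0 0 d 0
    have a2 := hadd 0 0 0 y 0 x 0 0
    have h1 := heven x hx d y
    have h2 := hd d
    have h3 := hxx 0 isSymm4_zero y x hx
    have h4 := hxx x hx 0 x hx
    have h5 := hP 0 0 0 y
    simp only [add_zero, zero_add] at a1 a2
    linarith
  let ιx : Arr4 n →ₗ[ℝ] Arr3 n × Arr4 n × Arr3 n × Arr4 n :=
    LinearMap.inr ℝ _ _ ∘ₗ LinearMap.inl ℝ _ _
  let ιy : Arr4 n →ₗ[ℝ] Arr3 n × Arr4 n × Arr3 n × Arr4 n :=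
    LinearMap.inr ℝ _ _ ∘ₗ LinearMap.inr ℝ _ _ ∘ₗ LinearMap.inr ℝ _ _
  have hιx : ∀ x, ιx x = (0, x, 0, 0) := fun _ => rfl
  have hιy : ∀ y, ιy y = (0, 0, 0, y) := fun _ => rfl
  -- The part linear in `x`.
  obtain ⟨b, hb⟩ := exists_eq_curvatureTrace (f := ℓ ∘ₗ ιx ∘ₗ symm4) (fun x => by
      simp only [LinearMap.comp_apply, symm4_of_isSymm4 (isSymm4_symm4 x)]) (fun A hA x => by
      simp only [LinearMap.comp_apply, symm4_change4, hιx]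
      have h1 := hlin A hA (symm4 x) (isSymm4_symm4 x) 0 0
      have h2 : IsSymm4 (change4 A (symm4 x)) := by rw [← symm4_change4]; exact isSymm4_symm4 _
      rw [change3_zero, change4_zero, hsplit _ h2, hsplit _ (isSymm4_symm4 x)] at h1
      linarith) (fun i j k l => by
      have := cyclic_of_metricCubic (f := ℓ ∘ₗ ιx) hTl i j k l
      exact this)
  -- The part quadratic in `y`.
  obtain ⟨c, hc⟩ := exists_eq_normSq4 (q := q.compl₁₂ ιy ιy) (fun x y => hq _ _)
    (fun y => isAlternating4_of_coeff (antisymm_of_derivShift (fun d S h => by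
      have := hδ 0 isSymm4_zero y d S h
      exact this))) (fun A hA => by
      have hdiag : ∀ y, q (ιy (change4 A y)) (ιy (change4 A y)) = q (ιy y) (ιy y) := by
        intro y
        have h1 := hlin A hA 0 isSymm4_zero 0 y
        have h2 := hlin A hA 0 isSymm4_zero 0 (-y)
        have e : change4 A (-y) = - change4 A y := by
          rw [← neg_one_smul ℝ y, change4_smul, neg_one_smul]
        have e' : ∀ y : Arr4 n, ((0 : Arr3 n), (0 : Arr4 n), (0 : Arr3 n), -y) = -(0, 0, 0, y) :=
          fun y => by simp
        rw [change3_zero, change4_zero, hP, hP] at h1 h2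
        rw [e, e', e'] at h2
        simp only [map_neg, LinearMap.neg_apply] at h2
        rw [hιy, hιy]
        linarith
      intro x y
      have h := hdiag (x + y)
      rw [change4_add] at h
      simp only [map_add, LinearMap.add_apply, hdiag] at h
      rw [hq (ιy (change4 A y)), hq (ιy y) (ιy x)] at h
      simp only [LinearMap.compl₁₂_apply]
      linarith)
  refine ⟨b, c / 2, fun x hx d y => ?_⟩
  have h1 := hb x hx
  have h2 := hc y
  simp only [LinearMap.comp_apply, symm4_of_isSymm4 hx, hιx] at h1
  simp only [LinearMap.compl₁₂_apply, hιy] at h2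
  rw [hsplit x hx d y, h1, h2]
  ring

/-! ### Transport under linear changes of coordinates -/

lemma change3_mul (A : Matrix (Fin n) (Fin n) ℝ) (u v w : Fin n → ℝ) :
    change3 A (fun i j k => u i * v j * w k) = fun i j k => Matrix.vecMul u A i *
        Matrix.vecMul v A j * Matrix.vecMul w A k := by
  ext i j k
  simp only [change3, Matrix.vecMul, dotProduct]
  calc _ = ∑ a, ∑ b, ∑ c, (u a * A a i) * (v b * A b j) * (w c * A c k) :=
      Finset.sum_congr rfl fun a _ => Finset.sum_congr rfl fun b _ => Finset.sum_congr rfl fun c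
        _ => by ring
    _ = _ := by simp only [← Finset.mul_sum, ← Finset.sum_mul]

lemma change3_change3 (A B : Matrix (Fin n) (Fin n) ℝ) (x : Arr3 n) :
    change3 B (change3 A x) = change3 (A * B) x := by
  let c : Matrix (Fin n) (Fin n) ℝ → Arr3 n →ₗ[ℝ] Arr3 n := fun A => ⟨⟨change3 A, fun x y => by
    ext i j k; simp [change3, mul_add, Finset.sum_add_distrib]⟩, fun r x => by
    ext i j k
    simp only [change3, Pi.smul_apply, smul_eq_mul, Finset.mul_sum, RingHom.id_apply]
    exact Finset.sum_congr rfl fun a _ => Finset.sum_congr rfl fun b _ => Finset.sum_congr rfl fun c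
      _ => by ring⟩
  have e :
    x = ∑ a, ∑ b, ∑ d, x a b d • (fun i j k => stdCovector a i * stdCovector b j *
      stdCovector d k : Arr3 n) := by
    ext i j k
    simp [stdCovector]
  change c B (c A x) = c (A * B) x
  rw [e]
  simp only [map_sum, map_smul]
  refine Finset.sum_congr rfl fun a _ => Finset.sum_congr rfl fun b _ => Finset.sum_congr rfl fun d
    _ => congrArg _ ?_
  change change3 B (change3 A _) = change3 (A * B) _
  rw [change3_mul, change3_mul, change3_mul]
  simp only [Matrix.vecMul_vecMul]

lemma change4_change4 (A B : Matrix (Fin n) (Fin n) ℝ) (x : Arr4 n) :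
    change4 B (change4 A x) = change4 (A * B) x := by
  have h : ∀ i j k l, change4 B (change4 A (basis4 i j k l)) =
    change4 (A * B) (basis4 i j k l) := by
    intro i j k l
    rw [basis4, change4_tensor4, change4_tensor4, change4_tensor4]
    simp only [Matrix.vecMul_vecMul]
  let c : Matrix (Fin n) (Fin n) ℝ → Arr4 n →ₗ[ℝ] Arr4 n :=
    fun A => ⟨⟨change4 A, change4_add A⟩, change4_smul A⟩
  change c B (c A x) = c (A * B) x
  rw [eq_sum_basis4 x]
  simp only [map_sum, map_smul]
  exact Finset.sum_congr rfl fun a _ => Finset.sum_congr rfl fun b _ => Finset.sum_congr rfl fun d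
    _ => Finset.sum_congr rfl fun e _ => congrArg _ (h a b d e)

lemma extDerivArr_change4 (A : Matrix (Fin n) (Fin n) ℝ) (y : Arr4 n) :
    extDerivArr (change4 A y) = change4 A (extDerivArr y) := by
  let c : Arr4 n →ₗ[ℝ] Arr4 n := ⟨⟨change4 A, change4_add A⟩, change4_smul A⟩
  have h12 : ∀ y, swap12 (c y) = c (swap12 y) := fun y => by
    ext i j k l; exact (change4_swap12 A y i j k l).symm
  have h23 : ∀ y, swap23 (c y) = c (swap23 y) := fun y => by
    ext i j k l; exact (change4_swap23 A y i j k l).symm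
  have h34 : ∀ y, swap34 (c y) = c (swap34 y) := fun y => by
    ext i j k l; exact (change4_swap34 A y i j k l).symm
  change extDerivArr (c y) = c (extDerivArr y)
  rw [extDerivArr_eq, extDerivArr_eq]
  simp only [h12, h23, h34, map_add, map_sub, map_smul]

/-- The standard pairing of arrays of four indices. -/
def pairing4 (x y : Arr4 n) : ℝ := ∑ i, ∑ j, ∑ k, ∑ l, x i j k l * y i j k l

lemma pairing4_change4 (A : Matrix (Fin n) (Fin n) ℝ) (x y : Arr4 n) :
    pairing4 (change4 A x) y = pairing4 x (change4 A.transpose y) := by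
  let f : Arr4 n →ₗ[ℝ] ℝ := ⟨⟨fun x => pairing4 (change4 A x) y, fun x x' => by
    simp only [pairing4, change4_add, Pi.add_apply, add_mul, Finset.sum_add_distrib]⟩, fun r x => by
    simp only [pairing4, change4_smul, Pi.smul_apply, smul_eq_mul, Finset.mul_sum, mul_assoc,
      RingHom.id_apply]⟩
  change f x = _
  rw [map_eq_sum_basis4 f x]
  refine Finset.sum_congr rfl fun a _ => Finset.sum_congr rfl fun b _ => Finset.sum_congr rfl fun c
    _ => Finset.sum_congr rfl fun d _ => ?_
  congr 1
  change pairing4 (change4 A (basis4 a b c d)) y = _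
  rw [basis4, change4_tensor4]
  simp only [vecMul_stdCovector]
  rfl

lemma mul_inv_change2 (w : Arr2 n) {A : Matrix (Fin n) (Fin n) ℝ} (hA : A.det ≠ 0) :
    A * Matrix.of (inv (change2 A w)) * A.transpose = Matrix.of (inv w) := by
  have e : Matrix.of (inv (change2 A w)) = (A.transpose * Matrix.of w * A)⁻¹ := by
    have : Matrix.of (change2 A w) = A.transpose * Matrix.of w * A := by
      ext i j
      exact congrFun (congrFun (change2_eq A w) i) j
    rw [← this]; rfl
  have hA' : IsUnit A.det := hA.isUnit
  have hAt : IsUnit A.transpose.det := by rwa [Matrix.det_transpose]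
  rw [e, Matrix.mul_inv_rev, Matrix.mul_inv_rev, ← Matrix.mul_assoc, Matrix.mul_nonsing_inv _ hA',
    Matrix.one_mul, Matrix.mul_assoc, Matrix.nonsing_inv_mul _ hAt, Matrix.mul_one]
  rfl

lemma normSq4_eq (w : Arr2 n) (T : Arr4 n) :
    normSq4 w T = pairing4 T (change4 (Matrix.of (inv w)).transpose T) := by
  unfold normSq4 pairing4 change4
  refine Finset.sum_congr rfl fun i _ => Finset.sum_congr rfl fun j _ => Finset.sum_congr rfl fun k
    _ => Finset.sum_congr rfl fun l _ => ?_
  simp only [Finset.mul_sum]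
  exact Finset.sum_congr rfl fun a _ => Finset.sum_congr rfl fun b _ => Finset.sum_congr rfl fun c
    _ => Finset.sum_congr rfl fun d _ => by
    simp only [Matrix.transpose_apply, Matrix.of_apply]; ring

lemma normSq4_change (w : Arr2 n) {A : Matrix (Fin n) (Fin n) ℝ} (hA : A.det ≠ 0) (T : Arr4 n) :
    normSq4 (change2 A w) (change4 A T) = normSq4 w T := by
  rw [normSq4_eq, normSq4_eq, pairing4_change4, change4_change4, change4_change4,
    ← mul_inv_change2 w hA, Matrix.transpose_mul, Matrix.transpose_mul, Matrix.transpose_transpose]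

lemma curvatureTrace_eq (w : Arr2 n) (x : Arr4 n) :
    curvatureTrace w x = pairing4 x (fun a b c d => inv w c a * inv w d b - inv w a b *
      inv w c d) := by
  simp only [curvatureTrace, pairing4, mul_sub, Finset.sum_sub_distrib]
  congr 1
  · rw [← sum4_swap12 (fun i j k r => inv w i j * inv w k r * x j r i k),
      ← sum4_swap34 (fun i j k r => inv w j i * inv w k r * x i r j k),
      ← sum4_swap23 (fun i j k r => inv w j i * inv w r k * x i k j r)]
    exact Finset.sum_congr rfl fun a _ => Finset.sum_congr rfl fun b _ => Finset.sum_congr rfl fun c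
      _ => Finset.sum_congr rfl fun d _ => by ring
  · exact Finset.sum_congr rfl fun a _ => Finset.sum_congr rfl fun b _ => Finset.sum_congr rfl fun c
      _ => Finset.sum_congr rfl fun d _ => by ring

lemma curvatureTrace_change (w : Arr2 n) {A : Matrix (Fin n) (Fin n) ℝ} (hA : A.det ≠ 0)
    (x : Arr4 n) :
    curvatureTrace (change2 A w) (change4 A x) = curvatureTrace w x := by
  rw [curvatureTrace_eq, curvatureTrace_eq, pairing4_change4]
  congr 1
  have key : ∀ a b, ∑ p, ∑ q, A a p * A b q * inv (change2 A w) p q = inv w a b := by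
    intro a b
    have := congrFun (congrFun (mul_inv_change2 w hA) a) b
    simp only [Matrix.mul_apply, Matrix.transpose_apply, Matrix.of_apply, Finset.sum_mul] at this
    rw [← this, Finset.sum_comm]
    exact Finset.sum_congr rfl fun a _ => Finset.sum_congr rfl fun b _ => by ring
  ext i j k l
  simp only [change4, Matrix.transpose_apply, mul_sub, Finset.sum_sub_distrib]
  congr 1
  · calc _ = ∑ a, ∑ b, ∑ c, ∑ d, (A k c * A i a * inv (change2 A w) c a) *
      (A l d * A j b * inv (change2 A w) d b) :=
        Finset.sum_congr rfl fun a _ => Finset.sum_congr rfl fun b _ => Finset.sum_congr rfl fun c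
          _ => Finset.sum_congr rfl fun d _ => by ring
      _ = (∑ a, ∑ c, A k c * A i a * inv (change2 A w) c a) *
        (∑ b, ∑ d, A l d * A j b * inv (change2 A w) d b) := by
        simp only [← Finset.mul_sum, ← Finset.sum_mul]
      _ = _ := by rw [Finset.sum_comm, key, Finset.sum_comm, key]
  · calc _ = ∑ a, ∑ b, ∑ c, ∑ d, (A i a * A j b * inv (change2 A w) a b) *
      (A k c * A l d * inv (change2 A w) c d) :=
        Finset.sum_congr rfl fun a _ => Finset.sum_congr rfl fun b _ => Finset.sum_congr rfl fun c
          _ => Finset.sum_congr rfl fun d _ => by ring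
      _ = (∑ a, ∑ b, A i a * A j b * inv (change2 A w) a b) *
        (∑ c, ∑ d, A k c * A l d * inv (change2 A w) c d) := by
        simp only [← Finset.mul_sum, ← Finset.sum_mul]
      _ = _ := by rw [key, key]

/-! ### Taylor expansion of a quadratic Lagrangian -/

lemma isOpen_nondegenerate : IsOpen (nondegenerate n) := by
  have : Continuous fun w : Arr2 n => (Matrix.of w).det := by
    apply Continuous.matrix_det
    exact continuous_id
  exact isOpen_ne_fun this continuous_const

lemma isOpen_jetDomain : IsOpen (jetDomain n) := isOpen_nondegenerate.preimage continuous_fst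

lemma add_mem_jetDomain {x u : JetSpace n} (hx : x ∈ jetDomain n) (hu : u.1 = 0) :
    x + u ∈ jetDomain n := by
  unfold jetDomain at *
  simpa [hu] using hx

/-- A quadratic Lagrangian equals its second Taylor polynomial in the directions which fix the
metric. -/
lemma IsQuadratic.eq_taylor {L : JetSpace n → ℝ} (hL : ContDiffOn ℝ ∞ L (jetDomain n))
    (hquad : IsQuadratic L) {x u : JetSpace n} (hx : x ∈ jetDomain n) (hu : u.1 = 0) :
    L (x + u) = L x + fderiv ℝ L x u + (1 / 2) * fderiv ℝ (fderiv ℝ L) x u u := by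
  have hmem : ∀ t : ℝ, x + t • u ∈ jetDomain n := fun t => add_mem_jetDomain hx (by simp [hu])
  have hd0 : ∀ z ∈ jetDomain n, DifferentiableAt ℝ L z :=
    fun z hz => (hL.contDiffAt (isOpen_jetDomain.mem_nhds hz)).differentiableAt (by simp)
  have hL1 : ContDiffOn ℝ ∞ (fderiv ℝ L) (jetDomain n) :=
    hL.fderiv_of_isOpen isOpen_jetDomain (by simp)
  have hd1 : ∀ z ∈ jetDomain n, DifferentiableAt ℝ (fderiv ℝ L) z :=
    fun z hz => (hL1.contDiffAt (isOpen_jetDomain.mem_nhds hz)).differentiableAt (by simp)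
  have hL2 : ContDiffOn ℝ ∞ (fderiv ℝ (fderiv ℝ L)) (jetDomain n) :=
    hL1.fderiv_of_isOpen isOpen_jetDomain (by simp)
  have hd2 : ∀ z ∈ jetDomain n, DifferentiableAt ℝ (fderiv ℝ (fderiv ℝ L)) z :=
    fun z hz => (hL2.contDiffAt (isOpen_jetDomain.mem_nhds hz)).differentiableAt (by simp)
  -- The three iterated line derivatives, as values of the iterated Fréchet derivatives.
  have h1 : ∀ z ∈ jetDomain n, lineDeriv ℝ L z u = fderiv ℝ L z u :=
    fun z hz => (hd0 z hz).lineDeriv_eq_fderiv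
  have h2 : ∀ z ∈ jetDomain n, lineDeriv ℝ (fun z => lineDeriv ℝ L z u) z u =
    fderiv ℝ (fderiv ℝ L) z u u := by
    intro z hz
    have ev : (fun z => lineDeriv ℝ L z u) =ᶠ[𝓝 z] fun z => fderiv ℝ L z u :=
      Filter.eventuallyEq_of_mem (isOpen_jetDomain.mem_nhds hz) h1
    rw [ev.lineDeriv_eq]
    have hd : HasFDerivAt (fun z => fderiv ℝ L z u) _ z :=
      (hd1 z hz).hasFDerivAt.clm_apply (hasFDerivAt_const u z)
    rw [hd.differentiableAt.lineDeriv_eq_fderiv, hd.fderiv]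
    simp
  have h3 : ∀ z ∈ jetDomain n, fderiv ℝ (fderiv ℝ (fderiv ℝ L)) z u u u = 0 := by
    intro z hz
    rw [← hquad z hz u u u hu hu hu]
    have ev : (fun x₁ => lineDeriv ℝ (fun x₂ => lineDeriv ℝ L x₂ u) x₁ u) =ᶠ[𝓝 z] fun z =>
      fderiv ℝ (fderiv ℝ L) z u u :=
      Filter.eventuallyEq_of_mem (isOpen_jetDomain.mem_nhds hz) h2
    rw [ev.lineDeriv_eq]
    have hd : HasFDerivAt (fun z => fderiv ℝ (fderiv ℝ L) z u u) _ z :=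
      ((hd2 z hz).hasFDerivAt.clm_apply (hasFDerivAt_const u z)).clm_apply (hasFDerivAt_const u z)
    rw [hd.differentiableAt.lineDeriv_eq_fderiv, hd.fderiv]
    simp
  have hline : ∀ t : ℝ, HasDerivAt (fun t : ℝ => x + t • u) u t := fun t => by
    simpa using ((hasDerivAt_id t).smul_const u).const_add x
  -- Integrate three times along the line `x + t u`: a function with vanishing derivative is
  -- constant.
  have c2 : ∀ t : ℝ, fderiv ℝ (fderiv ℝ L) (x + t • u) u u = fderiv ℝ (fderiv ℝ L) x u u := by
    have hder : ∀ t, HasDerivAt (fun t : ℝ => fderiv ℝ (fderiv ℝ L) (x + t • u) u u) 0 t := by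
      intro t
      have hd :=
        (((hd2 _ (hmem t)).hasFDerivAt.clm_apply (hasFDerivAt_const u _)).clm_apply
          (hasFDerivAt_const u _)).comp_hasDerivAt t (hline t)
      refine hd.congr_deriv ?_
      simpa using h3 _ (hmem t)
    intro t
    have := is_const_of_deriv_eq_zero (fun t => (hder t).differentiableAt) (fun t => (hder t).deriv)
      t 0
    simpa using this
  have c1 : ∀ t : ℝ, fderiv ℝ L (x + t • u) u - t * fderiv ℝ (fderiv ℝ L) x u u =
    fderiv ℝ L x u := by
    have hder :
      ∀ t, HasDerivAt (fun t : ℝ => fderiv ℝ L (x + t • u) u - t * fderiv ℝ (fderiv ℝ L) x u u) 0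
        t := by
      intro t
      have hd := ((hd1 _ (hmem t)).hasFDerivAt.clm_apply (hasFDerivAt_const u _)).comp_hasDerivAt t
        (hline t)
      refine (hd.sub ((hasDerivAt_id t).mul_const (fderiv ℝ (fderiv ℝ L) x u u))).congr_deriv ?_
      simp [c2 t]
    intro t
    have := is_const_of_deriv_eq_zero (fun t => (hder t).differentiableAt) (fun t => (hder t).deriv)
      t 0
    simpa using this
  have hder :
    ∀ t, HasDerivAt (fun t : ℝ => L (x + t • u) - t * fderiv ℝ L x u - t ^ 2 *
      ((1 / 2) * fderiv ℝ (fderiv ℝ L) x u u)) 0 t := by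
    intro t
    have hd := (hd0 _ (hmem t)).hasFDerivAt.comp_hasDerivAt t (hline t)
    refine ((hd.sub ((hasDerivAt_id t).mul_const (fderiv ℝ L x u))).sub
      (((hasDerivAt_id t).pow 2).mul_const _)).congr_deriv ?_
    have := c1 t
    simp
    linarith
  have := is_const_of_deriv_eq_zero (fun t => (hder t).differentiableAt) (fun t => (hder t).deriv) 1
    0
  simp at this
  linarith

lemma fderiv_fderiv_symm {L : JetSpace n → ℝ} (hL : ContDiffOn ℝ ∞ L (jetDomain n)) {x : JetSpace n}
    (hx : x ∈ jetDomain n) (u v : JetSpace n) :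
    fderiv ℝ (fderiv ℝ L) x u v = fderiv ℝ (fderiv ℝ L) x v u :=
  (hL.contDiffAt (isOpen_jetDomain.mem_nhds hx)).isSymmSndFDerivAt
    (by simpa using WithTop.coe_le_coe.2 (le_top (a := (2 : ℕ∞)))) u v

/-! ### The coefficient families -/

/-- The coefficients `β^{ijkl}`: the derivative of `L` in the variable `y_{ijkl}` (the derivative of
the connection) at `(w, 0, 0, 0, 0)`. -/
def betaOf (L : JetSpace n → ℝ) (w : Arr2 n) : Arr4 n := fun i j k l =>
  fderiv ℝ L (w, 0, 0, 0, 0) (0, 0, 0, 0, basis4 i j k l)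

/-- The array with entry `1` at `(i, j, k)` and `0` elsewhere. -/
def basis3 (i j k : Fin n) :
    Arr3 n := fun a b c => stdCovector i a * stdCovector j b * stdCovector k c

lemma eq_sum_basis3 (x : Arr3 n) : x = ∑ i, ∑ j, ∑ k, x i j k • basis3 i j k := by
  ext a b c
  simp [basis3, stdCovector]

/-- The coefficients `μ^{ijkabc}`: half the second derivatives of `L` in the variables `y_{ijk}`
(the connection) at `(w, 0, 0, 0, 0)`. -/
def muOf (L : JetSpace n → ℝ) (w : Arr2 n) (i j k : Fin n) : Arr3 n := fun a b c =>
  (1 / 2) * fderiv ℝ (fderiv ℝ L) (w, 0, 0, 0, 0) (0, 0, 0, basis3 a b c, 0) (0, 0, 0, basis3 i j k,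
    0)

lemma sum_betaOf (L : JetSpace n → ℝ) (w : Arr2 n) (y : Arr4 n) :
    ∑ i, ∑ j, ∑ k, ∑ l, betaOf L w i j k l * y i j k l = fderiv ℝ L (w, 0, 0, 0, 0)
        (0, 0, 0, 0, y) := by
  let ι : Arr4 n →ₗ[ℝ] JetSpace n := LinearMap.inr ℝ _ _ ∘ₗ LinearMap.inr ℝ _ _ ∘ₗ LinearMap.inr ℝ _
    _ ∘ₗ LinearMap.inr ℝ _ _
  have := map_eq_sum_basis4 ((fderiv ℝ L (w, 0, 0, 0, 0)).toLinearMap ∘ₗ ι) y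
  refine Eq.trans ?_ this.symm
  exact Finset.sum_congr rfl fun a _ => Finset.sum_congr rfl fun b _ => Finset.sum_congr rfl fun c
    _ => Finset.sum_congr rfl fun d _ => mul_comm _ _

lemma quadForm_muOf (L : JetSpace n → ℝ) (w : Arr2 n) (d : Arr3 n) :
    quadForm (muOf L) w d = (1 / 2) * fderiv ℝ (fderiv ℝ L) (w, 0, 0, 0, 0) (0, 0, 0, d, 0)
        (0, 0, 0, d, 0) := by
  let ι : Arr3 n →ₗ[ℝ] JetSpace n := LinearMap.inr ℝ _ _ ∘ₗ LinearMap.inr ℝ _ _ ∘ₗ LinearMap.inr ℝ _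
    _ ∘ₗ LinearMap.inl ℝ _ _
  let q : JetSpace n →L[ℝ] JetSpace n →L[ℝ] ℝ := fderiv ℝ (fderiv ℝ L) (w, 0, 0, 0, 0)
  change quadForm (muOf L) w d = (1 / 2) * q (ι d) (ι d)
  have e : ι d = ∑ i, ∑ j, ∑ k, d i j k • ι (basis3 i j k) := by
    conv_lhs => rw [eq_sum_basis3 d]
    simp only [map_sum, map_smul]
  rw [e]
  simp only [map_sum, map_smul, FunLike.coe_sum, FunLike.coe_smul, Finset.sum_apply, Pi.smul_apply,
    smul_eq_mul, Finset.mul_sum]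
  unfold quadForm
  refine Finset.sum_congr rfl fun i _ => Finset.sum_congr rfl fun j _ => Finset.sum_congr rfl fun k
    _ => Finset.sum_congr rfl fun a _ => Finset.sum_congr rfl fun b _ => Finset.sum_congr rfl fun c
      _ => ?_
  change (1 / 2) * q (ι (basis3 a b c)) (ι (basis3 i j k)) * d i j k * d a b c = _
  ring

lemma mem_jetDomain_of_nondegenerate {w : Arr2 n} (hw : w ∈ nondegenerate n) :
    ((w, 0, 0, 0, 0) : JetSpace n) ∈ jetDomain n := hw

lemma contDiffOn_betaOf {L : JetSpace n → ℝ} (hL : ContDiffOn ℝ ∞ L (jetDomain n)) :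
    ContDiffOn ℝ ∞ (betaOf L) (nondegenerate n) := by
  have h1 : ContDiffOn ℝ ∞ (fderiv ℝ L) (jetDomain n) :=
    hL.fderiv_of_isOpen isOpen_jetDomain (by simp)
  have hbase : ContDiffOn ℝ ∞ (fun w : Arr2 n => ((w, 0, 0, 0, 0) : JetSpace n))
    (nondegenerate n) := (contDiff_id.prodMk contDiff_const).contDiffOn
  have h2 : ContDiffOn ℝ ∞ (fun w : Arr2 n => fderiv ℝ L (w, 0, 0, 0, 0)) (nondegenerate n) :=
    h1.comp hbase fun w hw => mem_jetDomain_of_nondegenerate hw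
  refine contDiffOn_pi.2 fun i => contDiffOn_pi.2 fun j => contDiffOn_pi.2 fun k =>
    contDiffOn_pi.2 fun l => ?_
  exact h2.clm_apply contDiffOn_const

lemma contDiffOn_muOf {L : JetSpace n → ℝ} (hL : ContDiffOn ℝ ∞ L (jetDomain n)) :
    ContDiffOn ℝ ∞ (muOf L) (nondegenerate n) := by
  have h1 : ContDiffOn ℝ ∞ (fderiv ℝ L) (jetDomain n) :=
    hL.fderiv_of_isOpen isOpen_jetDomain (by simp)
  have h1' : ContDiffOn ℝ ∞ (fderiv ℝ (fderiv ℝ L)) (jetDomain n) :=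
    h1.fderiv_of_isOpen isOpen_jetDomain (by simp)
  have hbase : ContDiffOn ℝ ∞ (fun w : Arr2 n => ((w, 0, 0, 0, 0) : JetSpace n))
    (nondegenerate n) := (contDiff_id.prodMk contDiff_const).contDiffOn
  have h2 : ContDiffOn ℝ ∞ (fun w : Arr2 n => fderiv ℝ (fderiv ℝ L) (w, 0, 0, 0, 0))
    (nondegenerate n) := h1'.comp hbase fun w hw => mem_jetDomain_of_nondegenerate hw
  refine contDiffOn_pi.2 fun i => contDiffOn_pi.2 fun j => contDiffOn_pi.2 fun k =>
    contDiffOn_pi.2 fun a => contDiffOn_pi.2 fun b => contDiffOn_pi.2 fun c => ?_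
  exact contDiffOn_const.mul ((h2.clm_apply contDiffOn_const).clm_apply contDiffOn_const)

lemma lc4_zero : lc4 (0 : Arr4 n) = 0 := by
  ext i j k l; simp [lc4]

/-- The direction in which `hatJet w` moves: the part of `hatJet` linear in `(s, x, d, y)`. -/
def hatDirection : Arr3 n × Arr4 n × Arr3 n × Arr4 n →ₗ[ℝ] JetSpace n where
  toFun u := (0, u.1, u.2.1, u.2.2.1 + lc3 u.1, u.2.2.2 + lc4 u.2.1)
  map_add' u v := by
    refine Prod.ext (add_zero _).symm (Prod.ext rfl (Prod.ext rfl (Prod.ext ?_ ?_)))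
    · ext i j k; simp only [lc3, Prod.fst_add, Prod.snd_add, Pi.add_apply]; ring
    · ext i j k l; simp only [lc4, Prod.fst_add, Prod.snd_add, Pi.add_apply]; ring
  map_smul' r u := by
    refine Prod.ext (smul_zero _).symm (Prod.ext rfl (Prod.ext rfl (Prod.ext ?_ ?_)))
    · ext i j k; simp only [lc3, Prod.smul_fst, Prod.smul_snd, Pi.add_apply, Pi.smul_apply,
        smul_eq_mul, RingHom.id_apply]; ring
    · ext i j k l; simp only [lc4, Prod.smul_fst, Prod.smul_snd, Pi.add_apply, Pi.smul_apply,
        smul_eq_mul, RingHom.id_apply]; ring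

lemma hatDirection_apply (s : Arr3 n) (x : Arr4 n) (d : Arr3 n) (y : Arr4 n) :
    hatDirection (s, x, d, y) = (0, s, x, d + lc3 s, y + lc4 x) := rfl

lemma value_hatJet {L : JetSpace n → ℝ} (hL : ContDiffOn ℝ ∞ L (jetDomain n))
    (hquad : IsQuadratic L) {w : Arr2 n} (hw : w ∈ nondegenerate n) (s : Arr3 n) (x : Arr4 n)
      (d : Arr3 n) (y : Arr4 n) :
    L (hatJet w s x d y) = L (w, 0, 0, 0, 0) + fderiv ℝ L (w, 0, 0, 0, 0)
        (hatDirection (s, x, d, y))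
      + (1 / 2) * fderiv ℝ (fderiv ℝ L) (w, 0, 0, 0, 0) (hatDirection (s, x, d, y))
          (hatDirection (s, x, d, y)) := by
  rw [← hquad.eq_taylor hL (mem_jetDomain_of_nondegenerate hw) rfl, hatDirection_apply]
  simp [hatJet]

lemma hatDirection_d (d : Arr3 n) : hatDirection (0, 0, d, 0) = (0, 0, 0, d, 0) := by
  rw [hatDirection_apply, lc3_zero, lc4_zero, add_zero, add_zero]

lemma hatDirection_y (y : Arr4 n) : hatDirection (0, 0, 0, y) = (0, 0, 0, 0, y) := by
  rw [hatDirection_apply, lc3_zero, lc4_zero, add_zero, add_zero]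

lemma hatJet_zero (w : Arr2 n) : hatJet w 0 0 0 0 = (w, 0, 0, 0, 0) := by
  rw [hatJet, lc3_zero, lc4_zero, add_zero, add_zero]

lemma change4_neg (A : Matrix (Fin n) (Fin n) ℝ) (x : Arr4 n) : change4 A (-x) = - change4 A x := by
  rw [← neg_one_smul ℝ x, change4_smul, neg_one_smul]

lemma change3_neg (A : Matrix (Fin n) (Fin n) ℝ) (x : Arr3 n) : change3 A (-x) = - change3 A x := by
  ext i j k; simp [change3]

/-- The part of `L` linear in `y` is invariant, being the odd part of the value at
`(w, 0, 0, 0, y)`. -/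
lemma fderiv_change4 {L : JetSpace n → ℝ} (hL : ContDiffOn ℝ ∞ L (jetDomain n))
    (hquad : IsQuadratic L) (hinv : IsCoordinateInvariant L)
    {w : Arr2 n} (hw : IsLorentz w) {A : Matrix (Fin n) (Fin n) ℝ} (hA : A.det ≠ 0) (y : Arr4 n) :
    fderiv ℝ L (change2 A w, 0, 0, 0, 0) (0, 0, 0, 0, change4 A y) = fderiv ℝ L (w, 0, 0, 0, 0)
        (0, 0, 0, 0, y) := by
  have h1 := value_linear_change hinv hw isSymm4_zero 0 y hA
  have h2 := value_linear_change hinv hw isSymm4_zero 0 (-y) hA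
  rw [change4_zero, change3_zero, value_hatJet hL hquad hw.det_ne_zero,
    value_hatJet hL hquad (hw.change2 hA).det_ne_zero, hatDirection_y, hatDirection_y] at h1
  rw [change4_zero, change3_zero, value_hatJet hL hquad hw.det_ne_zero,
    value_hatJet hL hquad (hw.change2 hA).det_ne_zero, hatDirection_y, hatDirection_y,
      change4_neg] at h2
  have e : ∀ y : Arr4 n, ((0, 0, 0, 0, -y) : JetSpace n) = - (0, 0, 0, 0, y) := fun y => by simp
  rw [e, e] at h2
  simp only [map_neg, FunLike.coe_neg, Pi.neg_apply, neg_neg] at h2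
  linarith

/-- The quadratic term is the even part of the value at `(w, 0, 0, d, 0)`. -/
lemma isQuadraticInvariant_muOf {L : JetSpace n → ℝ} (hL : ContDiffOn ℝ ∞ L (jetDomain n))
    (hquad : IsQuadratic L) (hinv : IsCoordinateInvariant L) :
    IsQuadraticInvariant (muOf L) := by
  intro w hw A hA d
  rw [quadForm_muOf, quadForm_muOf]
  have h0 := value_linear_change hinv hw isSymm4_zero 0 0 hA
  have h1 := value_linear_change hinv hw isSymm4_zero d 0 hA
  have h2 := value_linear_change hinv hw isSymm4_zero (-d) 0 hA
  rw [change4_zero, change3_zero, hatJet_zero, hatJet_zero] at h0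
  rw [change4_zero, value_hatJet hL hquad hw.det_ne_zero,
    value_hatJet hL hquad (hw.change2 hA).det_ne_zero, hatDirection_d, hatDirection_d] at h1
  rw [change4_zero, value_hatJet hL hquad hw.det_ne_zero,
    value_hatJet hL hquad (hw.change2 hA).det_ne_zero, hatDirection_d, hatDirection_d,
      change3_neg] at h2
  have e : ∀ d : Arr3 n, ((0, 0, 0, -d, 0) : JetSpace n) = - (0, 0, 0, d, 0) := fun y => by simp
  rw [e, e] at h2
  simp only [map_neg, FunLike.coe_neg, Pi.neg_apply, neg_neg] at h2
  linarith

/-- Apply the invariance of the part linear in `y` to `y = d ⊗ v`, for all covectors `v`. -/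
lemma isVectorInvariant_betaOf {L : JetSpace n → ℝ} (hL : ContDiffOn ℝ ∞ L (jetDomain n))
    (hquad : IsQuadratic L) (hinv : IsCoordinateInvariant L) :
    IsVectorInvariant (betaOf L) := by
  intro w hw A hA d
  ext a
  have hsum : ∀ (w : Arr2 n) (d : Arr3 n) (v : Fin n → ℝ), ∑ l, v l * contraction (betaOf L) w d l =
    fderiv ℝ L (w, 0, 0, 0, 0) (0, 0, 0, 0, fun i j k l => d i j k * v l) := by
    intro w d v
    rw [← sum_betaOf]
    simp only [contraction, Finset.mul_sum]
    rw [Finset.sum_comm]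
    refine Finset.sum_congr rfl fun i _ => ?_
    rw [Finset.sum_comm]
    refine Finset.sum_congr rfl fun j _ => ?_
    rw [Finset.sum_comm]
    exact Finset.sum_congr rfl fun j _ => Finset.sum_congr rfl fun j _ => by ring
  have h1 := hsum w d (stdCovector a)
  have h2 := hsum (change2 A w) (change3 A d) (A a)
  rw [← fderiv_change4 hL hquad hinv hw hA] at h1
  have e : change4 A (fun i j k l => d i j k * stdCovector a l) = fun i j k l => change3 A d i j k *
    A a l := by
    ext i j k l
    simp only [change4, change3, Finset.sum_mul, stdCovector, mul_ite, mul_one, mul_zero,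
      Finset.sum_ite_eq', Finset.mem_univ, if_true]
    exact Finset.sum_congr rfl fun j _ => Finset.sum_congr rfl fun j _ => Finset.sum_congr rfl fun j
      _ => by ring
  rw [e, ← h2] at h1
  simp only [stdCovector, ite_mul, one_mul, zero_mul, Finset.sum_ite_eq', Finset.mem_univ,
    if_true] at h1
  rw [h1]; rfl

/-- The normal form at all jets with vanishing first derivatives of the metric. -/
theorem exists_value_normal_form {L : JetSpace n → ℝ} (hL : ContDiffOn ℝ ∞ L (jetDomain n))
    (hquad : IsQuadratic L) (hinv : IsCoordinateInvariant L) :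
    ∃ a b c : ℝ, ∀ w, IsLorentz w → ∀ x, IsSymm4 x → ∀ d y, L (hatJet w 0 x d y) = a + b *
        curvatureTrace w x + c * normSq4 w (extDerivArr y)
      + quadForm (muOf L) w d + ∑ i, ∑ j, ∑ k, ∑ l, betaOf L w i j k l * y i j k l := by
  have hη : eta n ∈ nondegenerate n := det_eta_ne_zero
  obtain ⟨b, c, h⟩ :=
    normal_form_eta (P₀ := L (eta n, 0, 0, 0, 0)) (ℓ := (fderiv ℝ L (eta n, 0, 0, 0, 0)).toLinearMap
      ∘ₗ hatDirection)
    (q := ((ContinuousLinearMap.coeLM ℝ) ∘ₗ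
      (fderiv ℝ (fderiv ℝ L) (eta n, 0, 0, 0, 0)).toLinearMap).compl₁₂ hatDirection hatDirection)
    (P := fun s x d y => L (hatJet (eta n) s x d y))
      (fun u v => fderiv_fderiv_symm hL (mem_jetDomain_of_nondegenerate hη) _ _)
    (fun s x d y => value_hatJet hL hquad hη s x d y)
    (fun A hA x hx d y => by
      have := value_linear_change hinv isLorentz_eta hx d y (det_ne_zero_of_change2_eta hA)
      rwa [hA] at this)
    (fun x hx d y S T hS hT hT' => value_shift hinv isLorentz_eta hx d y hS hT hT')
  refine ⟨L (eta n, 0, 0, 0, 0), b, c, fun w hw x hx d y => ?_⟩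
  -- A Lorentz matrix is `Aᵀ η A`, and all terms of the normal form are invariant.
  obtain ⟨A, hA, rfl⟩ := hw
  have hAi : A⁻¹ * A = 1 := Matrix.nonsing_inv_mul _ hA.isUnit
  have ex : change4 A (change4 A⁻¹ x) = x := by rw [change4_change4, hAi, change4_one]
  have ey : change4 A (change4 A⁻¹ y) = y := by rw [change4_change4, hAi, change4_one]
  have ed : change3 A (change3 A⁻¹ d) = d := by rw [change3_change3, hAi, change3_one]
  have hx' := hx.change4 A⁻¹
  have h1 := value_linear_change hinv isLorentz_eta hx' (change3 A⁻¹ d) (change4 A⁻¹ y) hA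
  have h2 := h _ hx' (change3 A⁻¹ d) (change4 A⁻¹ y)
  have h3 := fderiv_change4 hL hquad hinv isLorentz_eta hA (change4 A⁻¹ y)
  have h4 := isQuadraticInvariant_muOf hL hquad hinv (eta n) isLorentz_eta A hA (change3 A⁻¹ d)
  have h5 := curvatureTrace_change (eta n) hA (change4 A⁻¹ x)
  have h6 := normSq4_change (eta n) hA (extDerivArr (change4 A⁻¹ y))
  rw [← extDerivArr_change4, ey] at h6
  rw [ex] at h5
  rw [ed] at h4
  rw [ey] at h3
  rw [ex, ey, ed] at h1
  have h7 := quadForm_muOf L (eta n) (change3 A⁻¹ d)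
  rw [sum_betaOf]
  change L (hatJet (change2 A (eta n)) 0 x d y) = L (eta n, 0, 0, 0, 0) + b *
    curvatureTrace (change2 A (eta n)) x + c * normSq4 (change2 A (eta n)) (extDerivArr y) +
      quadForm (muOf L) (change2 A (eta n)) d + fderiv ℝ L (change2 A (eta n), 0, 0, 0, 0)
        (0, 0, 0, 0, y)
  rw [h1, h3, h4, h5, h6, h7, h2]
  rw [← hatDirection_y, ← hatDirection_d]
  change _ + _ + _ + fderiv ℝ L (eta n, 0, 0, 0, 0) (hatDirection (0, 0, 0, change4 A⁻¹ y)) +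
    (1 / 2) * fderiv ℝ (fderiv ℝ L) (eta n, 0, 0, 0, 0) (hatDirection (0, 0, change3 A⁻¹ d, 0))
      (hatDirection (0, 0, change3 A⁻¹ d, 0)) = _
  ring

/-! ### Scalar curvature in coordinates -/

lemma contDiff_det : ContDiff ℝ ∞ fun w : Arr2 n => (Matrix.of w).det := by
  simp only [Matrix.det_apply, Matrix.of_apply]
  fun_prop

lemma contDiffAt_inv {w : Arr2 n} (hw : (Matrix.of w).det ≠ 0) (a b : Fin n) :
    ContDiffAt ℝ ∞ (fun w => inv w a b) w := by
  -- Cramer's rule.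
  have e : (fun w : Arr2 n => inv w a b) = fun w => ((Matrix.of w).det)⁻¹ *
    ((Matrix.of w).updateRow b (Pi.single a 1)).det := by
    ext w
    rw [inv, Matrix.inv_def, Matrix.smul_apply, Matrix.adjugate_apply, Ring.inverse_eq_inv',
      smul_eq_mul]
  rw [e]
  refine (contDiff_det.contDiffAt.inv hw).mul (ContDiff.contDiffAt ?_)
  simp only [Matrix.det_apply, Matrix.updateRow_apply, Matrix.of_apply]
  refine ContDiff.sum fun σ _ => ContDiff.const_smul _ (contDiff_prod fun i _ => ?_)
  by_cases h : σ i = b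
  · simp only [h, if_true]; exact contDiff_const
  · simp only [h, if_false]; fun_prop

lemma contDiffAt_pd {f : Coord n → ℝ} {x : Coord n} (hf : ContDiffAt ℝ ∞ f x) (k : Fin n) :
    ContDiffAt ℝ ∞ (pd k f) x :=
  (hf.fderiv_right (m := ∞) (by simp)).clm_apply contDiffAt_const

lemma differentiableAt_of_contDiffAt {f : Coord n → ℝ} {x : Coord n} (hf : ContDiffAt ℝ ∞ f x) :
    DifferentiableAt ℝ f x :=
  hf.differentiableAt (by simp)

lemma pd_pd_symm {f : Coord n → ℝ} {x : Coord n} (hf : ContDiffAt ℝ ∞ f x) (k l : Fin n) :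
    pd l (pd k f) x = pd k (pd l f) x := by
  have h : ∀ k l : Fin n, pd l (pd k f) x = fderiv ℝ (fderiv ℝ f) x (EuclideanSpace.single l 1)
    (EuclideanSpace.single k 1) := by
    intro k l
    have hd : HasFDerivAt (fun y => fderiv ℝ f y (EuclideanSpace.single k 1)) _ x :=
      (((hf.fderiv_right (m := ∞) (by simp)).differentiableAt (by simp)).hasFDerivAt).clm_apply
        (hasFDerivAt_const (EuclideanSpace.single k (1 : ℝ)) x)
    change fderiv ℝ (fun y => fderiv ℝ f y (EuclideanSpace.single k 1)) x _ = _
    rw [hd.fderiv]; simp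
  rw [h, h]
  exact hf.isSymmSndFDerivAt (by simpa using WithTop.coe_le_coe.2 (le_top (a := (2 : ℕ∞)))) _ _

/-- The array `g_{ij,k}`. -/
def pd2 (G : Coord n → Arr2 n) (x : Coord n) : Arr3 n := fun i j k => pd k (fun y => G y i j) x

/-- The array `g_{ij,kl}`. -/
def pdd2 (G : Coord n → Arr2 n) (x : Coord n) :
    Arr4 n := fun i j k l => pd l (pd k (fun y => G y i j)) x

/-- The array `D_{ijk,l}`. -/
def pd3 (D : Coord n → Arr3 n) (x : Coord n) : Arr4 n := fun i j k l => pd l (fun y => D y i j k) x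

/-- Near `x`, `G` consists of the components of a smooth Lorentz metric. Smoothness at all nearby
points is required so that the condition is open: `ContDiffAt ℝ ∞` at one point is not. -/
structure IsLorentzGerm (G : Coord n → Arr2 n) (x : Coord n) : Prop where
  eventually_contDiffAt : ∀ᶠ y in 𝓝 x, ContDiffAt ℝ ∞ G y
  isLorentz : ∀ᶠ y in 𝓝 x, IsLorentz (G y)

namespace IsLorentzGerm

variable {G : Coord n → Arr2 n} {x : Coord n}

lemma contDiffAt (h : IsLorentzGerm G x) :
    ContDiffAt ℝ ∞ G x := h.eventually_contDiffAt.self_of_nhds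

lemma comp (h : IsLorentzGerm G x) (i j : Fin n) : ContDiffAt ℝ ∞ (fun y => G y i j) x :=
  contDiffAt_pi.1 (contDiffAt_pi.1 h.contDiffAt i) j

lemma eventually (h : IsLorentzGerm G x) : ∀ᶠ y in 𝓝 x, IsLorentzGerm G y := by
  filter_upwards [h.eventually_contDiffAt.eventually_nhds, h.isLorentz.eventually_nhds] with y h1 h2
    using ⟨h1, h2⟩

lemma det_ne_zero (h : IsLorentzGerm G x) :
    (Matrix.of (G x)).det ≠ 0 := h.isLorentz.self_of_nhds.det_ne_zero

lemma symm (h : IsLorentzGerm G x) (i j : Fin n) :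
    G x i j = G x j i := h.isLorentz.self_of_nhds.symm i j

lemma pd2_symm (h : IsLorentzGerm G x) (i j k : Fin n) : pd2 G x i j k = pd2 G x j i k :=
  pd_congr (by filter_upwards [h.isLorentz] with y hy using hy.symm i j) k

lemma isSymm4_pdd2 (h : IsLorentzGerm G x) : IsSymm4 (pdd2 G x) :=
  ⟨fun i j k l => pd_congr
    (pd_eventuallyEq (by filter_upwards [h.isLorentz] with y hy using hy.symm i j) k) l,
    fun i j k l => pd_pd_symm (h.comp i j) k l⟩

lemma leviCivitaLower_eq (G : Coord n → Arr2 n) (x : Coord n) :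
    leviCivitaLower G x = lc3 (pd2 G x) := rfl

lemma contDiffAt_leviCivitaLower (h : IsLorentzGerm G x) (i j k : Fin n) :
    ContDiffAt ℝ ∞ (fun y => leviCivitaLower G y i j k) x :=
  (((contDiffAt_pd (h.comp j k) i).add (contDiffAt_pd (h.comp i k) j)).sub
    (contDiffAt_pd (h.comp i j) k)).div_const 2

lemma pd_leviCivitaLower (h : IsLorentzGerm G x) (i j k l : Fin n) :
    pd l (fun y => leviCivitaLower G y i j k) x = lc4 (pdd2 G x) i j k l := by
  have hd := fun i j k => differentiableAt_of_contDiffAt (contDiffAt_pd (h.comp i j) k)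
  have e : (fun y => leviCivitaLower G y i j k) = fun y =>
    (pd i (fun y => G y j k) y + pd j (fun y => G y i k) y - pd k (fun y => G y i j) y) *
      (1 / 2) := by
    ext y; simp only [leviCivitaLower]; ring
  rw [e, pd_mul (((hd j k i).fun_add (hd i k j)).fun_sub (hd i j k)) (differentiableAt_const _),
    pd_const, pd_sub ((hd j k i).fun_add (hd i k j)) (hd i j k), pd_add (hd j k i) (hd i k j)]
  simp only [lc4, pdd2]; ring

lemma contDiffAt_leviCivita (h : IsLorentzGerm G x) (k i j : Fin n) :
    ContDiffAt ℝ ∞ (fun y => leviCivita G y k i j) x :=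
  ContDiffAt.sum fun r _ => ((contDiffAt_inv h.det_ne_zero k r).comp x h.contDiffAt).mul
    (h.contDiffAt_leviCivitaLower i j r)

lemma sum_mul_leviCivita (h : IsLorentzGerm G x) (i j k : Fin n) :
    ∑ p, G x k p * leviCivita G x p i j = leviCivitaLower G x i j k := by
  simp only [leviCivita, Finset.mul_sum]
  rw [Finset.sum_comm]
  have : ∀ r, ∑ p, G x k p * (inv (G x) p r * leviCivitaLower G x i j r) =
    (if k = r then 1 else 0) * leviCivitaLower G x i j r := by
    intro r
    rw [← self_mul_inv h.det_ne_zero, Finset.sum_mul]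
    exact Finset.sum_congr rfl fun b _ => by ring
  simp [this]

lemma leviCivita_symm (h : IsLorentzGerm G x) (k i j : Fin n) :
    leviCivita G x k i j = leviCivita G x k j i := by
  refine Finset.sum_congr rfl fun r _ => ?_
  have := h.pd2_symm i j r
  simp only [pd2] at this
  simp only [leviCivitaLower]
  rw [this]; ring

/-- The Levi-Civita connection is metric: `g_{ij,k} = g_{aj} Γ^a_{ik} + g_{ia} Γ^a_{jk}`. -/
lemma metricShift_leviCivita (h : IsLorentzGerm G x) :
    metricShift (G x) (leviCivita G x) = pd2 G x := by
  ext i j k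
  simp only [metricShift, Finset.sum_add_distrib]
  have e : ∑ a, G x a j * leviCivita G x a i k = ∑ a, G x j a * leviCivita G x a i k :=
    Finset.sum_congr rfl fun a _ => by rw [h.symm]
  rw [e, h.sum_mul_leviCivita, h.sum_mul_leviCivita]
  have h1 := h.pd2_symm k j i
  have h2 := h.pd2_symm i j k
  have h3 := h.pd2_symm i k j
  simp only [pd2] at h1 h2 h3
  simp only [leviCivitaLower, pd2]
  linarith

lemma sum_mul_pd_leviCivita (h : IsLorentzGerm G x) (i j k m : Fin n) :
    ∑ p, G x k p * pd m (fun y => leviCivita G y p i j) x = lc4 (pdd2 G x) i j k m - ∑ p, pd2 G x k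
        p m * leviCivita G x p i j := by
  have e : pd m (fun y => ∑ p, G y k p * leviCivita G y p i j) x = lc4 (pdd2 G x) i j k m := by
    rw [← h.pd_leviCivitaLower]
    refine pd_congr ?_ m
    filter_upwards [h.eventually] with y hy using hy.sum_mul_leviCivita i j k
  have hd := fun p => differentiableAt_of_contDiffAt (h.comp k p)
  have hd' := fun p => differentiableAt_of_contDiffAt (h.contDiffAt_leviCivita p i j)
  rw [pd_sum (fun p _ => (hd p).fun_mul (hd' p))] at e
  simp only [fun p => pd_mul (hd p) (hd' p) m, Finset.sum_add_distrib] at e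
  rw [← e]; simp only [pd2]; ring

end IsLorentzGerm

/-- The double trace `g^{ij} g^{kl} A_{ijkl}`. -/
def doubleTrace (w : Arr2 n) (A : Arr4 n) : ℝ := ∑ i, ∑ j, ∑ k, ∑ l, inv w i j * inv w k l *
    A i j k l

lemma inv_symm {w : Arr2 n} (hw : ∀ i j, w i j = w j i) (i j : Fin n) : inv w i j = inv w j i := by
  have e : (Matrix.of w).transpose = Matrix.of w := by ext i j; exact hw j i
  have := congrFun (congrFun (Matrix.transpose_nonsing_inv (Matrix.of w)) i) j
  rw [e] at this
  exact this.symm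

lemma doubleTrace_add (w : Arr2 n) (A B : Arr4 n) :
    doubleTrace w (A + B) = doubleTrace w A + doubleTrace w B := by
  simp only [doubleTrace, Pi.add_apply, mul_add, Finset.sum_add_distrib]

lemma doubleTrace_smul (w : Arr2 n) (r : ℝ) (A : Arr4 n) :
    doubleTrace w (r • A) = r * doubleTrace w A := by
  simp only [doubleTrace, Pi.smul_apply, smul_eq_mul, Finset.mul_sum]
  exact Finset.sum_congr rfl fun a _ => Finset.sum_congr rfl fun b _ => Finset.sum_congr rfl fun c
    _ => Finset.sum_congr rfl fun d _ => by ring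

lemma doubleTrace_swap12 {w : Arr2 n} (hw : ∀ i j, w i j = w j i) (A : Arr4 n) :
    doubleTrace w (fun i j k l => A j i k l) = doubleTrace w A := by
  unfold doubleTrace
  rw [← sum4_swap12]
  exact Finset.sum_congr rfl fun a _ => Finset.sum_congr rfl fun b _ => Finset.sum_congr rfl fun c
    _ => Finset.sum_congr rfl fun d _ => by rw [inv_symm hw]

lemma doubleTrace_swap34 {w : Arr2 n} (hw : ∀ i j, w i j = w j i) (A : Arr4 n) :
    doubleTrace w (fun i j k l => A i j l k) = doubleTrace w A := by
  unfold doubleTrace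
  rw [← sum4_swap34]
  exact Finset.sum_congr rfl fun a _ => Finset.sum_congr rfl fun b _ => Finset.sum_congr rfl fun c
    _ => Finset.sum_congr rfl fun d _ => by rw [inv_symm hw d c]

lemma doubleTrace_exchange (w : Arr2 n) (A : Arr4 n) :
    doubleTrace w (fun i j k l => A k l i j) = doubleTrace w A := by
  have e : ∀ F : Fin n → Fin n → Fin n → Fin n → ℝ, ∑ i, ∑ j, ∑ k, ∑ l, F k l i j =
    ∑ i, ∑ j, ∑ k, ∑ l, F i j k l := by
    intro F
    rw [← sum4_swap23 (fun i j k l => F k l i j), ← sum4_swap12 (fun i j k l => F j l i k),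
      ← sum4_swap34 (fun i j k l => F i l j k)]
    exact sum4_swap23 (fun i j k l => F i j k l)
  unfold doubleTrace
  rw [← e]
  exact Finset.sum_congr rfl fun a _ => Finset.sum_congr rfl fun b _ => Finset.sum_congr rfl fun c
    _ => Finset.sum_congr rfl fun d _ => by ring

namespace IsLorentzGerm

variable {G : Coord n → Arr2 n} {x : Coord n}

lemma scalarCurvature_eq_doubleTrace (h : IsLorentzGerm G x) :
    scalarCurvature G x = doubleTrace (G x) (fun i j k l =>
    ∑ p, G x l p * (pd k (fun y => leviCivita G y p j i) x - pd j (fun y => leviCivita G y p k i) x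
    + ∑ r, (leviCivita G x r j i * leviCivita G x p k r - leviCivita G x r k i * leviCivita G x p j
        r))) := by
  unfold scalarCurvature doubleTrace ricci
  refine Finset.sum_congr rfl fun i _ => Finset.sum_congr rfl fun j _ => ?_
  rw [Finset.mul_sum]
  refine Finset.sum_congr rfl fun k _ => ?_
  set F : Fin n → ℝ := fun p => pd k (fun y => leviCivita G y p j i) x - pd j
    (fun y => leviCivita G y p k i) x
    + ∑ r, (leviCivita G x r j i * leviCivita G x p k r - leviCivita G x r k i * leviCivita G x p j
      r) with hF
  change inv (G x) i j * F k = ∑ l, inv (G x) i j * inv (G x) k l * ∑ p, G x l p * F p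
  have : ∑ l, inv (G x) i j * inv (G x) k l * ∑ p, G x l p * F p = inv (G x) i j *
    ∑ p, (∑ l, inv (G x) k l * G x l p) * F p := by
    simp only [Finset.mul_sum, Finset.sum_mul]
    rw [Finset.sum_comm]
    exact Finset.sum_congr rfl fun p _ => Finset.sum_congr rfl fun l _ => by ring
  rw [this]
  simp [inv_mul_self h.det_ne_zero]

/-- The scalar curvature is the trace of `∂∂g` corrected by the shift which removes the first
derivatives of the metric. -/
lemma scalarCurvature_eq (h : IsLorentzGerm G x) :
    scalarCurvature G x = curvatureTrace (G x) (pdd2 G x - metricQuad (G x) (leviCivita G x)) := by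
  rw [h.scalarCurvature_eq_doubleTrace]
  set w := G x with hw
  set S := leviCivita G x with hS
  set X := pdd2 G x with hX
  have hws : ∀ i j, w i j = w j i := h.symm
  -- The products of Levi-Civita symbols, contracted over their upper indices. Everything is
  -- expressed by `P` and `X`.
  set P : Arr4 n := fun i j k l => ∑ a, ∑ b, w a b * (S a i j * S b k l) with hP
  have hSsymm : ∀ k i j, S k i j = S k j i := h.leviCivita_symm
  have hlow : ∀ i j k, ∑ p, w k p * S p i j = lc3 (pd2 G x) i j k := h.sum_mul_leviCivita
  have hP12 : ∀ i j k l, P j i k l = P i j k l := fun i j k l => by simp only [hP, hSsymm _ j i]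
  have hP34 : ∀ i j k l, P i j l k = P i j k l := fun i j k l => by simp only [hP, hSsymm _ l k]
  have hPex : ∀ i j k l, P k l i j = P i j k l := fun i j k l => by
    simp only [hP]
    rw [Finset.sum_comm]
    exact Finset.sum_congr rfl fun a _ => Finset.sum_congr rfl fun b _ => by rw [hws]; ring
  have hPlow : ∀ i j k l, ∑ p, lc3 (pd2 G x) i j p * S p k l = P i j k l := by
    intro i j k l
    simp only [← hlow, hP, Finset.sum_mul]
    rw [Finset.sum_comm]
    exact Finset.sum_congr rfl fun p _ => Finset.sum_congr rfl fun l _ => by rw [hws]; ring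
  have hpd : ∀ i j k, pd2 G x i j k = lc3 (pd2 G x) i k j + lc3 (pd2 G x) j k i := by
    intro i j k
    have h1 := h.pd2_symm k j i
    have h2 := h.pd2_symm i j k
    have h3 := h.pd2_symm i k j
    simp only [lc3]
    linarith
  have hlc3symm : ∀ i j k, lc3 (pd2 G x) i j k = lc3 (pd2 G x) j i k := by
    intro i j k
    have h2 := h.pd2_symm i j k
    simp only [lc3]; linarith
  -- The Riemann tensor with all indices lowered.
  have e1 : ∀ i j k l, ∑ p, w l p *
    (pd k (fun y => leviCivita G y p j i) x - pd j (fun y => leviCivita G y p k i) x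
    + ∑ r, (S r j i * S p k r - S r k i * S p j r)) = (X j l i k - X j i l k - X k l i j +
      X k i l j) / 2 - P i j k l + P i k j l := by
    intro i j k l
    have d1 := h.sum_mul_pd_leviCivita j i l k
    have d2 := h.sum_mul_pd_leviCivita k i l j
    have r1 : ∑ p, w l p * ∑ r, (S r j i * S p k r - S r k i * S p j r) = ∑ r, lc3 (pd2 G x) k r l *
      S r j i - ∑ r, lc3 (pd2 G x) j r l * S r k i := by
      simp only [← hlow, Finset.mul_sum, Finset.sum_mul, ← Finset.sum_sub_distrib]
      rw [Finset.sum_comm]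
      exact Finset.sum_congr rfl fun p _ => Finset.sum_congr rfl fun l _ => by ring
    have r2 : ∑ p, pd2 G x l p k * S p j i = P l k j i + ∑ p, lc3 (pd2 G x) k p l * S p j i := by
      rw [← hPlow, ← Finset.sum_add_distrib]
      exact Finset.sum_congr rfl fun p _ => by rw [hpd, hlc3symm p k]; ring
    have r3 : ∑ p, pd2 G x l p j * S p k i = P l j k i + ∑ p, lc3 (pd2 G x) j p l * S p k i := by
      rw [← hPlow, ← Finset.sum_add_distrib]
      exact Finset.sum_congr rfl fun p _ => by rw [hpd, hlc3symm p j]; ring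
    simp only [mul_add, mul_sub, Finset.sum_add_distrib, Finset.sum_sub_distrib] at r1 ⊢
    rw [r1]
    change ∑ p, w l p * _ = lc4 X j i l k - ∑ p, pd2 G x l p k * S p j i at d1
    change ∑ p, w l p * _ = lc4 X k i l j - ∑ p, pd2 G x l p j * S p k i at d2
    rw [d1, d2, r2, r3]
    have s1 := h.isSymm4_pdd2.1 k j l i
    have s2 := h.isSymm4_pdd2.2 i l j k
    have t1 : P l k j i = P i j k l := by rw [← hPex, hP12 i j, hP34 i j]
    have t2 : P l j k i = P i k j l := by rw [← hPex, hP12 i k, hP34 i k]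
    rw [t1, t2]
    simp only [lc4]
    linarith
  have hX1 : ∀ i j k l, X i j k l = X j i k l := h.isSymm4_pdd2.1
  have hX2 : ∀ i j k l, X i j k l = X i j l k := h.isSymm4_pdd2.2
  have e2 :
    (fun i j k l => ∑ p, w l p *
      (pd k (fun y => leviCivita G y p j i) x - pd j (fun y => leviCivita G y p k i) x
    + ∑ r, (S r j i * S p k r - S r k i * S p j r))) = (1 / 2 : ℝ) • (fun i j k l => X j l i k) +
      (-1 / 2 : ℝ) • X
      + (-1 / 2 : ℝ) • (fun i j k l => X k l i j) + (1 / 2 : ℝ) • (fun i j k l => X i k j l) +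
        (-1 : ℝ) • P + (fun i j k l => P i k j l) := by
    ext i j k l
    rw [e1, hX1 j i l k, hX2 i j l k, hX1 k i l j, hX2 i k l j]
    simp only [Pi.add_apply, Pi.smul_apply, smul_eq_mul]
    ring
  have e3 : curvatureTrace w (X - metricQuad w S) =
    doubleTrace w ((fun i j k l => X j l i k) + (-1 : ℝ) • X + (-1 : ℝ) • P +
      (-1 : ℝ) • (fun i j k l => P j k i l)
      + (fun i j k l => P i k j l) + (fun i j k l => P i l j k)) := by
    refine Finset.sum_congr rfl fun i _ => Finset.sum_congr rfl fun j _ =>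
      Finset.sum_congr rfl fun k _ => Finset.sum_congr rfl fun l _ => ?_
    have m : ∀ i j k l, metricQuad w S i j k l = P i k j l + P i l j k := by
      intro i j k l
      simp only [metricQuad, hP, mul_add, Finset.sum_add_distrib]
    simp only [Pi.add_apply, Pi.sub_apply, Pi.smul_apply, smul_eq_mul, m]
    rw [hP12 i j, hP34 i j k l, hP34 j k i l]
    ring
  -- The terms of the two traces are matched by the symmetries of the double trace.
  have b1 : doubleTrace w (fun i j k l => P j k i l) = doubleTrace w (fun i j k l => P i k j l) :=
    doubleTrace_swap12 hws (fun i j k l => P i k j l)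
  have b2 : doubleTrace w (fun i j k l => P i l j k) = doubleTrace w (fun i j k l => P i k j l) :=
    doubleTrace_swap34 hws (fun i j k l => P i k j l)
  have b3 : doubleTrace w (fun i j k l => X k l i j) = doubleTrace w X := doubleTrace_exchange w X
  have b4 : doubleTrace w (fun i j k l => X j l i k) = doubleTrace w (fun i j k l => X i k j l) :=
    (doubleTrace_swap12 hws (fun i j k l => X i l j k)).trans
      (doubleTrace_swap34 hws (fun i j k l => X i k j l))
  rw [e2, e3]
  simp only [doubleTrace_add, doubleTrace_smul]
  rw [b1, b2, b3, b4]
  ring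

end IsLorentzGerm

/-! ### The divergence of an invariant vector field -/

/-- The derivative of `change2 (1 + t B) w` at `t = 0`. -/
def infChange2 (B : Matrix (Fin n) (Fin n) ℝ) (w : Arr2 n) :
    Arr2 n := fun i j => ∑ a, (w a j * B a i + w i a * B a j)

/-- The derivative of `change3 (1 + t B) D` at `t = 0`. -/
def infChange3 (B : Matrix (Fin n) (Fin n) ℝ) (D : Arr3 n) :
    Arr3 n := fun i j k => ∑ a, (D a j k * B a i + D i a k * B a j + D i j a * B a k)

lemma hasDerivAt_entry (B : Matrix (Fin n) (Fin n) ℝ) (a i : Fin n) :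
    HasDerivAt (fun t : ℝ => ((1 : Matrix (Fin n) (Fin n) ℝ) + t • B) a i) (B a i) 0 := by
  simpa using ((hasDerivAt_id (0 : ℝ)).mul_const (B a i)).const_add
    ((1 : Matrix (Fin n) (Fin n) ℝ) a i)

lemma hasDerivAt_change2 (B : Matrix (Fin n) (Fin n) ℝ) (w : Arr2 n) :
    HasDerivAt (fun t : ℝ => change2 (1 + t • B) w) (infChange2 B w) 0 := by
  refine hasDerivAt_pi.2 fun i => hasDerivAt_pi.2 fun j => ?_
  have h := HasDerivAt.fun_sum (u := Finset.univ) fun a (_ : a ∈ Finset.univ) =>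
    HasDerivAt.fun_sum (u := Finset.univ) fun b (_ : b ∈ Finset.univ) =>
    ((hasDerivAt_entry B a i).fun_mul (hasDerivAt_entry B b j)).mul_const (w a b)
  refine h.congr_deriv ?_
  simp [infChange2, Matrix.one_apply, add_mul, Finset.sum_add_distrib, Finset.sum_ite_irrel,
    mul_comm (w _ _)]

lemma hasDerivAt_change3 (B : Matrix (Fin n) (Fin n) ℝ) (D : Arr3 n) :
    HasDerivAt (fun t : ℝ => change3 (1 + t • B) D) (infChange3 B D) 0 := by
  refine hasDerivAt_pi.2 fun i => hasDerivAt_pi.2 fun j => hasDerivAt_pi.2 fun k => ?_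
  have h := HasDerivAt.fun_sum (u := Finset.univ) fun a (_ : a ∈ Finset.univ) =>
    HasDerivAt.fun_sum (u := Finset.univ) fun b (_ : b ∈ Finset.univ) =>
    HasDerivAt.fun_sum (u := Finset.univ) fun c (_ : c ∈ Finset.univ) =>
    (((hasDerivAt_entry B a i).fun_mul (hasDerivAt_entry B b j)).fun_mul
      (hasDerivAt_entry B c k)).mul_const (D a b c)
  refine h.congr_deriv ?_
  simp [infChange3, Matrix.one_apply, add_mul, Finset.sum_add_distrib, Finset.sum_ite_irrel,
    mul_comm (D _ _ _)]

lemma hasDerivAt_det_one_add_smul (B : Matrix (Fin n) (Fin n) ℝ) :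
    HasDerivAt (fun t : ℝ => (1 + t • B).det) B.trace 0 := by
  rw [funext fun t => Matrix.det_one_add_smul t B]
  set p := (1 + (Polynomial.X : Polynomial ℝ) • B.map Polynomial.C).det.divX.divX
  have h := (((hasDerivAt_id (0 : ℝ)).const_mul B.trace).const_add 1).add
    ((p.hasDerivAt 0).mul ((hasDerivAt_id (0 : ℝ)).pow 2))
  refine h.congr_deriv ?_
  simp

/-- The volume density `|det w|^{1/2}`. -/
def volDensity (w : Arr2 n) : ℝ := √|(Matrix.of w).det|

lemma volDensity_pos {w : Arr2 n} (hw : (Matrix.of w).det ≠ 0) :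
    0 < volDensity w := Real.sqrt_pos.2 (abs_pos.2 hw)

lemma differentiableAt_volDensity {w : Arr2 n} (hw : (Matrix.of w).det ≠ 0) :
    DifferentiableAt ℝ volDensity w := by
  have h1 : DifferentiableAt ℝ (fun w : Arr2 n => (Matrix.of w).det) w :=
    contDiff_det.contDiffAt.differentiableAt (by simp)
  exact (DifferentiableAt.comp w (differentiableAt_abs hw) h1).sqrt (abs_ne_zero.2 hw)

lemma volDensity_change2 (A : Matrix (Fin n) (Fin n) ℝ) (w : Arr2 n) :
    volDensity (change2 A w) = |A.det| * volDensity w := by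
  unfold volDensity
  rw [det_change2, abs_mul, Real.sqrt_mul (abs_nonneg _), abs_pow, Real.sqrt_sq (abs_nonneg _)]

lemma change2_one_add_zero (B : Matrix (Fin n) (Fin n) ℝ) (w : Arr2 n) :
    change2 (1 + (0 : ℝ) • B) w = w := by
  rw [zero_smul, add_zero, change2_one]

/-- Jacobi's formula for the volume density. -/
lemma fderiv_volDensity {w : Arr2 n} (hw : (Matrix.of w).det ≠ 0) (B : Matrix (Fin n) (Fin n) ℝ) :
    fderiv ℝ volDensity w (infChange2 B w) = B.trace * volDensity w := by
  have h0 := change2_one_add_zero B w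
  -- Both sides are the derivative of `volDensity (change2 (1 + t B) w)` at `t = 0`.
  have h1 : HasDerivAt (fun t : ℝ => volDensity (change2 (1 + t • B) w))
    (fderiv ℝ volDensity w (infChange2 B w)) 0 := by
    have hd : HasFDerivAt volDensity (fderiv ℝ volDensity w) (change2 (1 + (0 : ℝ) • B) w) := by
      rw [h0]; exact (differentiableAt_volDensity hw).hasFDerivAt
    exact hd.comp_hasDerivAt 0 (hasDerivAt_change2 B w)
  have h2 : HasDerivAt (fun t : ℝ => volDensity (change2 (1 + t • B) w)) (B.trace * volDensity w)
    0 := by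
    have hdet := hasDerivAt_det_one_add_smul B
    have e : (fun t : ℝ => volDensity (change2 (1 + t • B) w)) =ᶠ[𝓝 0] fun t => (1 + t • B).det *
      volDensity w := by
      have : ∀ᶠ t in 𝓝 (0 : ℝ), 0 < (1 + t • B).det :=
        hdet.continuousAt.tendsto.eventually_const_lt (by simp)
      filter_upwards [this] with t ht
      rw [volDensity_change2, abs_of_pos ht]
    exact (hdet.mul_const _).congr_of_eventuallyEq e
  exact h1.unique h2

/-- The invariance of `β` differentiated along `1 + t B` at `t = 0`. -/
lemma IsVectorInvariant.infinitesimal {β : Arr2 n → Arr4 n} (hβ : IsVectorInvariant β) {w : Arr2 n}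
    (hw : IsLorentz w) (hd : DifferentiableAt ℝ β w) (B : Matrix (Fin n) (Fin n) ℝ) (D : Arr3 n)
      (c : Fin n) :
    ∑ m, B c m * contraction β w D m +
        (∑ i, ∑ j, ∑ k, fderiv ℝ β w (infChange2 B w) i j k c * D i j k) +
          ∑ i, ∑ j, ∑ k, β w i j k c * infChange3 B D i j k = 0 := by
  have h0 := change2_one_add_zero B w
  have hβd : HasDerivAt (fun t : ℝ => β (change2 (1 + t • B) w)) (fderiv ℝ β w (infChange2 B w))
    0 := by
    have hd : HasFDerivAt β (fderiv ℝ β w) (change2 (1 + (0 : ℝ) • B) w) := by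
      rw [h0]; exact hd.hasFDerivAt
    exact hd.comp_hasDerivAt 0 (hasDerivAt_change2 B w)
  have hX :
    ∀ m, HasDerivAt (fun t : ℝ => contraction β (change2 (1 + t • B) w) (change3 (1 + t • B) D) m)
      (∑ i, ∑ j, ∑ k, (fderiv ℝ β w (infChange2 B w) i j k m * D i j k + β w i j k m *
        infChange3 B D i j k)) 0 := by
    intro m
    have h := HasDerivAt.fun_sum (u := Finset.univ) fun i (_ : i ∈ Finset.univ) =>
      HasDerivAt.fun_sum (u := Finset.univ) fun j (_ : j ∈ Finset.univ) =>
      HasDerivAt.fun_sum (u := Finset.univ) fun k (_ : k ∈ Finset.univ) =>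
      (hasDerivAt_pi.1 (hasDerivAt_pi.1 (hasDerivAt_pi.1 (hasDerivAt_pi.1 hβd i) j) k) m).fun_mul
        (hasDerivAt_pi.1 (hasDerivAt_pi.1 (hasDerivAt_pi.1 (hasDerivAt_change3 B D) i) j) k)
    refine h.congr_deriv ?_
    rw [zero_smul, add_zero, change2_one, change3_one]
  have hlhs := HasDerivAt.fun_sum (u := Finset.univ) fun m (_ : m ∈ Finset.univ) =>
    (hasDerivAt_entry B c m).fun_mul (hX m)
  -- `1 + t B` is invertible for small `t`.
  have hev :
    (fun t : ℝ => ∑ m, ((1 : Matrix (Fin n) (Fin n) ℝ) + t • B) c m *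
      contraction β (change2 (1 + t • B) w) (change3 (1 + t • B) D) m) =ᶠ[𝓝 0] fun _ => contraction
        β w D c := by
    have : ∀ᶠ t in 𝓝 (0 : ℝ), 0 < (1 + t • B).det :=
      (hasDerivAt_det_one_add_smul B).continuousAt.tendsto.eventually_const_lt (by simp)
    filter_upwards [this] with t ht
    exact congrFun (hβ w hw _ ht.ne' D) c
  have huniq :=
    hlhs.unique ((hasDerivAt_const (0 : ℝ) (contraction β w D c)).congr_of_eventuallyEq hev)
  rw [zero_smul, add_zero, change2_one, change3_one] at huniq
  simp only [Matrix.one_apply, Finset.sum_add_distrib, ite_mul, one_mul, zero_mul,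
    Finset.sum_ite_eq, Finset.mem_univ, if_true] at huniq
  rw [← huniq]; ring

lemma fderiv_apply_single {G : Coord n → Arr2 n} {x : Coord n} (hG : DifferentiableAt ℝ G x)
    (l : Fin n) : fderiv ℝ G x (EuclideanSpace.single l 1) = fun i j => pd2 G x i j l := by
  ext i j
  have h := hasFDerivAt_pi'.1 (hasFDerivAt_pi'.1 hG.hasFDerivAt i) j
  simp only [pd2, pd]
  rw [h.fderiv]
  rfl

namespace IsLorentzGerm

variable {G : Coord n → Arr2 n} {x : Coord n}

lemma infChange2_leviCivita (h : IsLorentzGerm G x) (l : Fin n) :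
    infChange2 (fun a i => leviCivita G x a i l) (G x) = fun i j => pd2 G x i j l := by
  ext i j
  rw [← h.metricShift_leviCivita]; rfl

lemma pd_volDensity (h : IsLorentzGerm G x) (l : Fin n) :
    pd l (fun y => volDensity (G y)) x = (∑ a, leviCivita G x a a l) * volDensity (G x) := by
  have hd : HasFDerivAt (fun y => volDensity (G y)) _ x :=
    (differentiableAt_volDensity h.det_ne_zero).hasFDerivAt.comp x
      (h.contDiffAt.differentiableAt (by simp)).hasFDerivAt
  rw [pd, hd.fderiv, ContinuousLinearMap.comp_apply,
    fderiv_apply_single (h.contDiffAt.differentiableAt (by simp))]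
  have := fderiv_volDensity h.det_ne_zero (fun a i => leviCivita G x a i l)
  rw [h.infChange2_leviCivita] at this
  exact this

/-- The divergence of the vector field `β(g) D` is the contraction of `β(g)` with the covariant
derivative of `D`. -/
lemma divergence_contraction (h : IsLorentzGerm G x) {β : Arr2 n → Arr4 n}
    (hβ : IsVectorInvariant β) (hd : DifferentiableAt ℝ β (G x)) {D : Coord n → Arr3 n}
      (hD : ∀ i j k, DifferentiableAt ℝ (fun y => D y i j k) x) :
    divergence G (fun y => contraction β (G y) (D y)) x = ∑ i, ∑ j, ∑ k, ∑ l, β (G x) i j k l *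
        (pd3 D x - derivShift (D x) (leviCivita G x)) i j k l := by
  have hGd : DifferentiableAt ℝ G x := h.contDiffAt.differentiableAt (by simp)
  have hβc : ∀ i j k l, DifferentiableAt ℝ (fun y => β (G y) i j k l) x := fun i j k l =>
    differentiableAt_pi.1
      (differentiableAt_pi.1 (differentiableAt_pi.1 (differentiableAt_pi.1 (hd.comp x hGd) i) j) k)
        l
  have hβpd : ∀ i j k l m, pd m (fun y => β (G y) i j k l) x =
    fderiv ℝ β (G x) (fun i j => pd2 G x i j m) i j k l := by
    intro i j k l m
    have hc : HasFDerivAt (fun y => β (G y)) _ x := hd.hasFDerivAt.comp x hGd.hasFDerivAt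
    have := hasFDerivAt_pi'.1 (hasFDerivAt_pi'.1 (hasFDerivAt_pi'.1 (hasFDerivAt_pi'.1 hc i) j) k) l
    rw [← fderiv_apply_single hGd, pd, this.fderiv]
    rfl
  have hXd : ∀ l, DifferentiableAt ℝ (fun y => contraction β (G y) (D y) l) x := fun l =>
    DifferentiableAt.fun_sum fun i _ => DifferentiableAt.fun_sum fun j _ => DifferentiableAt.fun_sum
      fun k _ => (hβc i j k l).fun_mul (hD i j k)
  have hXpd : ∀ l, pd l (fun y => contraction β (G y) (D y) l) x = ∑ i, ∑ j, ∑ k, fderiv ℝ β (G x)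
    (fun i j => pd2 G x i j l) i j k l * D x i j k + ∑ i, ∑ j, ∑ k, β (G x) i j k l *
      pd3 D x i j k l := by
    intro l
    simp only [contraction]
    rw [pd_sum fun i _ => DifferentiableAt.fun_sum fun j _ => DifferentiableAt.fun_sum fun k
      _ => (hβc i j k l).fun_mul (hD i j k), ← Finset.sum_add_distrib]
    refine Finset.sum_congr rfl fun i _ => ?_
    rw [pd_sum fun j _ => DifferentiableAt.fun_sum fun k _ => (hβc i j k l).fun_mul (hD i j k),
      ← Finset.sum_add_distrib]
    refine Finset.sum_congr rfl fun j _ => ?_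
    rw [pd_sum fun k _ => (hβc i j k l).fun_mul (hD i j k), ← Finset.sum_add_distrib]
    refine Finset.sum_congr rfl fun k _ => ?_
    rw [pd_mul (hβc i j k l) (hD i j k), hβpd]; rfl
  have hVd : DifferentiableAt ℝ (fun y => volDensity (G y)) x :=
    (differentiableAt_volDensity h.det_ne_zero).comp x hGd
  have hV := (volDensity_pos h.det_ne_zero).ne'
  have hterm : ∀ l, (volDensity (G x))⁻¹ *
    pd l (fun y => volDensity (G y) * contraction β (G y) (D y) l) x =
      (∑ a, leviCivita G x a a l) * contraction β (G x) (D x) l + ∑ i, ∑ j, ∑ k, fderiv ℝ β (G x)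
        (fun i j => pd2 G x i j l) i j k l * D x i j k + ∑ i, ∑ j, ∑ k, β (G x) i j k l *
          pd3 D x i j k l := by
    intro l
    rw [pd_mul hVd (hXd l), h.pd_volDensity, hXpd]
    field_simp
    ring
  -- The matrix `B^a_i = Γ^a_{il}` changes the metric infinitesimally by `∂_l g`, so the
  -- differentiated invariance expresses the derivative of `β(g)` by undifferentiated terms.
  have hinf : ∀ l, ∑ i, ∑ j, ∑ k, fderiv ℝ β (G x) (fun i j => pd2 G x i j l) i j k l * D x i j k
      = - (∑ m, leviCivita G x l m l * contraction β (G x) (D x) m) - ∑ i, ∑ j, ∑ k, β (G x) i j k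
        l * derivShift (D x) (leviCivita G x) i j k l := by
    intro l
    have := hβ.infinitesimal h.isLorentz.self_of_nhds hd (fun a i => leviCivita G x a i l) (D x) l
    rw [h.infChange2_leviCivita] at this
    change _ + _ + ∑ i, ∑ j, ∑ k, β (G x) i j k l * derivShift (D x) (leviCivita G x) i j k l =
      0 at this
    linarith
  -- The derivative of the volume density cancels one of these terms.
  have htr : ∑ l, (∑ a, leviCivita G x a a l) * contraction β (G x) (D x) l =
    ∑ l, ∑ m, leviCivita G x l m l * contraction β (G x) (D x) m := by
    rw [Finset.sum_comm]
    refine Finset.sum_congr rfl fun m _ => ?_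
    rw [Finset.sum_mul]
    exact Finset.sum_congr rfl fun l _ => by rw [h.leviCivita_symm]
  have hrot : ∀ F : Fin n → Fin n → Fin n → Fin n → ℝ, ∑ i, ∑ j, ∑ k, ∑ l, F i j k l =
    ∑ l, ∑ i, ∑ j, ∑ k, F i j k l := by
    intro F
    rw [← sum4_swap34, ← sum4_swap23, ← sum4_swap12]
  change (volDensity (G x))⁻¹ * ∑ l, pd l (fun y => volDensity (G y) * contraction β (G y) (D y) l)
    x = _
  rw [Finset.mul_sum, hrot]
  simp only [hterm, hinf, Pi.sub_apply, mul_sub, Finset.sum_sub_distrib, Finset.sum_add_distrib,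
    htr, Finset.sum_neg_distrib]
  ring

end IsLorentzGerm

/-! ### The value of the Lagrangian at an arbitrary jet -/

lemma extDerivArr_sub (y z : Arr4 n) : extDerivArr (y - z) = extDerivArr y - extDerivArr z := by
  ext i j k l
  simp only [extDerivArr, antisymmPart, Pi.sub_apply]
  ring

lemma extDeriv3_antisymmPart {D : Coord n → Arr3 n} {x : Coord n}
    (hD : ∀ i j k, DifferentiableAt ℝ (fun y => D y i j k) x) :
    extDeriv3 (fun y => antisymmPart (D y)) x = extDerivArr (pd3 D x) := by
  have e : ∀ i j k l, pd l (fun y => antisymmPart (D y) i j k) x =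
    antisymmPart (fun a b c => pd3 D x a b c l) i j k := by
    intro i j k l
    have h1 := (hD i j k).fun_add (hD j k i)
    have h2 := h1.fun_add (hD k i j)
    have h3 := h2.fun_sub (hD j i k)
    have h4 := h3.fun_sub (hD i k j)
    have h5 := h4.fun_sub (hD k j i)
    have e : (fun y => antisymmPart (D y) i j k) = fun y =>
      (D y i j k + D y j k i + D y k i j - D y j i k - D y i k j - D y k j i) * (1 / 6) := by
      ext y; simp only [antisymmPart]; ring
    rw [e, pd_mul h5 (differentiableAt_const _), pd_const, pd_sub h4 (hD k j i),
      pd_sub h3 (hD i k j), pd_sub h2 (hD j i k), pd_add h1 (hD k i j),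
        pd_add (hD i j k) (hD j k i)]
    simp only [antisymmPart, pd3]; ring
  ext i j k l
  simp only [extDeriv3, extDerivArr, e]

/-- The jet of a metric and a connection in terms of the difference array. -/
lemma IsLorentzGerm.jet_eq {G : Coord n → Arr2 n} {C : Coord n → Arr3 n} {x : Coord n}
    (h : IsLorentzGerm G x) (hC : ∀ i j k, DifferentiableAt ℝ (fun y => C y i j k) x) :
    jet G C x = hatJet (G x) (pd2 G x) (pdd2 G x) (difference G C x) (pd3 (difference G C) x) := by
  have e1 : C x = difference G C x + lc3 (pd2 G x) := by
    ext i j k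
    simp only [difference, Pi.add_apply, ← IsLorentzGerm.leviCivitaLower_eq]; ring
  have e2 : pd3 C x = pd3 (difference G C) x + lc4 (pdd2 G x) := by
    ext i j k l
    have : pd3 (difference G C) x i j k l = pd3 C x i j k l - lc4 (pdd2 G x) i j k l := by
      rw [← h.pd_leviCivitaLower]
      exact pd_sub (hC i j k) (differentiableAt_of_contDiffAt (h.contDiffAt_leviCivitaLower i j k))
        l
    rw [Pi.add_apply, Pi.add_apply, Pi.add_apply, Pi.add_apply, this]; ring
  unfold hatJet
  rw [← e1, ← e2]
  rfl

/-- The conclusion for the components in a single chart. -/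
theorem exists_value_jet {L : JetSpace n → ℝ} (hL : ContDiffOn ℝ ∞ L (jetDomain n))
    (hquad : IsQuadratic L) (hinv : IsCoordinateInvariant L) :
    ∃ a b c : ℝ, ∀ (G : Coord n → Arr2 n) (C : Coord n → Arr3 n) (x : Coord n), IsLorentzGerm G x →
        (∀ i j k, ContDiffAt ℝ ∞ (fun y => C y i j k) x) →
      L (jet G C x) = a + b * scalarCurvature G x + c * normSq4 (G x)
          (extDeriv3 (fun y => antisymmPart (difference G C y)) x)
        + quadForm (muOf L) (G x) (difference G C x) +
            divergence G (fun y => contraction (betaOf L) (G y) (difference G C y)) x := by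
  obtain ⟨a, b, c, h⟩ := exists_value_normal_form hL hquad hinv
  refine ⟨a, b, c, fun G C x hG hC => ?_⟩
  have hw : IsLorentz (G x) := hG.isLorentz.self_of_nhds
  have hDd : ∀ i j k, DifferentiableAt ℝ (fun y => difference G C y i j k) x := fun i j k =>
    differentiableAt_of_contDiffAt ((hC i j k).sub (hG.contDiffAt_leviCivitaLower i j k))
  have hβd : DifferentiableAt ℝ (betaOf L) (G x) :=
    ((contDiffOn_betaOf hL).contDiffAt
      (isOpen_nondegenerate.mem_nhds hw.det_ne_zero)).differentiableAt (by simp)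
  set S := leviCivita G x with hS
  have hx : IsSymm4 (pdd2 G x - metricQuad (G x) S) := by
    have h1 := hG.isSymm4_pdd2
    have h2 := isSymm4_metricQuad hw.symm S
    exact ⟨fun i j k l => by simp only [Pi.sub_apply, h1.1 i j, h2.1 i j],
      fun i j k l => by simp only [Pi.sub_apply, h1.2 i j k, h2.2 i j k]⟩
  -- The shift by the Levi-Civita symbols leads from a jet with vanishing first derivatives of the
  -- metric to the given one.
  have hshift :=
    value_shift hinv hw hx (difference G C x)
      (pd3 (difference G C) x - derivShift (difference G C x) S) (S := S) (T := 0)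
        hG.leviCivita_symm (fun _ _ _ _ => rfl) (fun _ _ _ _ => rfl)
  rw [metricCubic_zero, add_zero, sub_add_cancel, sub_add_cancel, hS,
    hG.metricShift_leviCivita] at hshift
  rw [hG.jet_eq fun i j k => differentiableAt_of_contDiffAt (hC i j k), hshift, h _ hw _ hx,
    ← hG.scalarCurvature_eq, extDeriv3_antisymmPart hDd,
    hG.divergence_contraction (isVectorInvariant_betaOf hL hquad hinv) hβd hDd, extDerivArr_sub,
      extDerivArr_derivShift _ hG.leviCivita_symm, sub_zero]

/-! ### Smoothness of the components in the charts of a manifold -/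

section Smoothness

variable {M : Type*} [TopologicalSpace M] [ChartedSpace (Coord n) M]
  {e : OpenPartialHomeomorph M (Coord n)} {q : M}

lemma contMDiffAt_chart (he : e ∈ IsManifold.maximalAtlas (𝓡 n) ∞ M) (hq : q ∈ e.source) :
    ContMDiffAt (𝓡 n) (𝓡 n) ∞ e q :=
  contMDiffAt_of_mem_maximalAtlas he hq

lemma isInvertible_mfderiv_chart (he : e ∈ IsManifold.maximalAtlas (𝓡 n) ∞ M) (hq : q ∈ e.source) :
    (mfderiv (𝓡 n) (𝓡 n) e q).IsInvertible := by
  have h1 : e.MDifferentiable (𝓡 n) (𝓡 n) :=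
    ⟨(contMDiffOn_of_mem_maximalAtlas he).mdifferentiableOn (by simp),
      (contMDiffOn_symm_of_mem_maximalAtlas he).mdifferentiableOn (by simp)⟩
  exact ⟨h1.mfderiv hq, rfl⟩

lemma contDiffAt_comp_chart_symm (he : e ∈ IsManifold.maximalAtlas (𝓡 n) ∞ M) {f : M → ℝ}
    (hq : q ∈ e.source) (hf : ContMDiffAt (𝓡 n) 𝓘(ℝ, ℝ) ∞ f q) :
    ContDiffAt ℝ ∞ (fun y => f (e.symm y)) (e q) := by
  rw [← contMDiffAt_iff_contDiffAt]
  have hs : ContMDiffAt (𝓡 n) (𝓡 n) ∞ e.symm (e q) :=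
    contMDiffAt_symm_of_mem_maximalAtlas he (e.map_source hq)
  refine ContMDiffAt.comp (I' := 𝓡 n) (e q) ?_ hs
  rwa [e.left_inv hq]

variable [IsManifold (𝓡 n) ∞ M]

lemma contMDiffAt_coordField (he : e ∈ IsManifold.maximalAtlas (𝓡 n) ∞ M) (hq : q ∈ e.source)
    (i : Fin n) : ContMDiffAt (𝓡 n) ((𝓡 n).prod (𝓡 n)) ∞
      (fun p => Bundle.TotalSpace.mk' (Coord n) (E := fun p : M => TangentSpace (𝓡 n) p) p
        (coordField e i p)) q := by
  have hV : ContMDiffAt (𝓡 n) ((𝓡 n).prod (𝓡 n)) ∞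
      (fun p => Bundle.TotalSpace.mk' (Coord n) (E := fun p : Coord n => TangentSpace (𝓡 n) p) p
        (EuclideanSpace.single i 1 : Coord n)) (e q) := by
    exact contMDiffAt_vectorSpace_iff_contDiffAt.2 contDiffAt_const
  exact ContMDiffAt.mpullback_vectorField_preimage hV (contMDiffAt_chart he hq)
    (isInvertible_mfderiv_chart he hq) (by simp)

lemma contMDiffAt_metric_apply (g : LorentzMetric n M)
    {v w : ∀ p : M, TangentSpace (𝓡 n) p}
    (hv : ContMDiffAt (𝓡 n) ((𝓡 n).prod (𝓡 n)) ∞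
      (fun p => Bundle.TotalSpace.mk' (Coord n) (E := fun p : M => TangentSpace (𝓡 n) p) p (v p)) q)
    (hw : ContMDiffAt (𝓡 n) ((𝓡 n).prod (𝓡 n)) ∞
      (fun p => Bundle.TotalSpace.mk' (Coord n) (E := fun p : M => TangentSpace (𝓡 n) p) p (w p))
        q) :
    ContMDiffAt (𝓡 n) 𝓘(ℝ, ℝ) ∞ (fun p => g.val p (v p) (w p)) q := by
  have : ContMDiffAt (𝓡 n) ((𝓡 n).prod 𝓘(ℝ)) ∞
      (fun m ↦ Bundle.TotalSpace.mk' ℝ (E := Bundle.Trivial M ℝ) m (g.val m (v m) (w m))) q :=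
    ContMDiffAt.clm_bundle_apply₂ (F₁ := Coord n) (F₂ := Coord n) g.contMDiff.contMDiffAt hv hw
  simp only [Bundle.contMDiffAt_totalSpace] at this
  exact this.2

lemma isLorentz_metricComp (g : LorentzMetric n M) (he : e ∈ IsManifold.maximalAtlas (𝓡 n) ∞ M)
    (hq : q ∈ e.source) : IsLorentz (metricComp g e (e q)) := by
  obtain ⟨b, hb⟩ := g.lorentz q
  obtain ⟨T, hT⟩ := isInvertible_mfderiv_chart he hq
  have hT' : ContinuousLinearMap.inverse (mfderiv (𝓡 n) (𝓡 n) e q) = T.symm := by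
    rw [← hT]; exact ContinuousLinearMap.inverse_equiv T
  obtain ⟨c, hc⟩ : ∃ c : Module.Basis (Fin n) ℝ (TangentSpace (𝓡 n) q),
      ∀ i, coordField e i q = c i := by
    let T₀ : Coord n ≃ₗ[ℝ] TangentSpace (𝓡 n) q := T.symm.toLinearEquiv
    let c₀ : Module.Basis (Fin n) ℝ (Coord n) := (EuclideanSpace.basisFun (Fin n) ℝ).toBasis
    refine ⟨c₀.map T₀, fun i => ?_⟩
    have h1 : coordField e i q = T₀ (EuclideanSpace.single i 1) :=
      congrArg (fun S : TangentSpace (𝓡 n) (e q) →L[ℝ] TangentSpace (𝓡 n) q => S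
        (EuclideanSpace.single i 1 : Coord n)) hT'
    rw [h1]
    simp [c₀]
  have hexp : ∀ i, coordField e i q = ∑ a, b.toMatrix c a i • b a := fun i => by
    rw [hc, b.sum_toMatrix_smul_self c i]
  -- The coordinate fields form a basis `c`, and the change of basis from a Lorentz frame
  -- exhibits the matrix of components as Lorentz.
  refine ⟨b.toMatrix c, fun h0 => ?_, ?_⟩
  · have h1 := congrArg Matrix.det (b.toMatrix_mul_toMatrix_flip c)
    rw [Matrix.det_mul, h0, zero_mul, Matrix.det_one] at h1
    exact zero_ne_one h1
  · ext i j
    have h1 : metricComp g e (e q) i j = g.val q (coordField e i q) (coordField e j q) := by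
      unfold metricComp
      rw [e.left_inv hq]
    rw [h1, hexp i, hexp j]
    simp only [map_sum, map_smul, _root_.sum_apply,
      FunLike.coe_smul, Pi.smul_apply, smul_eq_mul, hb, change2, mul_assoc, Finset.mul_sum]
    rw [Finset.sum_comm]
    refine Finset.sum_congr rfl fun a _ => Finset.sum_congr rfl fun c _ => ?_
    ring

lemma isLorentzGerm_metricComp (g : LorentzMetric n M)
    (he : e ∈ IsManifold.maximalAtlas (𝓡 n) ∞ M) (hq : q ∈ e.source) :
    IsLorentzGerm (metricComp g e) (e q) := by
  have hmem : e.target ∈ 𝓝 (e q) := e.open_target.mem_nhds (e.map_source hq)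
  constructor
  · filter_upwards [hmem] with y hy
    have hp := e.map_target hy
    rw [contDiffAt_pi]; intro i
    rw [contDiffAt_pi]; intro j
    have := contDiffAt_comp_chart_symm he hp
      (contMDiffAt_metric_apply g (contMDiffAt_coordField he hp i) (contMDiffAt_coordField he hp j))
    rw [e.right_inv hy] at this
    exact this
  · filter_upwards [hmem] with y hy
    have := isLorentz_metricComp g he (e.map_target hy)
    rwa [e.right_inv hy] at this

/-- The covariant derivatives of the coordinate fields are smooth. The smoothness of a connection
concerns global sections, so the coordinate field is first cut off by a bump function. -/
lemma contMDiffAt_cov_coordField [T2Space M] (cov : AffineConnection n M)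
    [cov.ContMDiffCovariantDerivative ∞] (he : e ∈ IsManifold.maximalAtlas (𝓡 n) ∞ M)
    (hq : q ∈ e.source) (j : Fin n) :
    ContMDiffAt (𝓡 n) ((𝓡 n).prod 𝓘(ℝ, Coord n →L[ℝ] Coord n)) ∞
      (fun p => Bundle.TotalSpace.mk' (Coord n →L[ℝ] Coord n)
        (E := fun p : M => TangentSpace (𝓡 n) p →L[ℝ] TangentSpace (𝓡 n) p) p
        (cov (coordField e j) p)) q := by
  obtain ⟨χ, hχ⟩ : ∃ χ : SmoothBumpFunction (𝓡 n) q, tsupport χ ⊆ e.source := by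
    obtain ⟨χ, -, hχ⟩ := (SmoothBumpFunction.nhds_basis_tsupport (I := 𝓡 n) q).mem_iff.1
      (e.open_source.mem_nhds hq)
    exact ⟨χ, hχ⟩
  let σ : ∀ p : M, TangentSpace (𝓡 n) p := fun p => χ p • coordField e j p
  have hσ : ContMDiff (𝓡 n) ((𝓡 n).prod (𝓡 n)) ∞
      (fun p => Bundle.TotalSpace.mk' (Coord n) (E := fun p : M => TangentSpace (𝓡 n) p) p
        (σ p)) :=
    ContMDiffOn.smul_section_of_tsupport χ.contMDiff.contMDiffOn e.open_source hχ
      fun p hp => (contMDiffAt_coordField he hp j).contMDiffWithinAt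
  have hcov := (CovariantDerivative.ContMDiffCovariantDerivative.contMDiff
    (cov := cov) (k := ∞)).contMDiff (σ := σ) hσ.contMDiffOn
  rw [contMDiffOn_univ] at hcov
  refine (hcov q).congr_of_eventuallyEq ?_
  filter_upwards [χ.eventuallyEq_one.eventually_nhds, e.open_source.mem_nhds hq] with p hp hps
  have : cov (coordField e j) p = cov σ p := by
    refine cov.isCovariantDerivativeOn.congr_of_eventuallyEq
      ((contMDiffAt_coordField he hps j).mdifferentiableAt (by simp))
      ((hσ p).mdifferentiableAt (by simp)) Filter.univ_mem ?_
    filter_upwards [hp] with r hr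
    simp [σ, hr]
  rw [this]

lemma contDiffAt_connectionComp [T2Space M] (g : LorentzMetric n M) (cov : AffineConnection n M)
    [cov.ContMDiffCovariantDerivative ∞] (he : e ∈ IsManifold.maximalAtlas (𝓡 n) ∞ M)
    (hq : q ∈ e.source) (i j k : Fin n) :
    ContDiffAt ℝ ∞ (fun y => connectionComp g cov e y i j k) (e q) := by
  refine contDiffAt_comp_chart_symm he hq (f := fun p => g.val p (cov (coordField e j) p
    (coordField e i p)) (coordField e k p)) ?_
  refine contMDiffAt_metric_apply g ?_ (contMDiffAt_coordField he hq k)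
  exact (contMDiffAt_cov_coordField cov he hq j).clm_bundle_apply (contMDiffAt_coordField he hq i)

end Smoothness

end BrayLagrangian

end

theorem corollary3p4 (n : ℕ) (L : JetSpace n → ℝ)
    (hL : ContDiffOn ℝ ∞ L (jetDomain n)) (hquad : IsQuadratic L)
    (hinv : ∀ (M : Type) [TopologicalSpace M] [T2Space M] [SecondCountableTopology M]
      [ChartedSpace (Coord n) M] [IsManifold (𝓡 n) ∞ M]
      (g : LorentzMetric n M) (cov : AffineConnection n M)
      [cov.ContMDiffCovariantDerivative ∞],
      ∃ f : M → ℝ, ContMDiff (𝓡 n) 𝓘(ℝ, ℝ) ∞ f ∧ IsGivenBy L g cov f) :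
    ∃ (a b c : ℝ) (μ : Arr2 n → Fin n → Fin n → Fin n → Arr3 n) (β : Arr2 n → Arr4 n),
      ContDiffOn ℝ ∞ μ (nondegenerate n) ∧ IsQuadraticInvariant μ ∧
      ContDiffOn ℝ ∞ β (nondegenerate n) ∧ IsVectorInvariant β ∧
      ∀ (M : Type) [TopologicalSpace M] [T2Space M] [SecondCountableTopology M]
        [ChartedSpace (Coord n) M] [IsManifold (𝓡 n) ∞ M]
        (g : LorentzMetric n M) (cov : AffineConnection n M)
        [cov.ContMDiffCovariantDerivative ∞] (f : M → ℝ), IsGivenBy L g cov f →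
        ∀ e ∈ IsManifold.maximalAtlas (𝓡 n) ∞ M, ∀ p ∈ e.source,
          let G := metricComp g e
          let D := difference G (connectionComp g cov e)
          f p = a + b * scalarCurvature G (e p)
            + c * normSq4 (G (e p)) (extDeriv3 (fun y => antisymmPart (D y)) (e p))
            + quadForm μ (G (e p)) (D (e p))
            + divergence G (fun y => contraction β (G y) (D y)) (e p) := by
  obtain ⟨a, b, c, h⟩ := exists_value_jet hL hquad hinv
  refine ⟨a, b, c, muOf L, betaOf L, contDiffOn_muOf hL, isQuadraticInvariant_muOf hL hquad hinv,
    contDiffOn_betaOf hL, isVectorInvariant_betaOf hL hquad hinv, ?_⟩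
  intro M _ _ _ _ _ g cov _ f hf e he p hp
  rw [← hf e he p hp]
  exact h _ _ _ (isLorentzGerm_metricComp g he hp) fun i j k =>
    contDiffAt_connectionComp g cov he hp i j k
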